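/- **Model.** An algorithm is a program of a random access machine with uniform cost: it has finitely many registers and finitely many arrays of natural numbers (array cells are addressed by computed values); its elementary operations, each counted as one step, are loading a constant, reading or writing a register or an array cell, addition, truncated subtraction, comparison, and the tests that control branching and while-loops. An instance consists of a finite connected simple graph $G$ with vertices $0,\dots,n-1$, given by $n$ and its adjacency matrix, and a number $k\in\mathbb N=\{0,1,2,\dots\}$; all memory not used for the input is initially $0$. **Problem (MESP, Minimum Eccentricity Shortest Path).** Given $(G,k)$, decide whether $G$ has a path $P$ that is a shortest path between its endpoints and satisfies $\mathrm{ecc}_G(P)\le k$, where $\mathrm{ecc}_G(P)=\max_{u\in V(G)}\min_{p\in V(P)}d_G(u,p)$. **Parameter.** The distance to disjoint paths of $G$ is the least size $c$ of a set $X\subseteq V(G)$ such that $G\setminus X$ is a vertex-disjoint union of (possibly no) paths, that is, every connected component of $G\setminus X$ is a path (a single vertex is a path). **Theorem.** There are one algorithm and one absolute constant $B$ such that, for every $n\ge 1$, every connected graph $G$ on $n$ vertices and every $k\in\mathbb N$, the algorithm, given only $(G,k)$, halts with the correct answer to MESP ($1$ for yes, $0$ for no) after at most $$B\cdot 2^{5c}\cdot\max(k,1)^{c}\cdot\max(c,1)\cdot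 n^4$$ steps, where $c$ is the distance to disjoint paths of $G$. In particular, for $k,c\ge 1$, MESP is solved in $\mathcal O(2^{5c}k^{c}c\cdot n^4)$ time. -/

import Mathlib

/-! ### Random access machine with uniform (unit) cost

Structured programs over finitely many registers and arrays of natural numbers.  The only arithmetic
is addition, truncated subtraction and comparison, and every elementary operation is one step. -/

namespace RAM

/-- Memory: registers `reg r` and arrays `arr a` with cells `arr a i`.  A program names its registers
and arrays statically; cells of arrays are addressed by computed values. -/
structure Memory where
  reg : ℕ → ℕ
  arr : ℕ → ℕ → ℕ

/-- Expressions: constants, registers, array cells, addition, truncated subtraction, comparison. -/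
inductive Expr : Type
  | lit (m : ℕ) : Expr
  | reg (r : ℕ) : Expr
  | get (a : ℕ) (i : Expr) : Expr
  | add (x y : Expr) : Expr
  | sub (x y : Expr) : Expr
  | lt (x y : Expr) : Expr

/-- Value of an expression; a comparison has value `1` if it holds and `0` otherwise. -/
def Expr.eval (M : Memory) : Expr → ℕ
  | .lit m => m
  | .reg r => M.reg r
  | .get a i => M.arr a (i.eval M)
  | .add x y => x.eval M + y.eval M
  | .sub x y => x.eval M - y.eval M
  | .lt x y => if x.eval M < y.eval M then 1 else 0

/-- Number of elementary operations performed when an expression is evaluated. -/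
def Expr.cost : Expr → ℕ
  | .lit _ => 1
  | .reg _ => 1
  | .get _ i => i.cost + 1
  | .add x y => x.cost + y.cost + 1
  | .sub x y => x.cost + y.cost + 1
  | .lt x y => x.cost + y.cost + 1

/-- Programs. -/
inductive Prog : Type
  | skip : Prog
  | assign (r : ℕ) (e : Expr) : Prog
  | put (a : ℕ) (i e : Expr) : Prog
  | seq (p q : Prog) : Prog
  | ite (e : Expr) (p q : Prog) : Prog
  | while (e : Expr) (p : Prog) : Prog

/-- Write `v` to register `r`. -/
def Memory.setReg (M : Memory) (r v : ℕ) : Memory :=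
  { M with reg := Function.update M.reg r v }

/-- Write `v` to cell `i` of array `a`. -/
def Memory.setArr (M : Memory) (a i v : ℕ) : Memory :=
  { M with arr := Function.update M.arr a (Function.update (M.arr a) i v) }

/-- `Exec p M t M'`: started with memory `M`, the program `p` halts after exactly `t` steps with
memory `M'`. A guard is true if its value is not `0`. -/
inductive Exec : Prog → Memory → ℕ → Memory → Prop
  | skip (M : Memory) : Exec .skip M 1 M
  | assign (M : Memory) (r : ℕ) (e : Expr) :
      Exec (.assign r e) M (e.cost + 1) (M.setReg r (e.eval M))
  | put (M : Memory) (a : ℕ) (i e : Expr) :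
      Exec (.put a i e) M (i.cost + e.cost + 1) (M.setArr a (i.eval M) (e.eval M))
  | seq {p q : Prog} {M₁ M₂ M₃ : Memory} {t₁ t₂ : ℕ} :
      Exec p M₁ t₁ M₂ → Exec q M₂ t₂ M₃ → Exec (.seq p q) M₁ (t₁ + t₂) M₃
  | ite_true {e : Expr} {p q : Prog} {M M' : Memory} {t : ℕ} :
      e.eval M ≠ 0 → Exec p M t M' → Exec (.ite e p q) M (e.cost + 1 + t) M'
  | ite_false {e : Expr} {p q : Prog} {M M' : Memory} {t : ℕ} :
      e.eval M = 0 → Exec q M t M' → Exec (.ite e p q) M (e.cost + 1 + t) M'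
  | while_true {e : Expr} {p : Prog} {M₁ M₂ M₃ : Memory} {t₁ t₂ : ℕ} :
      e.eval M₁ ≠ 0 → Exec p M₁ t₁ M₂ → Exec (.while e p) M₂ t₂ M₃ →
      Exec (.while e p) M₁ (e.cost + 1 + t₁ + t₂) M₃
  | while_false {e : Expr} {p : Prog} {M : Memory} :
      e.eval M = 0 → Exec (.while e p) M (e.cost + 1) M

end RAM

/-! ### Minimum eccentricity shortest paths -/

namespace MESP

/-- `d_G(u, S)`, the minimum of `d_G(u, s)` over `s ∈ S` (used for nonempty `S`). -/
noncomputable def distToSet {V : Type*} (G : SimpleGraph V) (u : V) (S : Set V) : ℕ :=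
  sInf ((fun s => G.dist u s) '' S)

/-- The eccentricity of `S`, the maximum of `d_G(u, S)` over all vertices `u`. -/
noncomputable def ecc {V : Type*} [Fintype V] (G : SimpleGraph V) (S : Set V) : ℕ :=
  Finset.univ.sup fun u => distToSet G u S

/-- `P` has the least length among all paths with the same endpoints. -/
def IsShortest {V : Type*} {G : SimpleGraph V} {u v : V} (P : G.Walk u v) : Prop :=
  P.IsPath ∧ ∀ Q : G.Walk u v, Q.IsPath → P.length ≤ Q.length

/-- The instance `(G, k)` is a yes-instance: some path of `G` is a shortest path between its
endpoints and has eccentricity at most `k`. -/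
def IsYes {V : Type*} [Fintype V] (G : SimpleGraph V) (k : ℕ) : Prop :=
  ∃ (u v : V) (P : G.Walk u v), IsShortest P ∧ ecc G {x | x ∈ P.support} ≤ k

/-- Every connected component of `H` is a path. -/
def IsDisjointPaths {V : Type*} (H : SimpleGraph V) : Prop :=
  ∀ K : H.ConnectedComponent,
    ∃ m : ℕ, Nonempty (H.induce K.supp ≃g SimpleGraph.pathGraph m)

/-- Deleting `X` from `G` leaves a vertex-disjoint union of paths. -/
def IsModulator {V : Type*} (G : SimpleGraph V) (X : Finset V) : Prop :=
  IsDisjointPaths (G.induce {v | v ∉ X})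

/-- The distance to disjoint paths: the least size of a modulator (all vertices form one, if `V` is
finite). -/
noncomputable def distToDisjointPaths {V : Type*} (G : SimpleGraph V) : ℕ :=
  sInf {s | ∃ X : Finset V, IsModulator G X ∧ X.card = s}

open Classical in
/-- Initial memory: `n` in register `0`, `k` in register `1`, the adjacency matrix of `G` row by row
in array `0`, and `0` everywhere else. -/
noncomputable def input {n : ℕ} (G : SimpleGraph (Fin n)) (k : ℕ) : RAM.Memory where
  reg r := if r = 0 then n else if r = 1 then k else 0
  arr a x := if a = 0 ∧ ∃ i j : Fin n, x = i.val * n + j.val ∧ G.Adj i j then 1 else 0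

end MESP

/-! Suppose that at most c vertices have been removed and that the others form a `Layout`: a list in
which only consecutive vertices can be adjacent. Let k > 0, and let P be a shortest path of
eccentricity at most k. Guess its endpoints u, v and the distance from P, at most k, of every
removed vertex. These are n²(k+1)^c guesses. Removed vertices and endpoints are called special; the
endpoints have distance 0.

A vertex w with d(w, x) + e(x) ≤ k for some special x is within k of P automatically, so only the
other, uncovered, vertices matter. Split the layout into blocks at non-adjacent neighbours and at
breaks, that is, vertices in the closed neighbourhood of a special vertex with e = 0; the guess
determines these blocks. An uncovered vertex within k of P lies on P or reaches it along the layout,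
in one of two directions, at a break at distance exactly k (`Setting.trichotomy`). Hence it suffices
to check the first two uncovered vertices of each block (`Setting.covered_of_reps`). Conversely,
each gap between consecutive special vertices of P accounts for at most four of these
representatives: two on P and one in each direction (`Setting.card_reps_le`). If z of the c + 2
special indices have e = 0, this leaves at most (c + 2 - z) + 4(z - 1) ≤ 4c + 4 requirements of the
form "P comes within r of w".

For one guess, dynamic programming over subsets of requirements along increasing distance from u
(`reach_iff`) takes O(2^(4c) (c+1) n²) steps. Over all guesses this is O((k+1)^c 16^c (c+1) n⁴), and
(k+1)^c ≤ 2^c max(k,1)^c produces the factor 2^(5c). A confirmed guess always yields a good path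
(`hasGeodesic_of_confirmed`), and a good path always yields a confirmed guess (`exists_confirmed`).
For k = 0 the path contains all vertices, which means d(u, v) + 1 = n.

The layout comes from two facts about a modulator X: it meets every vertex set formed by a vertex
and three of its neighbours, and every subgraph of minimum degree at least two
(`meets_of_isModulator`). Branching four ways on such claws reaches maximum degree two, and some
branch removes only vertices of X (`exists_digits`). A greedy procedure then lays out the rest and
removes a vertex only if every remaining vertex has two remaining neighbours; these removals are
charged to further vertices of X (`Partial.remove`, `Partial.le_card`). Trying all strings of length
0, 1, …, c costs O((c+1)² 4^c n³), which is O(16^c n³). -/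

/-! ### Reasoning about programs of the random access machine -/

namespace RAM

infixr:60 " ;; " => Prog.seq

/-- Started in `M`, the program `p` halts within `t` steps in a memory satisfying `Q`. -/
def Runs (p : Prog) (M : Memory) (t : ℕ) (Q : Memory → Prop) : Prop :=
  ∃ t' ≤ t, ∃ M', Exec p M t' M' ∧ Q M'

/-- Does the program contain an assignment to register `r`? -/
def Prog.writesReg : Prog → ℕ → Bool
  | .skip, _ => false
  | .assign r _, x => r == x
  | .put _ _ _, _ => false
  | .seq p q, x => p.writesReg x || q.writesReg x
  | .ite _ p q, x => p.writesReg x || q.writesReg x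
  | .while _ p, x => p.writesReg x

/-- Does the program contain an assignment to a cell of array `a`? -/
def Prog.writesArr : Prog → ℕ → Bool
  | .skip, _ => false
  | .assign _ _, _ => false
  | .put a _ _, x => a == x
  | .seq p q, x => p.writesArr x || q.writesArr x
  | .ite _ p q, x => p.writesArr x || q.writesArr x
  | .while _ p, x => p.writesArr x

/-- The memories agree outside of the registers and arrays which `p` writes to. -/
structure Frame (p : Prog) (M M' : Memory) : Prop where
  reg : ∀ r, p.writesReg r = false → M'.reg r = M.reg r
  arr : ∀ a, p.writesArr a = false → M'.arr a = M.arr a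

@[simp] theorem Memory.setReg_reg (M : Memory) (r v x : ℕ) :
    (M.setReg r v).reg x = if x = r then v else M.reg x := by
  simp [Memory.setReg, Function.update_apply]

@[simp] theorem Memory.setReg_arr (M : Memory) (r v : ℕ) : (M.setReg r v).arr = M.arr := rfl

@[simp] theorem Memory.setArr_reg (M : Memory) (a i v : ℕ) : (M.setArr a i v).reg = M.reg := rfl

theorem Memory.setArr_arr (M : Memory) (a i v b : ℕ) :
    (M.setArr a i v).arr b = if b = a then Function.update (M.arr a) i v else M.arr b := by
  simp [Memory.setArr, Function.update_apply]

@[simp] theorem Memory.setArr_arr_self (M : Memory) (a i v : ℕ) :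
    (M.setArr a i v).arr a = Function.update (M.arr a) i v := by
  simp [Memory.setArr_arr]

@[simp] theorem Memory.setArr_arr_of_ne (M : Memory) {a b : ℕ} (i v : ℕ) (h : b ≠ a) :
    (M.setArr a i v).arr b = M.arr b := by
  simp [Memory.setArr_arr, h]

/-- Since `writesReg` and `writesArr` compute, this turns "the program does not touch this register"
into a proof by `rfl` or `decide`. All later correctness proofs carry facts across subprograms in
this way. -/
theorem Exec.frame {p : Prog} {M M' : Memory} {t : ℕ} (h : Exec p M t M') : Frame p M M' := by
  induction h with
  | skip M => exact ⟨fun _ _ => rfl, fun _ _ => rfl⟩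
  | assign M r e =>
    refine ⟨fun x hx => ?_, fun _ _ => rfl⟩
    have : x ≠ r := by
      rintro rfl
      simp [Prog.writesReg] at hx
    simp [this]
  | put M a i e =>
    refine ⟨fun _ _ => rfl, fun x hx => ?_⟩
    have : x ≠ a := by
      rintro rfl
      simp [Prog.writesArr] at hx
    simp [this]
  | seq _ _ h1 h2 =>
    refine ⟨fun x hx => ?_, fun x hx => ?_⟩
    · simp only [Prog.writesReg, Bool.or_eq_false_iff] at hx
      rw [h2.reg x hx.2, h1.reg x hx.1]
    · simp only [Prog.writesArr, Bool.or_eq_false_iff] at hx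
      rw [h2.arr x hx.2, h1.arr x hx.1]
  | ite_true _ _ h =>
    refine ⟨fun x hx => ?_, fun x hx => ?_⟩
    · simp only [Prog.writesReg, Bool.or_eq_false_iff] at hx
      exact h.reg x hx.1
    · simp only [Prog.writesArr, Bool.or_eq_false_iff] at hx
      exact h.arr x hx.1
  | ite_false _ _ h =>
    refine ⟨fun x hx => ?_, fun x hx => ?_⟩
    · simp only [Prog.writesReg, Bool.or_eq_false_iff] at hx
      exact h.reg x hx.2
    · simp only [Prog.writesArr, Bool.or_eq_false_iff] at hx
      exact h.arr x hx.2
  | while_true _ _ _ h1 h2 =>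
    refine ⟨fun x hx => ?_, fun x hx => ?_⟩
    · rw [h2.reg x hx, h1.reg x hx]
    · rw [h2.arr x hx, h1.arr x hx]
  | while_false _ => exact ⟨fun _ _ => rfl, fun _ _ => rfl⟩

theorem Frame.trans {p : Prog} {M₁ M₂ M₃ : Memory} (h : Frame p M₁ M₂) (h' : Frame p M₂ M₃) :
    Frame p M₁ M₃ :=
  ⟨fun r hr => (h'.reg r hr).trans (h.reg r hr), fun a ha => (h'.arr a ha).trans (h.arr a ha)⟩

namespace Runs

variable {p q : Prog} {M : Memory} {t t₁ t₂ : ℕ} {Q R : Memory → Prop} {e : Expr}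

theorem mono (h : Runs p M t₁ Q) (ht : t₁ ≤ t) (hQ : ∀ M', Q M' → R M') : Runs p M t R := by
  obtain ⟨t', h1, M', h2, h3⟩ := h
  exact ⟨t', h1.trans ht, M', h2, hQ _ h3⟩

theorem time (h : Runs p M t₁ Q) (ht : t₁ ≤ t) : Runs p M t Q := h.mono ht fun _ h => h

theorem frame (h : Runs p M t Q) : Runs p M t fun M' => Q M' ∧ Frame p M M' := by
  obtain ⟨t', h1, M', h2, h3⟩ := h
  exact ⟨t', h1, M', h2, h3, h2.frame⟩

theorem post (h : Runs p M t Q) (hQ : ∀ M', Q M' → Frame p M M' → R M') : Runs p M t R :=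
  h.frame.mono le_rfl fun M' h => hQ M' h.1 h.2

theorem skip (h : Q M) : Runs .skip M 1 Q := ⟨1, le_rfl, M, .skip M, h⟩

theorem assign {r : ℕ} (h : Q (M.setReg r (e.eval M))) : Runs (.assign r e) M (e.cost + 1) Q :=
  ⟨_, le_rfl, _, .assign M r e, h⟩

theorem put {a : ℕ} {i : Expr} (h : Q (M.setArr a (i.eval M) (e.eval M))) :
    Runs (.put a i e) M (i.cost + e.cost + 1) Q :=
  ⟨_, le_rfl, _, .put M a i e, h⟩

theorem seq (h : Runs p M t₁ Q) (h' : ∀ M', Q M' → Frame p M M' → Runs q M' t₂ R) :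
    Runs (p ;; q) M (t₁ + t₂) R := by
  obtain ⟨t', h1, M', h2, h3⟩ := h
  obtain ⟨t'', h4, M'', h5, h6⟩ := h' M' h3 h2.frame
  exact ⟨t' + t'', by omega, M'', .seq h2 h5, h6⟩

theorem assign_seq {r : ℕ} (h : Runs q (M.setReg r (e.eval M)) t Q) :
    Runs (.assign r e ;; q) M (e.cost + 1 + t) Q := by
  obtain ⟨t'', h4, M'', h5, h6⟩ := h
  exact ⟨_ + t'', by omega, M'', .seq (.assign M r e) h5, h6⟩

theorem put_seq {a : ℕ} {i : Expr} (h : Runs q (M.setArr a (i.eval M) (e.eval M)) t Q) :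
    Runs (.put a i e ;; q) M (i.cost + e.cost + 1 + t) Q := by
  obtain ⟨t'', h4, M'', h5, h6⟩ := h
  exact ⟨_ + t'', by omega, M'', .seq (.put M a i e) h5, h6⟩

theorem ite (h : e.eval M ≠ 0 → Runs p M t Q) (h' : e.eval M = 0 → Runs q M t Q) :
    Runs (.ite e p q) M (e.cost + 1 + t) Q := by
  by_cases he : e.eval M = 0
  · obtain ⟨t', h1, M', h2, h3⟩ := h' he
    exact ⟨_, by omega, M', .ite_false he h2, h3⟩
  · obtain ⟨t', h1, M', h2, h3⟩ := h he
    exact ⟨_, by omega, M', .ite_true he h2, h3⟩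

/-- A loop that executes its body at most `N` times. -/
theorem whileLoop {N tb : ℕ} {Inv : ℕ → Memory → Prop} (h0 : Inv 0 M)
    (hb : ∀ j M', Frame (.while e p) M M' → Inv j M' → e.eval M' ≠ 0 →
      j < N ∧ Runs p M' tb (Inv (j + 1))) :
    Runs (.while e p) M (N * (e.cost + 1 + tb) + (e.cost + 1))
      fun M' => ∃ j ≤ N, Inv j M' ∧ e.eval M' = 0 := by
  -- Induction on the number d of iterations still allowed. The frame always refers to the memory
  -- before the loop, so that facts about untouched registers are available in every iteration.
  have key : ∀ d j M', d + j = N → Frame (.while e p) M M' → Inv j M' →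
      Runs (.while e p) M' (d * (e.cost + 1 + tb) + (e.cost + 1))
        fun M' => ∃ j ≤ N, Inv j M' ∧ e.eval M' = 0 := by
    intro d
    induction d with
    | zero =>
      intro j M' hd hF hI
      have he : e.eval M' = 0 := by
        by_contra he
        have := (hb j M' hF hI he).1
        omega
      exact ⟨_, by omega, M', .while_false he, j, by omega, hI, he⟩
    | succ d ih =>
      intro j M' hd hF hI
      by_cases he : e.eval M' = 0
      · exact ⟨_, by nlinarith, M', .while_false he, j, by omega, hI, he⟩
      · obtain ⟨t', h1, M'', h2, h3⟩ := (hb j M' hF hI he).2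
        obtain ⟨t'', h4, M3, h5, h6⟩ := ih (j + 1) M'' (by omega)
          (hF.trans ⟨h2.frame.reg, h2.frame.arr⟩) h3
        exact ⟨_, by nlinarith, M3, .while_true he h2 h5, h6⟩
  exact key N 0 M (by omega) ⟨fun _ _ => rfl, fun _ _ => rfl⟩ h0

end Runs

/-- `for i := 0 to N - 1 do p` -/
def Prog.forLoop (i : ℕ) (N : Expr) (p : Prog) : Prog :=
  .assign i (.lit 0) ;; .while (.lt (.reg i) N) (p ;; .assign i (.add (.reg i) (.lit 1)))

/-- The bound N is evaluated anew at every test, hence the hypothesis that its value is stable under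
everything the loop writes. The invariant after the body is stated for the already incremented
counter. -/
theorem Runs.forLoop {i n tb : ℕ} {N : Expr} {p : Prog} {M : Memory} (Inv : ℕ → Memory → Prop)
    (hi : p.writesReg i = false)
    (hN : ∀ M', Frame (.forLoop i N p) M M' → N.eval M' = n)
    (h0 : Inv 0 (M.setReg i 0))
    (hb : ∀ j < n, ∀ M', Frame (.forLoop i N p) M M' → M'.reg i = j → Inv j M' →
      Runs p M' tb fun M'' => Inv (j + 1) (M''.setReg i (j + 1))) :
    Runs (.forLoop i N p) M (n * (tb + N.cost + 8) + (N.cost + 6)) fun M' => Inv n M' ∧ M'.reg i = n := by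
  unfold Prog.forLoop
  have hF0 : Frame (.forLoop i N p) M (M.setReg i 0) := by
    refine ⟨fun r hr => ?_, fun _ _ => rfl⟩
    have : r ≠ i := by
      rintro rfl
      simp [Prog.forLoop, Prog.writesReg] at hr
    simp [this]
  have hFw : ∀ M', Frame (.while (.lt (.reg i) N) (p ;; .assign i (.add (.reg i) (.lit 1))))
      (M.setReg i 0) M' → Frame (.forLoop i N p) M M' := by
    refine fun M' hF => hF0.trans ⟨fun r hr => ?_, fun a ha => ?_⟩
    · refine hF.reg r ?_
      simp [Prog.forLoop, Prog.writesReg] at hr ⊢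
      tauto
    · refine hF.arr a ?_
      simp [Prog.forLoop, Prog.writesArr] at ha ⊢
      tauto
  refine Runs.time (Runs.assign_seq (t := n * ((Expr.lt (.reg i) N).cost + 1 + (tb + 4)) +
    ((Expr.lt (.reg i) N).cost + 1)) ?_) ?_
  · refine Runs.post (Runs.whileLoop (N := n) (tb := tb + 4)
      (Inv := fun j M' => j ≤ n ∧ M'.reg i = j ∧ Inv j M') ⟨Nat.zero_le _, ?_, ?_⟩ ?_) ?_
    · simp [Expr.eval]
    · simpa [Expr.eval] using h0
    · rintro j M' hF ⟨hj, hr, hI⟩ hg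
      have hF' := hFw M' hF
      have hlt : j < n := by
        have := hN M' hF'
        by_contra h
        simp [Expr.eval, hr, this, h] at hg
      refine ⟨hlt, Runs.seq (hb j hlt M' hF' hr hI) fun M'' hI' hF'' => ?_⟩
      refine Runs.assign ?_
      have : M''.reg i = j := by rw [hF''.reg i hi, hr]
      simp only [Expr.eval, this]
      exact ⟨by omega, by simp, hI'⟩
    · rintro M' ⟨j, hj, ⟨hj', hr, hI⟩, he⟩ hF
      have hjn : j = n := by
        by_contra hne
        have := hN M' (hFw M' hF)
        have hlt : j < n := by omega
        simp [Expr.eval, hr, this, hlt] at he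
      subst hjn
      exact ⟨hI, hr⟩
  · simp only [Expr.cost]
    nlinarith

/-! ### Boolean expressions -/

namespace Expr

/-- Negation. -/
def not (a : Expr) : Expr := .sub (.lit 1) a

/-- Disjunction. -/
def or (a b : Expr) : Expr := .add a b

/-- Conjunction. -/
def and (a b : Expr) : Expr := not (or (not a) (not b))

/-- Equality. -/
def eq (a b : Expr) : Expr := not (or (.sub a b) (.sub b a))

variable (a b : Expr) (M : Memory)

@[simp] theorem eval_lit (m : ℕ) : (lit m).eval M = m := rfl
@[simp] theorem eval_reg (r : ℕ) : (reg r).eval M = M.reg r := rfl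
@[simp] theorem eval_get (x : ℕ) : (get x a).eval M = M.arr x (a.eval M) := rfl
@[simp] theorem eval_add : (add a b).eval M = a.eval M + b.eval M := rfl
@[simp] theorem eval_sub : (sub a b).eval M = a.eval M - b.eval M := rfl
@[simp] theorem cost_lit (m : ℕ) : (lit m).cost = 1 := rfl
@[simp] theorem cost_reg (r : ℕ) : (reg r).cost = 1 := rfl
@[simp] theorem cost_get (x : ℕ) : (get x a).cost = a.cost + 1 := rfl
@[simp] theorem cost_add : (add a b).cost = a.cost + b.cost + 1 := rfl
@[simp] theorem cost_sub : (sub a b).cost = a.cost + b.cost + 1 := rfl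
@[simp] theorem cost_lt : (lt a b).cost = a.cost + b.cost + 1 := rfl

-- Guards only distinguish zero from nonzero, and a sum used as a disjunction may exceed 1. Each
-- connective is therefore characterised by when it vanishes.
@[simp] theorem lt_eq_zero : (lt a b).eval M = 0 ↔ ¬ a.eval M < b.eval M := by
  simp [eval]

@[simp] theorem not_eq_zero : (not a).eval M = 0 ↔ ¬ a.eval M = 0 := by
  simp [not]
  omega

@[simp] theorem or_eq_zero : (or a b).eval M = 0 ↔ a.eval M = 0 ∧ b.eval M = 0 := by
  simp [or]

@[simp] theorem and_eq_zero : (and a b).eval M = 0 ↔ a.eval M = 0 ∨ b.eval M = 0 := by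
  rw [and, not_eq_zero, or_eq_zero, not_eq_zero, not_eq_zero]
  tauto

@[simp] theorem eq_eq_zero : (eq a b).eval M = 0 ↔ ¬ a.eval M = b.eval M := by
  simp only [eq, not_eq_zero, or_eq_zero, eval_sub]
  omega

@[simp] theorem cost_not : (not a).cost = a.cost + 2 := by
  simp [not]
  omega

@[simp] theorem cost_or : (or a b).cost = a.cost + b.cost + 1 := rfl

@[simp] theorem cost_and : (and a b).cost = a.cost + b.cost + 7 := by
  simp [and]
  omega

@[simp] theorem cost_eq : (eq a b).cost = 2 * a.cost + 2 * b.cost + 5 := by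
  simp [eq]
  omega

end Expr

/-! ### Linear search -/

open Classical in
/-- The largest `i < N` with `φ i`, or `d` if there is none. -/
noncomputable def lastBelow (φ : ℕ → Prop) (d : ℕ) : ℕ → ℕ
  | 0 => d
  | N + 1 => if φ N then N else lastBelow φ d N

/-- The largest `i < N` with `φ i`, or `N` if there is none. -/
noncomputable def lastIdx (N : ℕ) (φ : ℕ → Prop) : ℕ := lastBelow φ N N

theorem lastBelow_spec (φ : ℕ → Prop) (d N : ℕ) :
    (lastBelow φ d N < N ∧ φ (lastBelow φ d N)) ∨ (lastBelow φ d N = d ∧ ∀ i < N, ¬ φ i) := by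
  induction N with
  | zero => simp [lastBelow]
  | succ N ih =>
    by_cases h : φ N
    · simp [lastBelow, h]
    · simp only [lastBelow, h, if_false]
      rcases ih with ih | ih
      · exact .inl ⟨by omega, ih.2⟩
      · refine .inr ⟨ih.1, fun i hi => ?_⟩
        rcases Nat.lt_succ_iff_lt_or_eq.1 hi with h' | rfl
        exacts [ih.2 i h', h]

theorem lastIdx_lt {N : ℕ} {φ : ℕ → Prop} : lastIdx N φ < N ↔ ∃ i < N, φ i := by
  rcases lastBelow_spec φ N N with h | h
  · exact ⟨fun _ => ⟨_, h.1, h.2⟩, fun _ => h.1⟩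
  · refine ⟨fun h' => absurd h' (by simp [lastIdx, h.1]), fun ⟨i, hi, hφ⟩ => absurd hφ (h.2 i hi)⟩

theorem lastIdx_spec {N : ℕ} {φ : ℕ → Prop} (h : lastIdx N φ < N) : φ (lastIdx N φ) := by
  rcases lastBelow_spec φ N N with h' | h'
  · exact h'.2
  · exact absurd h (by simp [lastIdx, h'.1])

/-- Set register `r` to the largest `i < N` such that the guard `e` holds after the execution of
`p`, and to `N` if there is none. -/
def Prog.find (i r : ℕ) (N : Expr) (p : Prog) (e : Expr) : Prog :=
  .assign r N ;; .forLoop i N (p ;; .ite e (.assign r (.reg i)) .skip)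

theorem Frame.refl (p : Prog) (M : Memory) : Frame p M M := ⟨fun _ _ => rfl, fun _ _ => rfl⟩

/-- There is no early exit: each hit overwrites the previous one, which is why the result is the
last index, and the initial value N means that nothing was found. -/
theorem Runs.find {i r n tb : ℕ} {N e : Expr} {p : Prog} {M : Memory} (φ : ℕ → Prop)
    (hir : i ≠ r) (hi : p.writesReg i = false) (hr : p.writesReg r = false)
    (hN : ∀ M', Frame (.find i r N p e) M M' → N.eval M' = n)
    (hb : ∀ j < n, ∀ M', Frame (.find i r N p e) M M' → M'.reg i = j →
      Runs p M' tb fun M'' => (e.eval M'' ≠ 0 ↔ φ j)) :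
    Runs (.find i r N p e) M (n * (tb + e.cost + N.cost + 11) + (2 * N.cost + 7))
      fun M' => M'.reg r = lastIdx n φ := by
  have hF0 : ∀ v, Frame (.find i r N p e) M (M.setReg r v) := by
    refine fun v => ⟨fun x hx => ?_, fun _ _ => rfl⟩
    have : x ≠ r := by
      rintro rfl
      simp [Prog.find, Prog.writesReg] at hx
    simp [this]
  have hF1 : ∀ M' v, Frame (.forLoop i N (p ;; .ite e (.assign r (.reg i)) .skip))
      (M.setReg r v) M' → Frame (.find i r N p e) M M' := by
    refine fun M' v hF => (hF0 v).trans ⟨fun x hx => hF.reg x ?_, fun x hx => hF.arr x ?_⟩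
    · simp [Prog.find, Prog.writesReg] at hx ⊢
      tauto
    · simp [Prog.find, Prog.writesArr] at hx ⊢
      tauto
  unfold Prog.find
  refine Runs.time (Runs.assign_seq (t := n * (tb + (e.cost + 1 + 2) + N.cost + 8) + (N.cost + 6))
    ?_) (by nlinarith)
  rw [hN M (Frame.refl _ _)]
  refine Runs.mono (Runs.forLoop (fun j M' => M'.reg r = lastBelow φ n j) ?_ ?_ ?_ ?_) le_rfl
    fun M' h => h.1
  · simpa [Prog.writesReg, hi] using hir.symm
  · exact fun M' hF => hN M' (hF1 M' _ hF)
  · simp [hir.symm, lastBelow]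
  · rintro j hj M' hF hMi hI
    refine Runs.seq (hb j hj M' (hF1 M' _ hF) hMi) fun M'' hφ hF' => ?_
    refine Runs.ite (fun h => ?_) (fun h => ?_)
    · refine Runs.assign ?_
      have : M''.reg i = j := by rw [hF'.reg i hi, hMi]
      simp [hir.symm, this, lastBelow, hφ.1 h]
    · refine (Runs.skip ?_).time (by omega)
      have h' : ¬ φ j := fun h' => hφ.2 h' h
      simp [hir.symm, lastBelow, h', hF'.reg r hr, hI]

/-- `Prog.find` for a condition given by an expression. -/
theorem Runs.findExpr {i r n : ℕ} {N e : Expr} {M : Memory} (φ : ℕ → Prop)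
    (hir : i ≠ r)
    (hN : ∀ M', Frame (.find i r N .skip e) M M' → N.eval M' = n)
    (hb : ∀ j < n, ∀ M', Frame (.find i r N .skip e) M M' → M'.reg i = j →
      (e.eval M' ≠ 0 ↔ φ j)) :
    Runs (.find i r N .skip e) M (n * (e.cost + N.cost + 12) + (2 * N.cost + 7))
      fun M' => M'.reg r = lastIdx n φ :=
  (Runs.find (tb := 1) φ hir rfl rfl hN fun j hj M' hF hi => Runs.skip (hb j hj M' hF hi)).time
    (by nlinarith)

/-! ### Enumeration of all strings of digits -/

/-- The `j`-th digit of `g` in base `b`. -/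
def dig (b g j : ℕ) : ℕ := g / b ^ j % b

/-- The number with digits `s 0, …, s (m - 1)` in base `b`. -/
def ofDig (b : ℕ) (s : ℕ → ℕ) : ℕ → ℕ
  | 0 => 0
  | m + 1 => ofDig b s m + s m * b ^ m

theorem ofDig_lt {b m : ℕ} {s : ℕ → ℕ} (hs : ∀ j < m, s j < b) :
    ofDig b s m < b ^ m := by
  induction m with
  | zero => simp [ofDig]
  | succ m ih =>
    have h1 := ih fun j hj => hs j (by omega)
    have h2 : s m + 1 ≤ b := hs m (by omega)
    have h3 : (s m + 1) * b ^ m ≤ b * b ^ m := Nat.mul_le_mul_right _ h2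
    rw [ofDig, pow_succ]
    nlinarith

theorem dig_lt {b : ℕ} (hb : 0 < b) (g j : ℕ) : dig b g j < b := Nat.mod_lt _ hb

/-- This makes the enumeration exhaustive: every prescribed string of digits occurs at the number
`ofDig b s m`. -/
theorem dig_ofDig {b m : ℕ} {s : ℕ → ℕ} (hb : 0 < b) (hs : ∀ j < m, s j < b) :
    ∀ j < m, dig b (ofDig b s m) j = s j := by
  induction m with
  | zero => simp
  | succ m ih =>
    intro j hj
    have h1 := ofDig_lt fun j hj => hs j (Nat.lt_succ_of_lt hj)
    rw [ofDig, dig]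
    rcases Nat.lt_succ_iff_lt_or_eq.1 hj with h | rfl
    · have : s m * b ^ m = b ^ j * (b * (s m * b ^ (m - j - 1))) := by
        generalize s m = x
        obtain ⟨d, rfl⟩ : ∃ d, m = j + 1 + d := ⟨m - j - 1, by omega⟩
        rw [show j + 1 + d - j - 1 = d by omega]
        ring
      rw [this, Nat.add_mul_div_left _ _ (by positivity), Nat.add_mul_mod_self_left]
      exact ih (fun j hj => hs j (Nat.lt_succ_of_lt hj)) j h
    · rw [Nat.add_mul_div_right _ _ (by positivity), Nat.div_eq_of_lt h1, zero_add,
        Nat.mod_eq_of_lt (hs j (by omega))]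

theorem dig_zero (b j : ℕ) : dig b 0 j = 0 := by simp [dig]

theorem succ_mod_eq {b : ℕ} (q : ℕ) (hb : 0 < b) :
    (q + 1) % b = if q % b + 1 < b then q % b + 1 else 0 := by
  have h1 := Nat.mod_lt q hb
  have h2 : (q + 1) % b = (q % b + 1) % b := by simp [Nat.add_mod]
  rw [h2]
  split_ifs with h
  · exact Nat.mod_eq_of_lt h
  · rw [show q % b + 1 = b by omega, Nat.mod_self]

/-- When g is increased by one, the carry arrives at position j exactly if b ^ j divides g + 1. -/
theorem dig_succ {b : ℕ} (hb : 0 < b) (g j : ℕ) :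
    dig b (g + 1) j = if b ^ j ∣ g + 1 then (if dig b g j + 1 < b then dig b g j + 1 else 0)
      else dig b g j := by
  unfold dig
  rw [Nat.succ_div]
  by_cases h : b ^ j ∣ g + 1
  · rw [if_pos h, if_pos h, succ_mod_eq _ hb]
  · rw [if_neg h, if_neg h, add_zero]

/-- The carry leaves position j exactly if it arrives there and the digit is b - 1. -/
theorem pow_succ_dvd_succ {b : ℕ} (hb : 0 < b) (g j : ℕ) :
    b ^ (j + 1) ∣ g + 1 ↔ b ^ j ∣ g + 1 ∧ ¬ dig b g j + 1 < b := by
  by_cases h : b ^ j ∣ g + 1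
  · have h1 : (g + 1) / b ^ j = g / b ^ j + 1 := by rw [Nat.succ_div, if_pos h]
    have h2 : g + 1 = b ^ j * (g / b ^ j + 1) := by rw [← h1, Nat.mul_div_cancel' h]
    have h3 := succ_mod_eq (g / b ^ j) hb
    rw [pow_succ]
    conv_lhs => rw [h2]
    rw [Nat.mul_dvd_mul_iff_left (by positivity), Nat.dvd_iff_mod_eq_zero, h3]
    unfold dig
    split_ifs with h4
    · simp [h4]
    · simp [h4, h]
  · simp only [h, false_and, iff_false]
    exact fun h' => h ((pow_dvd_pow b (Nat.le_succ j)).trans h')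

/-- Run `p` for all strings of `c` digits in base `b` in array `d`; `j` and `s` are auxiliary
registers. -/
def Prog.enum (d j s : ℕ) (b c : Expr) (p : Prog) : Prog :=
  .forLoop j c (.put d (.reg j) (.lit 0)) ;; .assign s (.lit 0) ;;
  .while (.not (.reg s)) (p ;; .assign s (.lit 1) ;;
    .forLoop j c (.ite (.reg s)
      (.ite (.lt (.add (.get d (.reg j)) (.lit 1)) b)
        (.put d (.reg j) (.add (.get d (.reg j)) (.lit 1)) ;; .assign s (.lit 0))
        (.put d (.reg j) (.lit 0)))
      .skip))

/-- Array `d` is a counter in base `bv`, and register `s` is the carry of its increment; the loop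
stops when a carry leaves the top digit. The hypothesis `hst` says that the invariant does not
depend on the storage of the counter itself. -/
theorem Runs.enum {d j s bv cv tb : ℕ} {b c : Expr} {p : Prog} {M : Memory}
    (Inv : ℕ → Memory → Prop) (hjs : j ≠ s) (hd : p.writesArr d = false) (hbv : 0 < bv)
    (hb : ∀ M', Frame (.enum d j s b c p) M M' → b.eval M' = bv)
    (hc : ∀ M', Frame (.enum d j s b c p) M M' → c.eval M' = cv)
    (hst : ∀ g M₁ M₂, Inv g M₁ → (∀ r, r ≠ j → r ≠ s → M₂.reg r = M₁.reg r) →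
      (∀ a, a ≠ d → M₂.arr a = M₁.arr a) → Inv g M₂)
    (h0 : Inv 0 M)
    (hp : ∀ g < bv ^ cv, ∀ M', Frame (.enum d j s b c p) M M' →
      (∀ i < cv, M'.arr d i = dig bv g i) → Inv g M' → Runs p M' tb (Inv (g + 1))) :
    Runs (.enum d j s b c p) M
      (bv ^ cv * (tb + (cv + 1) * (b.cost + c.cost + 40)) + (cv + 1) * (c.cost + 40))
      (Inv (bv ^ cv)) := by
  have hfr : ∀ M', (∀ r, r ≠ j → r ≠ s → M'.reg r = M.reg r) →
      (∀ a, a ≠ d → M'.arr a = M.arr a) → Frame (.enum d j s b c p) M M' := by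
    refine fun M' h1 h2 => ⟨fun r hr => h1 r ?_ ?_, fun a ha => h2 a ?_⟩
    · rintro rfl
      simp [Prog.enum, Prog.forLoop, Prog.writesReg] at hr
    · rintro rfl
      simp [Prog.enum, Prog.forLoop, Prog.writesReg] at hr
    · rintro rfl
      simp [Prog.enum, Prog.forLoop, Prog.writesArr] at ha
  have hF1 : ∀ M' : Memory, Frame (.forLoop j c (.put d (.reg j) (.lit 0))) M M' →
      (∀ r, r ≠ j → r ≠ s → M'.reg r = M.reg r) ∧ (∀ a, a ≠ d → M'.arr a = M.arr a) := by
    refine fun M' hF => ⟨fun r h1 _ => hF.reg r ?_, fun a h1 => hF.arr a ?_⟩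
    · simp [Prog.forLoop, Prog.writesReg, h1.symm]
    · simp [Prog.forLoop, Prog.writesArr, h1.symm]
  unfold Prog.enum
  refine Runs.time (Runs.seq (Runs.forLoop (n := cv) (tb := 3)
    (fun i M' => ∀ i' < i, M'.arr d i' = 0) rfl ?_ (by simp) ?_)
      (t₂ := 2 + (bv ^ cv * (3 + 1 + (tb + (2 + (cv * ((b.cost + 17) + c.cost + 8) +
        (c.cost + 6))))) + (3 + 1))) ?_) ?_
  · exact fun M' hF => hc M' (hfr M' (hF1 M' hF).1 (hF1 M' hF).2)
  · intro i hi M' hF hMi hI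
    refine Runs.put ?_
    intro i' hi'
    simp only [Memory.setReg_arr, Memory.setArr_arr_self, Expr.eval_reg, Expr.eval_lit, hMi,
      Function.update_apply]
    split_ifs with h
    · rfl
    · exact hI i' (by omega)
  · rintro M₁ ⟨hz, -⟩ hF
    refine Runs.assign_seq ?_
    have hF' := hF1 M₁ hF
    have hr2 : ∀ r, r ≠ j → r ≠ s →
        (M₁.setReg s ((Expr.lit 0).eval M₁)).reg r = M.reg r := by
      intro r h1 h2
      simp [h2, hF'.1 r h1 h2]
    have hF2 : Frame (.enum d j s b c p) M (M₁.setReg s ((Expr.lit 0).eval M₁)) :=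
      hfr _ hr2 hF'.2
    refine Runs.mono (Runs.whileLoop (N := bv ^ cv)
      (Inv := fun g M' => Inv g M' ∧ M'.reg s = (if g = bv ^ cv then 1 else 0) ∧
        (g < bv ^ cv → ∀ i < cv, M'.arr d i = dig bv g i) ∧ g ≤ bv ^ cv) ?_ ?_) le_rfl ?_
    · refine ⟨hst 0 M _ h0 hr2 hF'.2, ?_, ?_, Nat.zero_le _⟩
      · have : 0 ≠ bv ^ cv := by positivity
        simp [this]
      · intro _ i hi
        simp [dig_zero, hz i hi]
    · rintro g M' hFw ⟨hI, hs, hdg, hg⟩ he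
      have hFe : Frame (.enum d j s b c p) M M' := by
        refine hF2.trans ⟨fun r hr => hFw.reg r ?_, fun a ha => hFw.arr a ?_⟩
        · simp [Prog.enum, Prog.writesReg] at hr ⊢
          tauto
        · simp [Prog.enum, Prog.writesArr] at ha ⊢
          tauto
      have hlt : g < bv ^ cv := by
        by_contra h
        have : g = bv ^ cv := by omega
        simp [hs, this] at he
      refine ⟨hlt, Runs.seq (hp g hlt M' hFe (hdg hlt) hI) fun M₂ hI2 hFp => ?_⟩
      have hFe2 : Frame (.enum d j s b c p) M M₂ := by
        refine hFe.trans ⟨fun r hr => hFp.reg r ?_, fun a ha => hFp.arr a ?_⟩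
        · simp [Prog.enum, Prog.writesReg] at hr ⊢
          tauto
        · simp [Prog.enum, Prog.writesArr] at ha ⊢
          tauto
      have hd2 : ∀ i < cv, M₂.arr d i = dig bv g i := by
        rw [hFp.arr d hd]
        exact hdg hlt
      refine Runs.assign_seq ?_
      -- During the increment, the digits below i are those of g + 1, the others are still those of
      -- g, and `s` tells whether a carry arrives at i.
      refine Runs.post (Runs.forLoop (n := cv) (tb := b.cost + 17)
        (fun i M₃ => M₃.reg s = (if bv ^ i ∣ g + 1 then 1 else 0) ∧
          (∀ i' < i, M₃.arr d i' = dig bv (g + 1) i') ∧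
          (∀ i' < cv, i ≤ i' → M₃.arr d i' = dig bv g i')) ?_ ?_ ?_ ?_) ?_
      · simp [Prog.writesReg, hjs.symm]
      · intro M₃ hF3
        refine hc M₃ (hFe2.trans ⟨fun r hr => ?_, fun a ha => ?_⟩)
        · rw [hF3.reg r ?_]
          · have : r ≠ s := by
              rintro rfl
              simp [Prog.enum, Prog.writesReg] at hr
            simp [this]
          · simp [Prog.enum, Prog.writesReg] at hr ⊢
            tauto
        · rw [hF3.arr a ?_]
          · simp
          · simp [Prog.enum, Prog.writesArr] at ha ⊢
            tauto
      · simp [hjs.symm]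
        exact hd2
      · rintro i hi M₃ hF3 hMi ⟨hs3, hlo, hhi⟩
        have hFe3 : Frame (.enum d j s b c p) M M₃ := by
          refine hFe2.trans ⟨fun r hr => ?_, fun a ha => ?_⟩
          · rw [hF3.reg r ?_]
            · have : r ≠ s := by
                rintro rfl
                simp [Prog.enum, Prog.writesReg] at hr
              simp [this]
            · simp [Prog.enum, Prog.writesReg] at hr ⊢
              tauto
          · rw [hF3.arr a ?_]
            · simp
            · simp [Prog.enum, Prog.writesArr] at ha ⊢
              tauto
        have hdi := hhi i hi le_rfl
        have hds := dig_succ hbv g i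
        have hdv := pow_succ_dvd_succ hbv g i
        refine Runs.time (Runs.ite (t := b.cost + 15) (fun h => ?_) (fun h => ?_)) (by simp; omega)
        · have hdvd : bv ^ i ∣ g + 1 := by
            by_contra h'
            simp [hs3, h'] at h
          rw [if_pos hdvd] at hds
          refine Runs.time (Runs.ite (t := 8) (fun h' => ?_) (fun h' => ?_)) (by simp; omega)
          · have h' : dig bv g i + 1 < bv := by
              simpa [hMi, hdi, hb M₃ hFe3] using h'
            refine Runs.time (Runs.put_seq (Runs.assign ?_)) (by simp)
            rw [if_pos h'] at hds
            refine ⟨?_, fun i' hi' => ?_, fun i' hi' h2 => ?_⟩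
            · simp [hjs.symm, hdv, h']
            · simp only [Memory.setReg_arr, Memory.setArr_arr_self, Expr.eval_reg, Expr.eval_lit,
                Expr.eval_add, Expr.eval_get, hMi, Function.update_apply]
              split_ifs with h3
              · rw [h3, hdi, hds]
              · exact hlo i' (by omega)
            · simp only [Memory.setReg_arr, Memory.setArr_arr_self, Expr.eval_reg, Expr.eval_lit,
                Expr.eval_add, Expr.eval_get, hMi, Function.update_apply]
              rw [if_neg (by omega)]
              exact hhi i' hi' (by omega)
          · have h' : ¬ dig bv g i + 1 < bv := by
              simpa [hMi, hdi, hb M₃ hFe3] using h'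
            refine Runs.time (Runs.put ?_) (by simp)
            rw [if_neg h'] at hds
            refine ⟨?_, fun i' hi' => ?_, fun i' hi' h2 => ?_⟩
            · rw [if_pos (hdv.2 ⟨hdvd, h'⟩)]
              simp [hjs.symm, hs3, hdvd]
            · simp only [Memory.setReg_arr, Memory.setArr_arr_self, Expr.eval_reg, Expr.eval_lit,
                hMi, Function.update_apply]
              split_ifs with h3
              · rw [h3, hds]
              · exact hlo i' (by omega)
            · simp only [Memory.setReg_arr, Memory.setArr_arr_self, Expr.eval_reg, Expr.eval_lit,
                hMi, Function.update_apply]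
              rw [if_neg (by omega)]
              exact hhi i' hi' (by omega)
        · have hdvd : ¬ bv ^ i ∣ g + 1 := by
            intro h'
            simp [hs3, h'] at h
          rw [if_neg hdvd] at hds
          refine Runs.time (Runs.skip ⟨?_, fun i' hi' => ?_, fun i' hi' h2 => ?_⟩) (by omega)
          · rw [if_neg fun h' => hdvd (hdv.1 h').1]
            simp [hjs.symm, hs3, hdvd]
          · rcases Nat.lt_succ_iff_lt_or_eq.1 hi' with h3 | rfl
            · exact hlo i' h3
            · simp [hdi, hds]
          · exact hhi i' hi' (by omega)
      · rintro M₃ ⟨⟨hs3, hlo, -⟩, -⟩ hF3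
        -- As g + 1 ≤ bv ^ cv, a carry out of the top digit means that all strings have been
        -- treated.
        have hdvd : bv ^ cv ∣ g + 1 ↔ g + 1 = bv ^ cv :=
          ⟨fun h => le_antisymm hlt (Nat.le_of_dvd (by omega) h), fun h => h ▸ dvd_rfl⟩
        refine ⟨hst _ M₂ M₃ hI2 (fun r h1 h2 => ?_) (fun a h1 => ?_), ?_, fun _ => hlo, hlt⟩
        · rw [hF3.reg r]
          · simp [h2]
          · simp [Prog.forLoop, Prog.writesReg, h1.symm, h2.symm]
        · rw [hF3.arr a]
          · simp
          · simp [Prog.forLoop, Prog.writesArr, h1.symm]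
        · rw [hs3]
          simp only [hdvd]
    · rintro M' ⟨g, hg, ⟨hI, hs, -, -⟩, he⟩
      have : g = bv ^ cv := by
        by_contra h
        simp [hs, h] at he
      exact this ▸ hI
  · have h1 : 3 + 1 + (tb + (2 + (cv * ((b.cost + 17) + c.cost + 8) + (c.cost + 6)))) ≤
        tb + (cv + 1) * (b.cost + c.cost + 40) := by nlinarith
    have h2 := Nat.mul_le_mul_left (bv ^ cv) h1
    have h3 : cv * (3 + c.cost + 8) + (c.cost + 6) + (2 + 4) ≤ (cv + 1) * (c.cost + 40) := by
      nlinarith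
    omega

end RAM

/-! ### Eccentricity of geodesics relative to a layout in disjoint paths -/

namespace MESP

/-- `D` is the distance function of a connected graph with vertices `0, …, n - 1`. -/
structure GraphMetric (n : ℕ) (D : ℕ → ℕ → ℕ) : Prop where
  self : ∀ a < n, D a a = 0
  eq : ∀ a < n, ∀ b < n, D a b = 0 → a = b
  symm : ∀ a < n, ∀ b < n, D a b = D b a
  tri : ∀ a < n, ∀ b < n, ∀ c < n, D a c ≤ D a b + D b c
  step : ∀ a < n, ∀ b < n, ∀ t, D a b = t + 1 → ∃ c < n, D a c = t ∧ D c b = 1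

/-- `f 0, …, f l` are the vertices of a shortest path. -/
structure Geodesic (n : ℕ) (D : ℕ → ℕ → ℕ) (f : ℕ → ℕ) (l : ℕ) : Prop where
  lt : ∀ t ≤ l, f t < n
  dist : ∀ s t, s ≤ t → t ≤ l → D (f s) (f t) = t - s

/-- `ord 0, …, ord (len - 1)` are different vertices, and only consecutive ones can be adjacent. -/
structure Layout (n : ℕ) (D : ℕ → ℕ → ℕ) (ord : ℕ → ℕ) (len : ℕ) : Prop where
  lt : ∀ i < len, ord i < n
  inj : ∀ i < len, ∀ j < len, ord i = ord j → i = j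
  adj : ∀ i j, i < j → j < len → D (ord i) (ord j) = 1 → j = i + 1

variable {n k : ℕ} {D : ℕ → ℕ → ℕ} {f ord x e : ℕ → ℕ} {l len m : ℕ}

theorem Geodesic.mono {l' : ℕ} (h : Geodesic n D f l) (hl : l' ≤ l) : Geodesic n D f l' :=
  ⟨fun t ht => h.lt t (ht.trans hl), fun s t hs ht => h.dist s t hs (ht.trans hl)⟩

theorem Geodesic.inj (h : Geodesic n D f l) (hM : GraphMetric n D) {s t : ℕ} (hs : s ≤ l)
    (ht : t ≤ l) (he : f s = f t) : s = t := by
  rcases le_total s t with h' | h'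
  · have := h.dist s t h' ht
    rw [he, hM.self _ (h.lt t ht)] at this
    omega
  · have := h.dist t s h' hs
    rw [he, hM.self _ (h.lt t ht)] at this
    omega

/-- Unit steps bound D (f s) (f t) from above by t - s. The triangle inequality through f s, with
the known distances from f 0, bounds it from below. -/
theorem Geodesic.of_steps (hM : GraphMetric n D) (hlt : ∀ t ≤ l, f t < n)
    (h0 : ∀ t ≤ l, D (f 0) (f t) = t) (h1 : ∀ t < l, D (f t) (f (t + 1)) = 1) :
    Geodesic n D f l := by
  have key : ∀ s d, s + d ≤ l → D (f s) (f (s + d)) ≤ d := by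
    intro s d
    induction d with
    | zero => exact fun h => (hM.self _ (hlt s h)).le
    | succ d ih =>
      intro h
      have := hM.tri _ (hlt s (by omega)) _ (hlt (s + d) (by omega)) _ (hlt (s + d + 1) h)
      have h2 := h1 (s + d) (by omega)
      have h3 := ih (by omega)
      rw [← add_assoc]
      omega
  refine ⟨hlt, fun s t hs ht => ?_⟩
  have h2 := key s (t - s) (by omega)
  rw [show s + (t - s) = t by omega] at h2
  have h3 := hM.tri _ (hlt 0 (by omega)) _ (hlt s (by omega)) _ (hlt t ht)
  have h4 := h0 s (by omega)
  have h5 := h0 t ht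
  omega

theorem exists_geodesic (hM : GraphMetric n D) {a b : ℕ} (ha : a < n) (hb : b < n) :
    ∃ f, f 0 = a ∧ f (D a b) = b ∧ Geodesic n D f (D a b) := by
  have key : ∀ d b, b < n → D a b = d → ∃ f : ℕ → ℕ, f 0 = a ∧ f d = b ∧ (∀ t ≤ d, f t < n) ∧
      (∀ t ≤ d, D (f 0) (f t) = t) ∧ ∀ t < d, D (f t) (f (t + 1)) = 1 := by
    intro d
    induction d with
    | zero =>
      intro b hb h
      have := hM.eq a ha b hb h
      subst this
      refine ⟨fun _ => a, rfl, rfl, fun _ _ => ha, fun t ht => ?_, fun t ht => by omega⟩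
      rw [hM.self a ha]
      omega
    | succ d ih =>
      intro b hb h
      obtain ⟨c, hc, h1, h2⟩ := hM.step a ha b hb d h
      obtain ⟨f, h3, h4, h5, h6, h7⟩ := ih c hc h1
      refine ⟨fun t => if t ≤ d then f t else b, by simp [h3], by simp, fun t ht => ?_,
        fun t ht => ?_, fun t ht => ?_⟩
      · dsimp only
        split_ifs with h8
        exacts [h5 t h8, hb]
      · simp only [Nat.zero_le, if_true]
        split_ifs with h8
        · exact h6 t h8
        · rw [h3, h]
          omega
      · dsimp only
        rw [if_pos (by omega)]
        split_ifs with h8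
        · exact h7 t (by omega)
        · rw [show t = d by omega, h4, h2]
  obtain ⟨f, h1, h2, h3, h4, h5⟩ := key _ b hb rfl
  exact ⟨f, h1, h2, Geodesic.of_steps hM h3 h4 h5⟩

theorem Layout.adj' (hL : Layout n D ord len) (hM : GraphMetric n D) {i j : ℕ} (hi : i < len)
    (hj : j < len) (h : D (ord i) (ord j) = 1) : j = i + 1 ∨ i = j + 1 := by
  rcases lt_trichotomy i j with h' | rfl | h'
  · exact .inl (hL.adj i j h' hj h)
  · rw [hM.self _ (hL.lt i hi)] at h
    omega
  · rw [hM.symm _ (hL.lt i hi) _ (hL.lt j hj)] at h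
    exact .inr (hL.adj j i h' hi h)

/-- `x 0, …, x (m - 1)` contain the vertex `a`. -/
def Special (m : ℕ) (x : ℕ → ℕ) (a : ℕ) : Prop := ∃ j < m, x j = a

/-- A geodesic without special vertices runs along the layout in one of the two directions. -/
theorem Geodesic.run (hf : Geodesic n D f l) (hM : GraphMetric n D) (hL : Layout n D ord len)
    (hc : ∀ a < n, ¬ Special m x a → ∃ i < len, ord i = a)
    (hs : ∀ s ≤ l, ¬ Special m x (f s)) :
    ∃ i, (∀ s ≤ l, i + s < len ∧ ord (i + s) = f s) ∨
      (∀ s ≤ l, s ≤ i ∧ i < len ∧ ord (i - s) = f s) := by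
  induction l with
  | zero =>
    obtain ⟨i, hi, h⟩ := hc _ (hf.lt 0 le_rfl) (hs 0 le_rfl)
    refine ⟨i, .inl fun s h0 => ?_⟩
    obtain rfl : s = 0 := by omega
    exact ⟨hi, h⟩
  | succ l ih =>
    obtain ⟨i, hi⟩ := ih (hf.mono (Nat.le_succ l)) fun s h => hs s (by omega)
    obtain ⟨j, hj, hjf⟩ := hc _ (hf.lt (l + 1) le_rfl) (hs _ le_rfl)
    have h1 : D (f l) (f (l + 1)) = 1 := by
      rw [hf.dist l (l + 1) (by omega) le_rfl]
      omega
    rcases hi with hi | hi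
    · obtain ⟨h2, h3⟩ := hi l le_rfl
      rw [← h3, ← hjf] at h1
      rcases hL.adj' hM h2 hj h1 with h4 | h4
      · refine ⟨i, .inl fun s h5 => ?_⟩
        rcases Nat.le_succ_iff.1 h5 with h6 | rfl
        · exact hi s h6
        · rw [show i + (l + 1) = j by omega]
          exact ⟨hj, hjf⟩
      -- A step against the current direction. With a single vertex so far the direction is still
      -- open and is now fixed; otherwise the step would return to f (l - 1), contradicting
      -- injectivity.
      · rcases Nat.eq_zero_or_pos l with rfl | hl
        · refine ⟨i, .inr fun s h5 => ?_⟩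
          rcases Nat.le_succ_iff.1 h5 with h6 | rfl
          · obtain rfl : s = 0 := by omega
            exact ⟨by omega, h2, h3⟩
          · rw [show i - (0 + 1) = j by omega]
            exact ⟨by omega, h2, hjf⟩
        · have h5 := (hi (l - 1) (by omega)).2
          rw [show i + (l - 1) = j by omega, hjf] at h5
          have := hf.inj hM le_rfl (by omega) h5
          omega
    · obtain ⟨h2, h2', h3⟩ := hi l le_rfl
      rw [← h3, ← hjf] at h1
      rcases hL.adj' hM (by omega) hj h1 with h4 | h4
      · rcases Nat.eq_zero_or_pos l with rfl | hl
        · refine ⟨i, .inl fun s h5 => ?_⟩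
          rcases Nat.le_succ_iff.1 h5 with h6 | rfl
          · obtain rfl : s = 0 := by omega
            exact ⟨by omega, h3⟩
          · rw [show i + (0 + 1) = j by omega]
            exact ⟨by omega, hjf⟩
        · have h5 := (hi (l - 1) (by omega)).2.2
          rw [show i - (l - 1) = j by omega, hjf] at h5
          have := hf.inj hM le_rfl (by omega) h5
          omega
      · refine ⟨i, .inr fun s h5 => ?_⟩
        rcases Nat.le_succ_iff.1 h5 with h6 | rfl
        · exact hi s h6
        · rw [show i - (l + 1) = j by omega]
          exact ⟨by omega, h2', hjf⟩

/-! ### Uncovered vertices, breaks and blocks -/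

/-- The vertex is far from all `x j` with respect to the radii `k - e j`. -/
def Uncovered (D : ℕ → ℕ → ℕ) (k m : ℕ) (x e : ℕ → ℕ) (w : ℕ) : Prop :=
  ∀ j < m, k < D w (x j) + e j

/-- The vertex is in the closed neighbourhood of some `x j` with `e j = 0`. -/
def Break (D : ℕ → ℕ → ℕ) (m : ℕ) (x e : ℕ → ℕ) (w : ℕ) : Prop :=
  ∃ j < m, e j = 0 ∧ D w (x j) < 2

/-- The vertices at the positions `i, …, j` are consecutively adjacent, and none is a break. -/
def SameBlock (D : ℕ → ℕ → ℕ) (m : ℕ) (x e ord : ℕ → ℕ) (i j : ℕ) : Prop :=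
  (∀ s, i ≤ s → s < j → D (ord s) (ord (s + 1)) = 1) ∧
    ∀ s, i ≤ s → s ≤ j → ¬ Break D m x e (ord s)

/-- A geodesic between special vertices; `e j` is the distance of `x j` from it; all vertices that
are not special are in the layout. -/
structure Setting (n k : ℕ) (D : ℕ → ℕ → ℕ) (ord : ℕ → ℕ) (len : ℕ) (x e : ℕ → ℕ) (m : ℕ)
    (f : ℕ → ℕ) (l : ℕ) : Prop where
  met : GraphMetric n D
  lay : Layout n D ord len
  cover : ∀ a < n, ¬ Special m x a → ∃ i < len, ord i = a
  x_lt : ∀ j < m, x j < n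
  geo : Geodesic n D f l
  start : Special m x (f 0)
  finish : Special m x (f l)
  near : ∀ j < m, ∃ t ≤ l, D (x j) (f t) ≤ e j
  far : ∀ j < m, ∀ t ≤ l, e j ≤ D (x j) (f t)
  e_le : ∀ j < m, e j ≤ k
  k_pos : 0 < k

/-- The geodesic contains the vertex. -/
def OnPath (f : ℕ → ℕ) (l w : ℕ) : Prop := ∃ t ≤ l, f t = w

namespace Setting

variable (S : Setting n k D ord len x e m f l)
include S

theorem e_zero_of_onPath {j : ℕ} (hj : j < m) (h : OnPath f l (x j)) : e j = 0 := by
  obtain ⟨t, ht, h⟩ := h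
  have := S.far j hj t ht
  rw [h, S.met.self _ (S.x_lt j hj)] at this
  omega

theorem onPath_of_e_zero {j : ℕ} (hj : j < m) (h : e j = 0) : OnPath f l (x j) := by
  obtain ⟨t, ht, h'⟩ := S.near j hj
  exact ⟨t, ht, (S.met.eq _ (S.x_lt j hj) _ (S.geo.lt t ht) (by omega)).symm⟩

theorem break_of_special {w : ℕ} (hs : Special m x w) (hw : OnPath f l w) : Break D m x e w := by
  obtain ⟨j, hj, rfl⟩ := hs
  exact ⟨j, hj, S.e_zero_of_onPath hj hw, by rw [S.met.self _ (S.x_lt j hj)]; omega⟩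

theorem Uncovered.not_special {w : ℕ} (hw : Uncovered D k m x e w) : ¬ Special m x w := by
  rintro ⟨j, hj, rfl⟩
  have := hw j hj
  rw [S.met.self _ (S.x_lt j hj)] at this
  have := S.e_le j hj
  omega

/-- The break b is within 1 of some x j with e j = 0, so k < D w (x j) ≤ D w b + 1. -/
theorem Uncovered.lt_of_break {w b : ℕ} (hw : Uncovered D k m x e w) (hwn : w < n) (hbn : b < n)
    (hb : Break D m x e b) : k ≤ D w b := by
  obtain ⟨j, hj, h1, h2⟩ := hb
  have := hw j hj
  have := S.met.tri _ hwn _ hbn _ (S.x_lt j hj)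
  omega

theorem Uncovered.not_break {w : ℕ} (hw : Uncovered D k m x e w) (hwn : w < n) :
    ¬ Break D m x e w := by
  intro h
  have := Uncovered.lt_of_break S hw hwn hwn h
  rw [S.met.self _ hwn] at this
  have := S.k_pos
  omega

/-- Inner vertices of the geodesic that are no breaks have both layout neighbours on it. -/
theorem nbrs_onPath {i t : ℕ} (hi : i < len) (ht : t ≤ l) (hti : f t = ord i)
    (hs : ¬ Special m x (ord i))
    (hb : ¬ ∃ s ≤ l, Special m x (f s) ∧ D (f s) (ord i) = 1) :
    0 < i ∧ i + 1 < len ∧ OnPath f l (ord (i + 1)) ∧ D (ord i) (ord (i + 1)) = 1 ∧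
      OnPath f l (ord (i - 1)) ∧ D (ord (i - 1)) (ord i) = 1 := by
  have h0 : t ≠ 0 := by
    rintro rfl
    exact hs (hti ▸ S.start)
  have hl : t ≠ l := by
    rintro rfl
    exact hs (hti ▸ S.finish)
  have hd1 : D (f (t - 1)) (f t) = 1 := by
    rw [S.geo.dist _ _ (by omega) ht]
    omega
  have hd2 : D (f t) (f (t + 1)) = 1 := by
    rw [S.geo.dist _ _ (by omega) (by omega)]
    omega
  have hd2' : D (f (t + 1)) (f t) = 1 := by
    rw [S.met.symm _ (S.geo.lt _ (by omega)) _ (S.geo.lt t ht), hd2]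
  have hd1' : D (f t) (f (t - 1)) = 1 := by
    rw [S.met.symm _ (S.geo.lt t ht) _ (S.geo.lt _ (by omega)), hd1]
  obtain ⟨i1, hi1, h1⟩ := S.cover (f (t - 1)) (S.geo.lt _ (by omega)) fun h =>
    hb ⟨t - 1, by omega, h, by rw [← hti, hd1]⟩
  obtain ⟨i2, hi2, h2⟩ := S.cover (f (t + 1)) (S.geo.lt _ (by omega)) fun h =>
    hb ⟨t + 1, by omega, h, by rw [← hti, hd2']⟩
  have hne : i1 ≠ i2 := by
    rintro rfl
    have := S.geo.inj S.met (by omega) (by omega) (h1.symm.trans h2)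
    omega
  have a1 := S.lay.adj' S.met hi1 hi (by rw [h1, ← hti, hd1])
  have a2 := S.lay.adj' S.met hi2 hi (by rw [h2, ← hti, hd2'])
  rcases a1 with a1 | a1
  · have a3 : i2 = i + 1 := by omega
    subst a3
    obtain rfl : i1 = i - 1 := by omega
    exact ⟨by omega, hi2, ⟨t + 1, by omega, h2.symm⟩, by rw [h2, ← hti, hd2],
      ⟨t - 1, by omega, h1.symm⟩, by rw [h1, ← hti, hd1]⟩
  · have a3 : i2 = i - 1 := by omega
    subst a3 a1
    exact ⟨by omega, hi1, ⟨t - 1, by omega, h1.symm⟩, by rw [h1, ← hti, hd1'],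
      ⟨t + 1, by omega, h2.symm⟩, by rw [h2, ← hti, hd2']⟩

theorem nbrs_onPath_of_not_break {i : ℕ} (hi : i < len) (hp : OnPath f l (ord i))
    (hb : ¬ Break D m x e (ord i)) :
    0 < i ∧ i + 1 < len ∧ OnPath f l (ord (i + 1)) ∧ D (ord i) (ord (i + 1)) = 1 ∧
      OnPath f l (ord (i - 1)) ∧ D (ord (i - 1)) (ord i) = 1 := by
  obtain ⟨t, ht, hti⟩ := id hp
  refine S.nbrs_onPath hi ht hti (fun h => hb (S.break_of_special h hp)) ?_
  rintro ⟨s, hs, ⟨j, hj, hsp⟩, hd⟩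
  refine hb ⟨j, hj, S.e_zero_of_onPath hj ⟨s, hs, hsp.symm⟩, ?_⟩
  rw [S.met.symm _ (S.lay.lt i hi) _ (S.x_lt j hj), hsp, hd]
  omega

/-- If the geodesic contains one vertex of a block, then it contains the block. -/
theorem onPath_of_sameBlock {i j : ℕ} (hij : i ≤ j) (hj : j < len) (hp : OnPath f l (ord i))
    (hb : SameBlock D m x e ord i j) : OnPath f l (ord j) := by
  induction j, hij using Nat.le_induction with
  | base => exact hp
  | succ j hij ih =>
    have h1 := ih (by omega) ⟨fun s h1 h2 => hb.1 s h1 (by omega),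
      fun s h1 h2 => hb.2 s h1 (by omega)⟩
    exact (S.nbrs_onPath_of_not_break (by omega) h1 (hb.2 j hij (by omega))).2.2.1

/-- The vertex at position `j` has distance `k` from the geodesic, which contains the break at
position `j - k` but not its successor. -/
def Left (D : ℕ → ℕ → ℕ) (k : ℕ) (ord : ℕ → ℕ) (len m : ℕ) (x e f : ℕ → ℕ) (l j : ℕ) : Prop :=
  k ≤ j ∧ j < len ∧ OnPath f l (ord (j - k)) ∧ Break D m x e (ord (j - k)) ∧
    (∀ s < k, D (ord (j - k + s)) (ord (j - k + s + 1)) = 1) ∧ ¬ OnPath f l (ord (j - k + 1))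

/-- The vertex at position `j` has distance `k` from the geodesic, which contains the break at
position `j + k` but not its predecessor. -/
def Right (D : ℕ → ℕ → ℕ) (k : ℕ) (ord : ℕ → ℕ) (len m : ℕ) (x e f : ℕ → ℕ) (l j : ℕ) : Prop :=
  j + k < len ∧ OnPath f l (ord (j + k)) ∧ Break D m x e (ord (j + k)) ∧
    (∀ s < k, D (ord (j + s)) (ord (j + s + 1)) = 1) ∧ ¬ OnPath f l (ord (j + k - 1))

/-- A shortest path h from the vertex to a nearest point f t of the geodesic avoids special
vertices, because the vertex is uncovered; so it runs along the layout in one direction. If no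
special vertex of the geodesic were adjacent to f t, both layout neighbours of f t would be on the
geodesic, including the one just before f t on h, against minimality. So f t is a break, and being
uncovered forces distance exactly k. -/
theorem trichotomy {j : ℕ} (hj : j < len) (hU : Uncovered D k m x e (ord j))
    (hsat : ∃ t ≤ l, D (ord j) (f t) ≤ k) :
    OnPath f l (ord j) ∨ Left D k ord len m x e f l j ∨ Right D k ord len m x e f l j := by
  classical
  by_cases hP : OnPath f l (ord j)
  · exact .inl hP
  right
  have hw := S.lay.lt j hj
  obtain ⟨t, ht, hmin⟩ : ∃ t ≤ l, ∀ s ≤ l, D (ord j) (f t) ≤ D (ord j) (f s) := by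
    obtain ⟨t, ht, h⟩ := Finset.exists_min_image (Finset.range (l + 1)) (fun t => D (ord j) (f t))
      ⟨0, by simp⟩
    exact ⟨t, by simpa [Nat.lt_succ_iff] using ht, fun s hs => h s (by simpa [Nat.lt_succ_iff])⟩
  obtain ⟨t', ht', h1⟩ := hsat
  have hk : D (ord j) (f t) ≤ k := (hmin t' ht').trans h1
  have hp := S.geo.lt t ht
  obtain ⟨h, h0, hδ, hg⟩ := exists_geodesic S.met hw hp
  set δ := D (ord j) (f t) with hδ'
  have hδpos : 0 < δ := by
    by_contra h
    exact hP ⟨t, ht, (S.met.eq _ hw _ hp (by omega)).symm⟩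
  -- A special x i on h would satisfy D (ord j) (x i) + e i ≤ δ ≤ k, since e i is at most its
  -- distance from f t.
  have hns : ∀ s ≤ δ, ¬ Special m x (h s) := by
    rintro s hs ⟨i, hi, his⟩
    have h2 := hU i hi
    obtain ⟨r, hr, hrd⟩ := S.near i hi
    have h3 := hg.dist 0 s (by omega) hs
    have h4 := hg.dist s δ hs le_rfl
    rw [h0, ← his] at h3
    rw [hδ, ← his] at h4
    have := S.far i hi t ht
    omega
  have hon : ∀ s ≤ δ, OnPath f l (h s) → s = δ := by
    rintro s hs ⟨r, hr, hrs⟩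
    have h2 := hmin r hr
    rw [hrs, ← h0, hg.dist 0 s (by omega) hs] at h2
    omega
  -- The disjunction says that some layout neighbour of f t is an earlier vertex of h, which by
  -- `hon` is not on the geodesic. A special neighbour x r of f t on the geodesic has e r = 0, so k
  -- < D (ord j) (x r) ≤ δ + 1.
  have hbreak : ∀ i < len, ord i = f t → (∃ s < δ, ord (i + 1) = h s) ∨
      (∃ s < δ, ord (i - 1) = h s) → Break D m x e (ord i) ∧ δ = k := by
    intro i hi hit hnb
    have : ∃ s ≤ l, Special m x (f s) ∧ D (f s) (ord i) = 1 := by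
      by_contra hcon
      have hn := S.nbrs_onPath hi ht hit.symm (by rw [hit, ← hδ]; exact hns δ le_rfl) hcon
      rcases hnb with ⟨s, hs, hs'⟩ | ⟨s, hs, hs'⟩
      · have := hon s hs.le (hs' ▸ hn.2.2.1)
        omega
      · have := hon s hs.le (hs' ▸ hn.2.2.2.2.1)
        omega
    obtain ⟨s, hs, ⟨r, hr, hrs⟩, hd⟩ := this
    have he := S.e_zero_of_onPath hr ⟨s, hs, hrs.symm⟩
    have hd' : D (ord i) (x r) = 1 := by
      rw [S.met.symm _ (S.lay.lt i hi) _ (S.x_lt r hr), hrs, hd]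
    have h2 := hU r hr
    have h3 := S.met.tri _ hw _ (S.lay.lt i hi) _ (S.x_lt r hr)
    rw [hit, ← hδ', ← hit] at h3
    exact ⟨⟨r, hr, he, by omega⟩, by omega⟩
  obtain ⟨i, hi | hi⟩ := hg.run S.met S.lay S.cover hns
  · right
    obtain ⟨a1, a2⟩ := hi 0 (by omega)
    have : i + 0 = j := S.lay.inj _ a1 _ hj (by rw [a2, h0])
    obtain rfl : i = j := by omega
    obtain ⟨a3, a4⟩ := hi δ le_rfl
    obtain ⟨a5, a6⟩ := hbreak (i + δ) a3 (a4.trans hδ) (.inr ⟨δ - 1, by omega, by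
      rw [← (hi (δ - 1) (by omega)).2]; congr 1; omega⟩)
    clear_value δ
    subst a6
    refine ⟨a3, ⟨t, ht, by rw [a4, hδ]⟩, a5, fun s hs => ?_, fun hcon => ?_⟩
    · rw [(hi s (by omega)).2, add_assoc, (hi (s + 1) (by omega)).2,
        hg.dist s (s + 1) (by omega) (by omega)]
      omega
    · rw [show i + δ - 1 = i + (δ - 1) by omega, (hi (δ - 1) (by omega)).2] at hcon
      have := hon _ (by omega) hcon
      omega
  · left
    obtain ⟨-, a1, a2⟩ := hi 0 (by omega)
    have : i - 0 = j := S.lay.inj _ (by omega) _ hj (by rw [a2, h0])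
    obtain rfl : i = j := by omega
    obtain ⟨a3', a3, a4⟩ := hi δ le_rfl
    obtain ⟨a5, a6⟩ := hbreak (i - δ) (by omega) (a4.trans hδ) (.inl ⟨δ - 1, by omega, by
      rw [← (hi (δ - 1) (by omega)).2.2]; congr 1; omega⟩)
    clear_value δ
    subst a6
    refine ⟨a3', hj, ⟨t, ht, by rw [a4, hδ]⟩, a5, fun s hs => ?_, fun hcon => ?_⟩
    · rw [show i - δ + s = i - (δ - s) by omega, (hi (δ - s) (by omega)).2.2,
        show i - (δ - s) + 1 = i - (δ - s - 1) by omega, (hi (δ - s - 1) (by omega)).2.2,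
        S.met.symm _ (hg.lt _ (by omega)) _ (hg.lt _ (by omega)),
        hg.dist (δ - s - 1) (δ - s) (by omega) (by omega)]
      omega
    · rw [show i - δ + 1 = i - (δ - 1) by omega, (hi (δ - 1) (by omega)).2.2] at hcon
      have := hon _ (by omega) hcon
      omega

theorem dist_le_of_adj {i d : ℕ} (hd : i + d < len)
    (h : ∀ s < d, D (ord (i + s)) (ord (i + s + 1)) = 1) : D (ord i) (ord (i + d)) ≤ d := by
  induction d with
  | zero => exact (S.met.self _ (S.lay.lt i (by omega))).le
  | succ d ih =>
    have h1 := ih (by omega) fun s hs => h s (by omega)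
    have h2 := h d (by omega)
    have h3 := S.met.tri _ (S.lay.lt i (by omega)) _ (S.lay.lt (i + d) (by omega)) _
      (S.lay.lt (i + d + 1) hd)
    rw [← add_assoc]
    omega

/-- The break at position j - k either lies in the block of i and j, which contains no breaks, or
precedes i at distance less than k, too close to the uncovered vertex at i. -/
theorem Left.first {i j : ℕ} (h : Left D k ord len m x e f l j)
    (hU : Uncovered D k m x e (ord i)) (hij : i < j) (hb : SameBlock D m x e ord i j) : False := by
  obtain ⟨h1, h2, h3, h4, h5, h6⟩ := h
  rcases le_or_gt i (j - k) with h7 | h7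
  · exact hb.2 _ h7 (by omega) h4
  · have h8 := Uncovered.lt_of_break S hU (S.lay.lt i (by omega)) (S.lay.lt (j - k) (by omega)) h4
    have h9 := S.dist_le_of_adj (i := j - k) (d := i - (j - k)) (by omega)
      fun s hs => h5 s (by omega)
    rw [show j - k + (i - (j - k)) = i by omega,
      S.met.symm _ (S.lay.lt _ (by omega)) _ (S.lay.lt i (by omega))] at h9
    omega

/-- Mirror image of `Left.first`: the break at position i + k is either inside the block or too
close to the uncovered vertex at j. -/
theorem Right.last {i j : ℕ} (h : Right D k ord len m x e f l i)
    (hU : Uncovered D k m x e (ord j)) (hj : j < len) (hij : i < j)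
    (hb : SameBlock D m x e ord i j) : False := by
  obtain ⟨h2, h3, h4, h5, h6⟩ := h
  rcases le_or_gt (i + k) j with h7 | h7
  · exact hb.2 _ (by omega) h7 h4
  · have h8 := Uncovered.lt_of_break S hU (S.lay.lt j (by omega)) (S.lay.lt (i + k) (by omega)) h4
    have h9 := S.dist_le_of_adj (i := j) (d := i + k - j) (by omega)
      fun s hs => by
        have := h5 (j - i + s) (by omega)
        rwa [show i + (j - i + s) = j + s by omega] at this
    rw [show j + (i + k - j) = i + k by omega] at h9
    omega

end Setting

/-! ### Representatives of the uncovered vertices -/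

open Classical in
/-- The number of representatives so far in the current block before position `i` is treated. -/
noncomputable def blockCount (D : ℕ → ℕ → ℕ) (k m : ℕ) (x e ord : ℕ → ℕ) : ℕ → ℕ
  | 0 => 0
  | i + 1 =>
    let c := if Break D m x e (ord i) ∨ ¬ D (ord (i - 1)) (ord i) = 1 then 0
      else blockCount D k m x e ord i
    if Uncovered D k m x e (ord i) ∧ c < 2 then c + 1 else c

open Classical in
/-- `blockCount`, set to `0` if a new block starts at position `i`. -/
noncomputable def blockPos (D : ℕ → ℕ → ℕ) (k m : ℕ) (x e ord : ℕ → ℕ) (i : ℕ) : ℕ :=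
  if Break D m x e (ord i) ∨ ¬ D (ord (i - 1)) (ord i) = 1 then 0 else blockCount D k m x e ord i

/-- The vertex at position `i` is one of the first two uncovered vertices of its block. -/
def IsRep (D : ℕ → ℕ → ℕ) (k m : ℕ) (x e ord : ℕ → ℕ) (i : ℕ) : Prop :=
  Uncovered D k m x e (ord i) ∧ blockPos D k m x e ord i < 2

open Classical in
theorem blockCount_succ (i : ℕ) : blockCount D k m x e ord (i + 1) =
    if IsRep D k m x e ord i then blockPos D k m x e ord i + 1 else blockPos D k m x e ord i := by
  rw [blockCount]
  unfold IsRep blockPos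
  congr

theorem blockPos_pos {i : ℕ} (h : 0 < blockPos D k m x e ord i) :
    ∃ i', i = i' + 1 ∧ D (ord i') (ord (i' + 1)) = 1 ∧ ¬ Break D m x e (ord i) ∧
      blockPos D k m x e ord i = blockCount D k m x e ord (i' + 1) := by
  have h1 : ¬ (Break D m x e (ord i) ∨ ¬ D (ord (i - 1)) (ord i) = 1) := by
    intro h1
    rw [blockPos, if_pos h1] at h
    exact lt_irrefl _ h
  have h' := h
  rw [blockPos, if_neg h1] at h'
  push Not at h1
  cases i with
  | zero => exact absurd h' (lt_irrefl _)
  | succ i =>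
    refine ⟨i, rfl, h1.2, h1.1, ?_⟩
    rw [blockPos, if_neg]
    push Not
    exact h1

/-- Position j is where the counter of the current block was last increased. No claim is made that j
itself is not a break, since a break may start the block; for uncovered vertices this is excluded by
`Uncovered.not_break`. -/
theorem exists_prev_rep (i : ℕ) (h : 0 < blockPos D k m x e ord i) :
    ∃ j < i, IsRep D k m x e ord j ∧ blockPos D k m x e ord j + 1 = blockPos D k m x e ord i ∧
      (∀ s, j ≤ s → s < i → D (ord s) (ord (s + 1)) = 1) ∧
      ∀ s, j < s → s ≤ i → ¬ Break D m x e (ord s) := by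
  induction i with
  | zero =>
    obtain ⟨i', h1, -⟩ := blockPos_pos h
    omega
  | succ i ih =>
    obtain ⟨i', h1, h2, h3, h4⟩ := blockPos_pos h
    obtain rfl : i = i' := by omega
    rw [blockCount_succ] at h4
    split_ifs at h4 with h5
    · refine ⟨i, by omega, h5, h4.symm, fun s hs hs' => ?_, fun s hs hs' => ?_⟩
      · rwa [show s = i by omega]
      · rwa [show s = i + 1 by omega]
    · obtain ⟨j, hj, h6, h7, h8, h9⟩ := ih (by omega)
      refine ⟨j, by omega, h6, by omega, fun s hs hs' => ?_, fun s hs hs' => ?_⟩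
      · rcases Nat.lt_succ_iff_lt_or_eq.1 hs' with h | rfl
        exacts [h8 s hs h, h2]
      · rcases Nat.le_succ_iff.1 hs' with h | rfl
        exacts [h9 s hs h, h3]

/-- A representative increases the counter, and it is not reset within a block. Thus the values 0
and 1 separate the representatives of one block. -/
theorem blockPos_lt_of_sameBlock {i j : ℕ} (hi : IsRep D k m x e ord i) (hij : i < j)
    (hb : SameBlock D m x e ord i j) : blockPos D k m x e ord i < blockPos D k m x e ord j := by
  have key : ∀ j, i + 1 ≤ j → SameBlock D m x e ord i j →
      blockPos D k m x e ord i < blockPos D k m x e ord j := by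
    intro j hj
    have hstep : ∀ j, i ≤ j → SameBlock D m x e ord i (j + 1) →
        blockPos D k m x e ord (j + 1) = blockCount D k m x e ord (j + 1) := by
      intro j h1 h2
      rw [blockPos, if_neg]
      push Not
      exact ⟨h2.2 _ (by omega) le_rfl, h2.1 j h1 (by omega)⟩
    induction j, hj using Nat.le_induction with
    | base =>
      intro hb
      rw [hstep i le_rfl hb, blockCount_succ, if_pos hi]
      omega
    | succ j hj ih =>
      intro hb
      have := ih ⟨fun s h1 h2 => hb.1 s h1 (by omega), fun s h1 h2 => hb.2 s h1 (by omega)⟩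
      rw [hstep j (by omega) hb, blockCount_succ]
      split_ifs <;> omega
  exact key j hij hb

namespace Setting

variable (S : Setting n k D ord len x e m f l)
include S

/-- An uncovered vertex i that is no representative is preceded in its block by representatives j' <
j. Apply `trichotomy` to j: if j is on the geodesic, so is i; access from the left is excluded by
j', and access from the right by i itself. Hence two representatives per block are enough. -/
theorem covered_of_reps
    (h : ∀ i < len, IsRep D k m x e ord i → ∃ t ≤ l, D (ord i) (f t) ≤ k) :
    ∀ w < n, ∃ t ≤ l, D w (f t) ≤ k := by
  intro w hw
  by_cases hU : Uncovered D k m x e w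
  · obtain ⟨i, hi, rfl⟩ := S.cover w hw (Uncovered.not_special S hU)
    by_cases hr : IsRep D k m x e ord i
    · exact h i hi hr
    · have h2 : ¬ blockPos D k m x e ord i < 2 := fun h' => hr ⟨hU, h'⟩
      obtain ⟨j, hj, hj1, hj2, hj3, hj4⟩ := exists_prev_rep (D := D) (k := k) (m := m) (x := x)
        (e := e) (ord := ord) i (by omega)
      obtain ⟨j', hj', hj1', hj2', hj3', hj4'⟩ := exists_prev_rep (D := D) (k := k) (m := m)
        (x := x) (e := e) (ord := ord) j (by omega)
      have b1 : SameBlock D m x e ord j i := ⟨hj3, fun s h1 h2 => by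
        rcases Nat.eq_or_lt_of_le h1 with rfl | h3
        · exact Uncovered.not_break S hj1.1 (S.lay.lt _ (by omega))
        · exact hj4 s h3 h2⟩
      have b2 : SameBlock D m x e ord j' j := ⟨hj3', fun s h1 h2 => by
        rcases Nat.eq_or_lt_of_le h1 with rfl | h3
        · exact Uncovered.not_break S hj1'.1 (S.lay.lt _ (by omega))
        · exact hj4' s h3 h2⟩
      rcases S.trichotomy (by omega) hj1.1 (h j (by omega) hj1) with hp | hp | hp
      · obtain ⟨t, ht, hti⟩ := S.onPath_of_sameBlock hj.le hi hp b1
        exact ⟨t, ht, by rw [hti, S.met.self _ hw]; omega⟩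
      · exact (Left.first S hp hj1'.1 hj' b2).elim
      · exact (Right.last S hp hU hi hj b1).elim
  · unfold Uncovered at hU
    push Not at hU
    obtain ⟨j, hj, h1⟩ := hU
    obtain ⟨t, ht, h2⟩ := S.near j hj
    have := S.met.tri _ hw _ (S.x_lt j hj) _ (S.geo.lt t ht)
    exact ⟨t, ht, by omega⟩

end Setting

/-! ### Counting representatives by the gaps between special vertices -/

open Classical in
/-- The number of special vertices among `f 0, …, f t`. -/
noncomputable def gap (m : ℕ) (x f : ℕ → ℕ) (t : ℕ) : ℕ :=
  ((Finset.range (t + 1)).filter fun s => Special m x (f s)).card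

theorem gap_succ_le {s t : ℕ} (hst : s < t) (h : Special m x (f t)) :
    gap m x f s + 1 ≤ gap m x f t := by
  classical
  unfold gap
  rw [← Finset.card_insert_of_notMem (a := t) (by simp; omega)]
  refine Finset.card_le_card fun r hr => ?_
  simp only [Finset.mem_insert, Finset.mem_filter, Finset.mem_range] at hr ⊢
  rcases hr with rfl | hr
  · exact ⟨by omega, h⟩
  · exact ⟨by omega, hr.2⟩

theorem gap_mono {s t : ℕ} (hst : s ≤ t) : gap m x f s ≤ gap m x f t := by
  classical
  refine Finset.card_le_card fun r hr => ?_
  simp only [Finset.mem_filter, Finset.mem_range] at hr ⊢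
  exact ⟨by omega, hr.2⟩

theorem not_special_of_gap_eq {s t r : ℕ} (h : gap m x f s = gap m x f t) (hsr : s < r)
    (hr : r ≤ t) : ¬ Special m x (f r) := by
  intro h'
  have h1 := gap_succ_le (f := f) hsr h'
  have h2 := gap_mono (m := m) (x := x) (f := f) hr
  omega

theorem Geodesic.shift (h : Geodesic n D f l) {s d : ℕ} (hs : s + d ≤ l) :
    Geodesic n D (fun r => f (s + r)) d :=
  ⟨fun t ht => h.lt _ (by omega), fun a b h1 h2 => by
    rw [h.dist _ _ (by omega) (by omega)]
    omega⟩

namespace Setting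

variable (S : Setting n k D ord len x e m f l)
include S

/-- A special vertex on the geodesic is some x j with e j = 0, and the vertices of a geodesic are
distinct. -/
theorem gap_le [DecidablePred fun j => e j = 0] :
    gap m x f l ≤ ((Finset.range m).filter fun j => e j = 0).card := by
  classical
  have h : ∀ s, ∃ j, s ≤ l → Special m x (f s) → j < m ∧ x j = f s := by
    intro s
    by_cases h : Special m x (f s)
    · obtain ⟨j, hj⟩ := h
      exact ⟨j, fun _ _ => hj⟩
    · exact ⟨0, fun _ h' => absurd h' h⟩
  choose g hg using h
  refine Finset.card_le_card_of_injOn g (fun s hs => ?_) fun s hs s' hs' he => ?_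
  · simp only [Finset.coe_filter, Finset.mem_range, Set.mem_ofPred_eq] at hs ⊢
    obtain ⟨h1, h2⟩ := hg s (by omega) hs.2
    exact ⟨h1, S.e_zero_of_onPath h1 ⟨s, by omega, h2.symm⟩⟩
  · simp only [Finset.coe_filter, Finset.mem_range, Set.mem_ofPred_eq] at hs hs'
    obtain ⟨h1, h2⟩ := hg s (by omega) hs.2
    obtain ⟨h3, h4⟩ := hg s' (by omega) hs'.2
    exact S.geo.inj S.met (by omega) (by omega) (by rw [← h2, ← h4, he])

/-- Two vertices of the geodesic without special vertices in between are in the same block, up to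
breaks at these two vertices. -/
theorem gap_run {t t' a a' : ℕ} (htt : t ≤ t') (ht' : t' ≤ l) (hg : gap m x f t = gap m x f t')
    (ha : a < len) (ha' : a' < len) (hta : f t = ord a) (hta' : f t' = ord a')
    (hs : ¬ Special m x (f t)) {lo hi : ℕ} (h : lo = a ∧ hi = a' ∨ lo = a' ∧ hi = a)
    (hlh : lo ≤ hi) :
    (∀ b, lo ≤ b → b ≤ hi → OnPath f l (ord b)) ∧
      (∀ b, lo ≤ b → b < hi → D (ord b) (ord (b + 1)) = 1) ∧
      ∀ b, lo < b → b < hi → ¬ Break D m x e (ord b) := by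
  have hns : ∀ s, t ≤ s → s ≤ t' → ¬ Special m x (f s) := by
    intro s h1 h2
    rcases Nat.eq_or_lt_of_le h1 with rfl | h3
    exacts [hs, not_special_of_gap_eq hg h3 h2]
  obtain ⟨d, rfl⟩ := Nat.exists_eq_add_of_le htt
  -- The break is caused by some x j with e j = 0, hence on the geodesic and at most one step from f
  -- s. It would be a special vertex between f t and f (t + d).
  have hnb : ∀ s, t < s → s < t + d → ¬ Break D m x e (f s) := by
    rintro s h1 h2 ⟨j, hj, h3, h4⟩
    obtain ⟨r, hr, hrj⟩ := S.onPath_of_e_zero hj h3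
    rw [← hrj] at h4
    refine hns r ?_ ?_ (hrj ▸ ⟨j, hj, rfl⟩)
    · by_contra h5
      rw [S.met.symm _ (S.geo.lt s (by omega)) _ (S.geo.lt r hr),
        S.geo.dist r s (by omega) (by omega)] at h4
      omega
    · by_contra h5
      rw [S.geo.dist s r (by omega) (by omega)] at h4
      omega
  obtain ⟨i, hi' | hi'⟩ := (S.geo.shift ht').run S.met S.lay S.cover
    fun s hs => hns _ (by omega) (by omega)
  · have h1 := hi' 0 (by omega)
    have h2 := hi' d le_rfl
    have h3 : i + 0 = a := S.lay.inj _ h1.1 _ ha (h1.2.trans hta)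
    have h4 : i + d = a' := S.lay.inj _ h2.1 _ ha' (h2.2.trans hta')
    have h5 : ∀ b, lo ≤ b → b ≤ hi → ord b = f (t + (b - i)) := by
      intro b h5 h6
      rw [← (hi' (b - i) (by omega)).2]
      congr 1
      omega
    refine ⟨fun b h6 h7 => ⟨_, ?_, (h5 b h6 h7).symm⟩, fun b h6 h7 => ?_, fun b h6 h7 => ?_⟩
    · omega
    · rw [h5 b h6 (by omega), h5 (b + 1) (by omega) (by omega),
        S.geo.dist _ _ (by omega) (by omega)]
      omega
    · rw [h5 b h6.le h7.le]
      exact hnb _ (by omega) (by omega)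
  · have h1 := hi' 0 (by omega)
    have h2 := hi' d le_rfl
    have h3 : i - 0 = a := S.lay.inj _ (by omega) _ ha (h1.2.2.trans hta)
    have h4 : i - d = a' := S.lay.inj _ (by omega) _ ha' (h2.2.2.trans hta')
    have h5 : ∀ b, lo ≤ b → b ≤ hi → ord b = f (t + (i - b)) := by
      intro b h5 h6
      rw [← (hi' (i - b) (by omega)).2.2]
      congr 1
      omega
    refine ⟨fun b h6 h7 => ⟨_, ?_, (h5 b h6 h7).symm⟩, fun b h6 h7 => ?_, fun b h6 h7 => ?_⟩
    · omega
    · rw [h5 b h6 (by omega), h5 (b + 1) (by omega) (by omega),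
        S.met.symm _ (S.geo.lt _ (by omega)) _ (S.geo.lt _ (by omega)),
        S.geo.dist _ _ (by omega) (by omega)]
      omega
    · rw [h5 b h6.le h7.le]
      exact hnb _ (by omega) (by omega)

/-- `gap_run` without assumption on the order of `t` and `t'`. -/
theorem gap_run' {t t' a a' : ℕ} (ht : t ≤ l) (ht' : t' ≤ l) (hg : gap m x f t = gap m x f t')
    (ha : a < len) (ha' : a' < len) (hta : f t = ord a) (hta' : f t' = ord a')
    (hs : ¬ Special m x (f t)) (hs' : ¬ Special m x (f t')) (haa : a ≤ a') :
    (∀ b, a ≤ b → b ≤ a' → OnPath f l (ord b)) ∧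
      (∀ b, a ≤ b → b < a' → D (ord b) (ord (b + 1)) = 1) ∧
      ∀ b, a < b → b < a' → ¬ Break D m x e (ord b) := by
  rcases le_total t t' with h | h
  · exact S.gap_run h ht' hg ha ha' hta hta' hs (.inl ⟨rfl, rfl⟩) haa
  · exact S.gap_run h ht hg.symm ha' ha hta' hta hs' (.inr ⟨rfl, rfl⟩) haa

/-- Position `i` belongs to the gap `g` with type `τ`. -/
def GapType (D : ℕ → ℕ → ℕ) (k : ℕ) (ord : ℕ → ℕ) (len m : ℕ) (x e f : ℕ → ℕ) (l i g τ : ℕ) :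
    Prop :=
  (τ < 2 ∧ blockPos D k m x e ord i = τ ∧
    ∃ t ≤ l, f t = ord i ∧ ¬ Special m x (f t) ∧ gap m x f t = g) ∨
  (τ = 2 ∧ Left D k ord len m x e f l i ∧
    ∃ t ≤ l, f t = ord (i - k) ∧ ¬ Special m x (f t) ∧ gap m x f t = g) ∨
  (τ = 3 ∧ Right D k ord len m x e f l i ∧
    ∃ t ≤ l, f t = ord (i + k) ∧ ¬ Special m x (f t) ∧ gap m x f t = g)

/-- Two vertices of the geodesic in one gap span a run of the layout that lies on the geodesic. For
types 0 and 1 the two positions are then in one block, where `blockPos` is strictly monotone on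
representatives. For types 2 and 3 the run joins two access points, so it contains the neighbour
that `Left` or `Right` requires to be off the geodesic. -/
theorem GapType.le {i j g τ : ℕ} (hi : GapType D k ord len m x e f l i g τ)
    (hj : GapType D k ord len m x e f l j g τ) (hri : IsRep D k m x e ord i)
    (hrj : IsRep D k m x e ord j) (hil : i < len) (hjl : j < len) : j ≤ i := by
  by_contra hij
  rcases hi with ⟨h0, h1, t, ht, h2, h3, h4⟩ | ⟨h0, h1, t, ht, h2, h3, h4⟩ |
    ⟨h0, h1, t, ht, h2, h3, h4⟩ <;>
  rcases hj with ⟨h0', h1', t', ht', h2', h3', h4'⟩ | ⟨h0', h1', t', ht', h2', h3', h4'⟩ |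
    ⟨h0', h1', t', ht', h2', h3', h4'⟩ <;> try omega
  · obtain ⟨-, h5, h6⟩ := S.gap_run' ht ht' (h4.trans h4'.symm) hil hjl h2 h2' h3 h3' (by omega)
    have := blockPos_lt_of_sameBlock hri (j := j) (by omega) ⟨h5, fun s a1 a2 => ?_⟩
    · omega
    · rcases Nat.eq_or_lt_of_le a1 with rfl | a1
      · exact Uncovered.not_break S hri.1 (S.lay.lt _ hil)
      rcases Nat.eq_or_lt_of_le a2 with rfl | a2
      · exact Uncovered.not_break S hrj.1 (S.lay.lt _ hjl)
      exact h6 s a1 a2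
  · have := h1.1
    have := h1'.1
    have h5 := (S.gap_run' ht ht' (h4.trans h4'.symm) (by omega) (by omega) h2 h2' h3 h3'
      (by omega)).1 (i - k + 1) (by omega) (by omega)
    exact h1.2.2.2.2.2 h5
  · have := h1.1
    have := h1'.1
    have h5 := (S.gap_run' ht ht' (h4.trans h4'.symm) (by omega) (by omega) h2 h2' h3 h3'
      (by omega)).1 (j + k - 1) (by omega) (by omega)
    exact h1'.2.2.2.2 h5

/-- The type is the position in the block for vertices on the geodesic, and otherwise the direction
of access. An access point is not special: it is within k of the representative, which is uncovered.
Since both ends of the geodesic are special, gap numbers of non-special vertices are at least 1 and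
less than the total. -/
theorem exists_gapType {i : ℕ} (hi : i < len) (hr : IsRep D k m x e ord i)
    (hsat : ∃ t ≤ l, D (ord i) (f t) ≤ k) :
    ∃ p : ℕ × ℕ, p ∈ (Finset.Ico 1 (gap m x f l)) ×ˢ (Finset.range 4) ∧
      GapType D k ord len m x e f l i p.1 p.2 := by
  classical
  have hgap : ∀ t ≤ l, ¬ Special m x (f t) → gap m x f t ∈ Finset.Ico 1 (gap m x f l) := by
    intro t ht hs
    rw [Finset.mem_Ico]
    constructor
    · refine Finset.card_pos.2 ⟨0, ?_⟩
      simp [S.start]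
    · refine gap_succ_le (Nat.lt_of_le_of_ne ht ?_) S.finish
      rintro rfl
      exact hs S.finish
  have hns : ∀ w < n, D (ord i) w ≤ k → OnPath f l w → ¬ Special m x w := by
    rintro w hw hd hp ⟨j, hj, rfl⟩
    have := hr.1 j hj
    rw [S.e_zero_of_onPath hj hp] at this
    omega
  rcases S.trichotomy hi hr.1 hsat with hp | hp | hp
  · obtain ⟨t, ht, h⟩ := hp
    have hs : ¬ Special m x (f t) := h ▸ Uncovered.not_special S hr.1
    exact ⟨(gap m x f t, blockPos D k m x e ord i),
      Finset.mem_product.2 ⟨hgap t ht hs, Finset.mem_range.2 (hr.2.trans (by omega))⟩,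
      .inl ⟨hr.2, rfl, t, ht, h, hs, rfl⟩⟩
  · obtain ⟨h1, h2, ⟨t, ht, h⟩, h4, h5, h6⟩ := id hp
    have hd := S.dist_le_of_adj (i := i - k) (d := k) (by omega) h5
    rw [show i - k + k = i by omega,
      S.met.symm _ (S.lay.lt _ (by omega)) _ (S.lay.lt _ (by omega)), ← h] at hd
    have hs := hns _ (S.geo.lt t ht) hd ⟨t, ht, rfl⟩
    exact ⟨(gap m x f t, 2), Finset.mem_product.2 ⟨hgap t ht hs, Finset.mem_range.2 (by omega)⟩,
      .inr (.inl ⟨rfl, hp, t, ht, h, hs, rfl⟩)⟩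
  · obtain ⟨h2, ⟨t, ht, h⟩, h4, h5, h6⟩ := id hp
    have hd := S.dist_le_of_adj (i := i) (d := k) (by omega) h5
    rw [← h] at hd
    have hs := hns _ (S.geo.lt t ht) hd ⟨t, ht, rfl⟩
    exact ⟨(gap m x f t, 3), Finset.mem_product.2 ⟨hgap t ht hs, Finset.mem_range.2 (by omega)⟩,
      .inr (.inr ⟨rfl, hp, t, ht, h, hs, rfl⟩)⟩

/-- There are at most four representatives between any two consecutive special vertices of a
geodesic of eccentricity at most `k`. -/
theorem card_reps_le [DecidablePred fun j => e j = 0] [DecidablePred (IsRep D k m x e ord)]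
    (h : ∀ w < n, ∃ t ≤ l, D w (f t) ≤ k) :
    ((Finset.range len).filter (IsRep D k m x e ord)).card + 4 ≤
      4 * ((Finset.range m).filter fun j => e j = 0).card := by
  classical
  have hG := S.gap_le
  have h1 : 1 ≤ gap m x f l := Finset.card_pos.2 ⟨0, by simp [S.start]⟩
  have h2 : ∀ i, ∃ p : ℕ × ℕ, i < len → IsRep D k m x e ord i →
      p ∈ (Finset.Ico 1 (gap m x f l)) ×ˢ (Finset.range 4) ∧
        GapType D k ord len m x e f l i p.1 p.2 := by
    intro i
    by_cases hi : i < len ∧ IsRep D k m x e ord i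
    · obtain ⟨p, hp⟩ := S.exists_gapType hi.1 hi.2 (h _ (S.lay.lt i hi.1))
      exact ⟨p, fun _ _ => hp⟩
    · exact ⟨(0, 0), fun h h' => absurd ⟨h, h'⟩ hi⟩
  choose g hg using h2
  have h3 := Finset.card_le_card_of_injOn (s := (Finset.range len).filter (IsRep D k m x e ord))
    (t := (Finset.Ico 1 (gap m x f l)) ×ˢ (Finset.range 4)) g (fun i hi => ?_)
    fun i hi j hj he => ?_
  · rw [Finset.card_product, Nat.card_Ico, Finset.card_range] at h3
    omega
  · simp only [Finset.coe_filter, Finset.mem_range, Set.mem_ofPred_eq] at hi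
    exact (hg i hi.1 hi.2).1
  · simp only [Finset.coe_filter, Finset.mem_range, Set.mem_ofPred_eq] at hi hj
    have h4 := (hg i hi.1 hi.2).2
    have h5 := (hg j hj.1 hj.2).2
    rw [he] at h4
    exact le_antisymm (GapType.le S h5 h4 hj.2 hi.2 hj.1 hi.1)
      (GapType.le S h4 h5 hi.2 hj.2 hi.1 hj.1)

end Setting

end MESP

namespace MESP

/-! ### The criterion decided by the algorithm -/

/-- Some shortest path has eccentricity at most `k`. -/
def HasGeodesic (n : ℕ) (D : ℕ → ℕ → ℕ) (k : ℕ) : Prop :=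
  ∃ f l, Geodesic n D f l ∧ ∀ w < n, ∃ t ≤ l, D w (f t) ≤ k

/-- The vertex may be used by a shortest path that starts in `u` and has the distances `e j` from
the vertices `x j`. -/
def Allowed (D : ℕ → ℕ → ℕ) (m : ℕ) (x e : ℕ → ℕ) (u q : ℕ) : Prop :=
  ∀ j < m, e j ≤ D q (x j) ∧ (e j = 0 → D u q = D u (x j) → q = x j)

/-- All pairs of a vertex and a radius that have to be checked satisfy `Φ`. -/
def ForallReq (D : ℕ → ℕ → ℕ) (k m : ℕ) (x e ord : ℕ → ℕ) (len : ℕ) (Φ : ℕ → ℕ → Prop) : Prop :=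
  (∀ j < m, 0 < e j → Φ (x j) (e j)) ∧ ∀ i < len, IsRep D k m x e ord i → Φ (ord i) k

open Classical in
/-- The number of pairs that have to be checked. -/
noncomputable def numReq (D : ℕ → ℕ → ℕ) (k m : ℕ) (x e ord : ℕ → ℕ) (len : ℕ) : ℕ :=
  ((Finset.range m).filter fun j => 0 < e j).card +
    ((Finset.range len).filter (IsRep D k m x e ord)).card

/-- The guess `u, v, e` is confirmed. -/
def Confirmed (n : ℕ) (D : ℕ → ℕ → ℕ) (k c : ℕ) (x e ord : ℕ → ℕ) (len u v : ℕ) : Prop :=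
  (∀ j < c + 2, e j = 0 → D u (x j) ≤ D u v) ∧
  numReq D k (c + 2) x e ord len ≤ 4 * c + 4 ∧
  ∃ f, f 0 = u ∧ f (D u v) = v ∧ Geodesic n D f (D u v) ∧
    (∀ t ≤ D u v, Allowed D (c + 2) x e u (f t)) ∧
    ForallReq D k (c + 2) x e ord len fun w r => ∃ t ≤ D u v, D w (f t) ≤ r

variable {n k c u v len : ℕ} {D : ℕ → ℕ → ℕ} {C x e ord : ℕ → ℕ}

/-- The conditions make the guessed e exact. `Allowed` gives e j as a lower bound for the distance
from x j. The upper bound is a listed requirement if e j > 0; if e j = 0, the vertex of the path at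
the level of x j must be x j itself. Then `Setting.covered_of_reps` applies. -/
theorem hasGeodesic_of_confirmed (hM : GraphMetric n D) (hL : Layout n D ord len)
    (hc : ∀ a < n, ¬ Special (c + 2) x a → ∃ i < len, ord i = a)
    (hx : ∀ j < c + 2, x j < n) (hxu : x c = u) (hxv : x (c + 1) = v) (hk : 0 < k)
    (he : ∀ j < c + 2, e j ≤ k)
    (h : Confirmed n D k c x e ord len u v) : HasGeodesic n D k := by
  obtain ⟨h1, -, f, h0, hl, hf, h2, h3⟩ := h
  have S : Setting n k D ord len x e (c + 2) f (D u v) := by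
    refine ⟨hM, hL, hc, hx, hf, ⟨c, by omega, by rw [hxu, h0]⟩, ⟨c + 1, by omega, by rw [hxv, hl]⟩,
      fun j hj => ?_, fun j hj t ht => ?_, he, hk⟩
    · rcases Nat.eq_zero_or_pos (e j) with h4 | h4
      · have h5 := h1 j hj h4
        have h6 := hf.dist 0 (D u (x j)) (by omega) h5
        rw [h0, Nat.sub_zero] at h6
        have h7 := (h2 _ h5 j hj).2 h4 h6
        exact ⟨_, h5, by rw [h7, hM.self _ (hx j hj)]; omega⟩
      · exact h3.1 j hj h4
    · rw [hM.symm _ (hx j hj) _ (hf.lt t ht)]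
      exact (h2 t ht j hj).1
  exact ⟨f, _, hf, S.covered_of_reps h3.2⟩

/-- The guess consists of the true distances from a good path. The conclusion holds for all x and e
with the prescribed first c + 2 values, because the arrays in memory are arbitrary beyond them. -/
theorem exists_confirmed (hM : GraphMetric n D) (hL : Layout n D ord len)
    (hc : ∀ a < n, (∀ j < c, C j ≠ a) → ∃ i < len, ord i = a)
    (hC : ∀ j < c, C j < n) (hk : 0 < k) (h : HasGeodesic n D k) :
    ∃ u < n, ∃ v < n, ∃ e₀ : ℕ → ℕ, (∀ j < c, e₀ j ≤ k) ∧ ∀ x e : ℕ → ℕ, (∀ j < c, x j = C j) →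
      x c = u → x (c + 1) = v → (∀ j < c, e j = e₀ j) → e c = 0 → e (c + 1) = 0 →
      Confirmed n D k c x e ord len u v := by
  classical
  obtain ⟨f, l, hf, hcov⟩ := h
  have hmin : ∀ a, ∃ r, a < n → (∃ t ≤ l, D a (f t) ≤ r) ∧ (∀ t ≤ l, r ≤ D a (f t)) ∧ r ≤ k := by
    intro a
    obtain ⟨t, ht, h⟩ := Finset.exists_min_image (Finset.range (l + 1)) (fun t => D a (f t))
      ⟨0, by simp⟩
    refine ⟨D a (f t), fun ha => ⟨⟨t, by simpa [Nat.lt_succ_iff] using ht, le_rfl⟩,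
      fun s hs => h s (by simpa [Nat.lt_succ_iff]), ?_⟩⟩
    obtain ⟨s, hs, h'⟩ := hcov a ha
    exact (h s (by simpa [Nat.lt_succ_iff])).trans h'
  choose r hr using hmin
  have hr0 : ∀ t ≤ l, r (f t) = 0 := by
    intro t ht
    have := (hr _ (hf.lt t ht)).2.1 t ht
    rw [hM.self _ (hf.lt t ht)] at this
    omega
  have huv : D (f 0) (f l) = l := by rw [hf.dist 0 l (by omega) le_rfl, Nat.sub_zero]
  refine ⟨f 0, hf.lt 0 (by omega), f l, hf.lt l le_rfl, fun j => r (C j),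
    fun j hj => (hr _ (hC j hj)).2.2, fun x e hxC hxu hxv he hec hec' => ?_⟩
  have hx : ∀ j < c + 2, x j < n := by
    intro j hj
    rcases lt_trichotomy j c with h | rfl | h
    · rw [hxC j h]
      exact hC j h
    · rw [hxu]
      exact hf.lt 0 (by omega)
    · obtain rfl : j = c + 1 := by omega
      rw [hxv]
      exact hf.lt l le_rfl
  have her : ∀ j < c + 2, e j = r (x j) := by
    intro j hj
    rcases lt_trichotomy j c with h | rfl | h
    · rw [hxC j h, he j h]
    · rw [hxu, hec, hr0 0 (by omega)]
    · obtain rfl : j = c + 1 := by omega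
      rw [hxv, hec', hr0 l le_rfl]
  have S : Setting n k D ord len x e (c + 2) f l := by
    refine ⟨hM, hL, fun a ha h => hc a ha fun j hj hja => h ⟨j, by omega, by rw [hxC j hj, hja]⟩,
      hx, hf, ⟨c, by omega, hxu⟩, ⟨c + 1, by omega, hxv⟩, fun j hj => ?_, fun j hj => ?_,
      fun j hj => ?_, hk⟩
    · rw [her j hj]
      exact (hr _ (hx j hj)).1
    · rw [her j hj]
      exact (hr _ (hx j hj)).2.1
    · rw [her j hj]
      exact (hr _ (hx j hj)).2.2
  unfold Confirmed
  rw [huv]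
  refine ⟨fun j hj h0 => ?_, ?_, f, rfl, rfl, hf, fun t ht j hj => ⟨?_, fun h0 h1 => ?_⟩,
    fun j hj _ => S.near j hj, fun i hi _ => hcov _ (hL.lt i hi)⟩
  · obtain ⟨t, ht, h⟩ := S.onPath_of_e_zero hj h0
    rw [← h, hf.dist 0 t (by omega) ht]
    omega
  -- With z indices j such that e j = 0, the number of requirements is at most (c + 2 - z) + (4z -
  -- 4) ≤ 4c + 4, as z ≤ c + 2.
  · have h1 := S.card_reps_le hcov
    have h2 := Finset.card_filter_add_card_filter_not (s := Finset.range (c + 2))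
      (fun j => e j = 0)
    simp only [← Nat.pos_iff_ne_zero, Finset.card_range] at h2
    unfold numReq
    convert_to ((Finset.range (c + 2)).filter fun j => 0 < e j).card +
      ((Finset.range len).filter (IsRep D k (c + 2) x e ord)).card ≤ _
    omega
  · rw [hM.symm _ (hf.lt t ht) _ (hx j hj)]
    exact S.far j hj t ht
  · obtain ⟨s, hs, h⟩ := S.onPath_of_e_zero hj h0
    rw [← h, hf.dist 0 t (by omega) ht, hf.dist 0 s (by omega) hs] at h1
    rw [← h, show t = s by omega]

/-- A geodesic with n different vertices exhausts the graph. This and its converse for k = 0 replace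
the block argument, which needs k > 0. -/
theorem hasGeodesic_of_dist_add_one (hM : GraphMetric n D) (hu : u < n) (hv : v < n)
    (h : D u v + 1 = n) : HasGeodesic n D k := by
  obtain ⟨f, -, -, hf⟩ := exists_geodesic hM hu hv
  refine ⟨f, _, hf, fun w hw => ?_⟩
  have h1 : (Finset.range n).image f = Finset.range n := by
    refine Finset.eq_of_subset_of_card_le (fun a ha => ?_) ?_
    · obtain ⟨t, ht, rfl⟩ := Finset.mem_image.1 ha
      exact Finset.mem_range.2 (hf.lt t (by rw [Finset.mem_range] at ht; omega))
    · rw [Finset.card_image_of_injOn]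
      intro s hs t ht he
      simp only [Finset.coe_range, Set.mem_Iio] at hs ht
      exact hf.inj hM (by omega) (by omega) he
  obtain ⟨t, ht, rfl⟩ := Finset.mem_image.1 (h1 ▸ Finset.mem_range.2 hw)
  exact ⟨t, by rw [Finset.mem_range] at ht; omega, by rw [hM.self _ hw]; omega⟩

theorem exists_dist_add_one (hM : GraphMetric n D) (h : HasGeodesic n D 0) :
    ∃ u < n, ∃ v < n, D u v + 1 = n := by
  obtain ⟨f, l, hf, hcov⟩ := h
  refine ⟨f 0, hf.lt 0 (by omega), f l, hf.lt l le_rfl, ?_⟩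
  rw [hf.dist 0 l (by omega) le_rfl]
  have h1 : (Finset.range (l + 1)).image f = Finset.range n := by
    ext a
    simp only [Finset.mem_image, Finset.mem_range]
    constructor
    · rintro ⟨t, ht, rfl⟩
      exact hf.lt t (by omega)
    · intro ha
      obtain ⟨t, ht, h⟩ := hcov a ha
      exact ⟨t, by omega, (hM.eq a ha _ (hf.lt t ht) (by omega)).symm⟩
  have h2 := congrArg Finset.card h1
  rw [Finset.card_image_of_injOn, Finset.card_range, Finset.card_range] at h2
  · omega
  · intro s hs t ht he
    simp only [Finset.coe_range, Set.mem_Iio] at hs ht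
    exact hf.inj hM (by omega) (by omega) he

end MESP

namespace MESP

/-! ### Graphs and their distance functions -/

open Classical in
/-- The distance function on vertex numbers. -/
noncomputable def distFn {n : ℕ} (G : SimpleGraph (Fin n)) (a b : ℕ) : ℕ :=
  if h : a < n ∧ b < n then G.dist ⟨a, h.1⟩ ⟨b, h.2⟩ else 0

variable {n k : ℕ} {G : SimpleGraph (Fin n)}

theorem distFn_val (a b : Fin n) : distFn G a b = G.dist a b := by
  simp [distFn]

theorem graphMetric_distFn (hG : G.Connected) : GraphMetric n (distFn G) where
  self a ha := by
    lift a to Fin n using ha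
    simp [distFn_val]
  eq a ha b hb h := by
    lift a to Fin n using ha
    lift b to Fin n using hb
    rw [distFn_val, hG.dist_eq_zero_iff] at h
    rw [h]
  symm a ha b hb := by
    lift a to Fin n using ha
    lift b to Fin n using hb
    rw [distFn_val, distFn_val, SimpleGraph.dist_comm]
  tri a ha b hb c hc := by
    lift a to Fin n using ha
    lift b to Fin n using hb
    lift c to Fin n using hc
    rw [distFn_val, distFn_val, distFn_val]
    exact hG.dist_triangle
  step a ha b hb t h := by
    lift a to Fin n using ha
    lift b to Fin n using hb
    rw [distFn_val, SimpleGraph.dist_comm] at h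
    obtain ⟨p, hp⟩ := hG.exists_walk_length_eq_dist b a
    rw [h] at hp
    cases p with
    | nil => simp at hp
    | @cons _ c _ hadj q =>
      refine ⟨c, c.2, ?_, ?_⟩
      · rw [distFn_val, SimpleGraph.dist_comm]
        have h1 := SimpleGraph.dist_le q
        have h2 := hG.dist_triangle (u := b) (v := c) (w := a)
        rw [h, SimpleGraph.dist_eq_one_iff_adj.2 hadj] at h2
        rw [SimpleGraph.Walk.length_cons] at hp
        omega
      · rw [distFn_val, SimpleGraph.dist_eq_one_iff_adj]
        exact hadj.symm

theorem distFn_eq_one (a b : Fin n) : distFn G a b = 1 ↔ G.Adj a b := by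
  rw [distFn_val, SimpleGraph.dist_eq_one_iff_adj]

theorem distFn_lt (hG : G.Connected) {a b : ℕ} (ha : a < n) (hb : b < n) : distFn G a b < n := by
  lift a to Fin n using ha
  lift b to Fin n using hb
  rw [distFn_val]
  obtain ⟨p, hp, hl⟩ := hG.exists_path_of_dist a b
  rw [← hl]
  have := hp.length_lt
  simpa using this

theorem distToSet_le_iff (w : Fin n) {s : Set (Fin n)} (hs : s.Nonempty) :
    distToSet G w s ≤ k ↔ ∃ a ∈ s, G.dist w a ≤ k := by
  unfold distToSet
  constructor
  · intro h
    obtain ⟨a, ha, h'⟩ := Nat.sInf_mem (hs.image fun a => G.dist w a)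
    exact ⟨a, ha, by simpa only [h'] using h⟩
  · rintro ⟨a, ha, h⟩
    exact (Nat.sInf_le (Set.mem_image_of_mem _ ha)).trans h

theorem ecc_le_iff {s : Set (Fin n)} (hs : s.Nonempty) :
    ecc G s ≤ k ↔ ∀ w, ∃ a ∈ s, G.dist w a ≤ k := by
  simp only [ecc, Finset.sup_le_iff, Finset.mem_univ, true_implies, distToSet_le_iff _ hs]

theorem exists_walk_of_geodesic {f : ℕ → ℕ} {l : ℕ} (hf : Geodesic n (distFn G) f l) (a b : Fin n)
    (ha : f 0 = a) (hb : f l = b) :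
    ∃ P : G.Walk a b, P.length = l ∧ ∀ t ≤ l, ∃ c ∈ P.support, f t = (c : Fin n).val := by
  induction l generalizing b with
  | zero =>
    obtain rfl : a = b := Fin.ext (ha.symm.trans hb)
    exact ⟨.nil, rfl, fun t ht => ⟨a, by simp, by rw [← ha]; congr; omega⟩⟩
  | succ l ih =>
    obtain ⟨P, hP, h⟩ := ih (hf.mono (Nat.le_succ l)) ⟨f l, hf.lt l (by omega)⟩ rfl
    have h1 := hf.dist l (l + 1) (by omega) le_rfl
    rw [hb, show l + 1 - l = 1 by omega] at h1
    have h2 := (distFn_eq_one ⟨f l, hf.lt l (by omega)⟩ b).1 h1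
    refine ⟨P.concat h2, by simp [hP], fun t ht => ?_⟩
    rcases Nat.le_succ_iff.1 ht with h3 | rfl
    · obtain ⟨c, hc, h4⟩ := h t h3
      exact ⟨c, by simp [SimpleGraph.Walk.support_concat, hc], h4⟩
    · exact ⟨b, by simp [SimpleGraph.Walk.support_concat], hb⟩

/-- A shortest path has length d(u, v), so its initial and final pieces are also shortest and its
vertices form a `Geodesic`. Conversely, a geodesic gives a walk whose length is the distance of its
ends, hence a path. -/
theorem isYes_iff_hasGeodesic (hG : G.Connected) : IsYes G k ↔ HasGeodesic n (distFn G) k := by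
  have hM := graphMetric_distFn hG
  constructor
  · rintro ⟨u, v, P, ⟨-, hmin⟩, hecc⟩
    rw [ecc_le_iff ⟨u, by simp⟩] at hecc
    have hl : P.length = G.dist u v := by
      refine le_antisymm ?_ (SimpleGraph.dist_le P)
      obtain ⟨Q, hQ, hl⟩ := hG.exists_path_of_dist u v
      exact hl ▸ hmin Q hQ
    have h0 : ∀ t ≤ P.length, G.dist u (P.getVert t) = t := by
      intro t ht
      have h1 := SimpleGraph.dist_le (P.take t)
      have h2 := SimpleGraph.dist_le (P.drop t)
      have h3 := hG.dist_triangle (u := u) (v := P.getVert t) (w := v)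
      rw [SimpleGraph.Walk.take_length] at h1
      rw [SimpleGraph.Walk.drop_length] at h2
      omega
    refine ⟨fun t => P.getVert t, P.length, Geodesic.of_steps hM (fun t _ => (P.getVert t).2)
      (fun t ht => ?_) (fun t ht => ?_), fun w hw => ?_⟩
    · rw [distFn_val, SimpleGraph.Walk.getVert_zero]
      exact h0 t ht
    · rw [distFn_eq_one]
      exact P.adj_getVert_succ ht
    · obtain ⟨a, ha, h⟩ := hecc ⟨w, hw⟩
      obtain ⟨t, h1, h2⟩ := SimpleGraph.Walk.mem_support_iff_exists_getVert.1 ha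
      refine ⟨t, h2, ?_⟩
      have := distFn_val (G := G) ⟨w, hw⟩ (P.getVert t)
      rw [this, h1]
      exact h
  · rintro ⟨f, l, hf, hcov⟩
    obtain ⟨P, hP, h⟩ := exists_walk_of_geodesic hf ⟨f 0, hf.lt 0 (by omega)⟩
      ⟨f l, hf.lt l le_rfl⟩ rfl rfl
    have hd := hf.dist 0 l (by omega) le_rfl
    have hd' := distFn_val (G := G) ⟨f 0, hf.lt 0 (by omega)⟩ ⟨f l, hf.lt l le_rfl⟩
    have hl : P.length = G.dist _ _ := hP.trans (by rw [← hd']; exact hd.symm)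
    refine ⟨_, _, P, ⟨P.isPath_of_length_eq_dist hl, fun Q _ => hl ▸ SimpleGraph.dist_le Q⟩, ?_⟩
    rw [ecc_le_iff ⟨_, P.start_mem_support⟩]
    intro w
    obtain ⟨t, ht, h1⟩ := hcov w w.2
    obtain ⟨a, ha, h2⟩ := h t ht
    exact ⟨a, ha, by rwa [h2, distFn_val] at h1⟩

/-! ### Modulators -/

/-- `X` meets every claw and every subgraph of minimum degree at least two. -/
structure Meets (n : ℕ) (D : ℕ → ℕ → ℕ) (X : Finset ℕ) : Prop where
  claw : ∀ w < n, ∀ y₁ < n, ∀ y₂ < n, ∀ y₃ < n, D w y₁ = 1 → D w y₂ = 1 → D w y₃ = 1 →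
    y₁ ≠ y₂ → y₁ ≠ y₃ → y₂ ≠ y₃ → w ∈ X ∨ y₁ ∈ X ∨ y₂ ∈ X ∨ y₃ ∈ X
  core : ∀ R : Finset ℕ, R.Nonempty → (∀ w ∈ R, w < n ∧ ∃ y₁ ∈ R, ∃ y₂ ∈ R, y₁ ≠ y₂ ∧
    D w y₁ = 1 ∧ D w y₂ = 1) → ∃ w ∈ R, w ∈ X

/-- The position is the index in the path formed by the component. Different components reuse the
same indices, so injectivity is claimed only for neighbours of a common vertex. -/
theorem exists_positions {X : Finset (Fin n)} (hX : IsModulator G X) :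
    ∃ pos : Fin n → ℕ, ∀ w y z, w ∉ X → y ∉ X → z ∉ X → G.Adj w y → G.Adj w z →
      (pos y = pos w + 1 ∨ pos w = pos y + 1) ∧ (pos y = pos z → y = z) := by
  classical
  choose m hm using hX
  let κ : ∀ v : Fin n, v ∉ X → (G.induce {v | v ∉ X}).ConnectedComponent :=
    fun v hv => (G.induce {v | v ∉ X}).connectedComponentMk ⟨v, hv⟩
  let φ := fun K => (hm K).some
  refine ⟨fun v => if hv : v ∉ X then (φ (κ v hv) ⟨⟨v, hv⟩, rfl⟩).val else 0,
    fun w y z hw hy hz hwy hwz => ?_⟩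
  have hadj : ∀ y (hy : y ∉ X), G.Adj w y → κ y hy = κ w hw := by
    intro y hy h
    refine SimpleGraph.ConnectedComponent.sound (SimpleGraph.Adj.reachable ?_)
    exact h.symm
  have hval : ∀ y (hy : y ∉ X) (K) (h : κ y hy = K),
      (φ (κ y hy) ⟨⟨y, hy⟩, rfl⟩).val = (φ K ⟨⟨y, hy⟩, h⟩).val := by
    rintro y hy K rfl
    rfl
  simp only [hw, hy, hz, not_false_eq_true, dif_pos]
  rw [hval y hy _ (hadj y hy hwy), hval z hz _ (hadj z hz hwz)]
  constructor
  · have h1 : (SimpleGraph.pathGraph (m (κ w hw))).Adj (φ (κ w hw) ⟨⟨w, hw⟩, rfl⟩)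
        (φ (κ w hw) ⟨⟨y, hy⟩, hadj y hy hwy⟩) := (φ (κ w hw)).map_adj_iff.2 hwy
    rw [SimpleGraph.pathGraph_adj] at h1
    omega
  · intro h
    have h1 := (φ (κ w hw)).injective (Fin.ext h)
    exact congrArg Subtype.val (congrArg Subtype.val h1)

/-- Outside X, three different neighbours of w would need three different positions among the two
next to w. In a set of minimum degree two, a vertex of least position would have two neighbours,
both one position higher. -/
theorem meets_of_isModulator {X : Finset (Fin n)} (hX : IsModulator G X) :
    Meets n (distFn G) (X.map Fin.valEmbedding) := by
  classical
  obtain ⟨pos, hpos⟩ := exists_positions hX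
  have hmem : ∀ a : Fin n, a.val ∈ X.map Fin.valEmbedding ↔ a ∈ X := by
    intro a
    simp [Fin.val_inj]
  constructor
  · intro w hw y₁ h₁ y₂ h₂ y₃ h₃ a₁ a₂ a₃ n₁₂ n₁₃ n₂₃
    lift w to Fin n using hw
    lift y₁ to Fin n using h₁
    lift y₂ to Fin n using h₂
    lift y₃ to Fin n using h₃
    rw [distFn_eq_one] at a₁ a₂ a₃
    simp only [hmem]
    by_contra hcon
    push Not at hcon
    obtain ⟨c0, c1, c2, c3⟩ := hcon
    have b12 := hpos w y₁ y₂ c0 c1 c2 a₁ a₂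
    have b13 := hpos w y₁ y₃ c0 c1 c3 a₁ a₃
    have b23 := hpos w y₂ y₃ c0 c2 c3 a₂ a₃
    have b3 := hpos w y₃ y₃ c0 c3 c3 a₃ a₃
    have e12 : pos y₁ ≠ pos y₂ := fun h => n₁₂ (congrArg _ (b12.2 h))
    have e13 : pos y₁ ≠ pos y₃ := fun h => n₁₃ (congrArg _ (b13.2 h))
    have e23 : pos y₂ ≠ pos y₃ := fun h => n₂₃ (congrArg _ (b23.2 h))
    omega
  · intro R hR h
    by_contra hcon
    push Not at hcon
    have hRn : ∀ w ∈ R, w < n := fun w hw => (h w hw).1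
    obtain ⟨w, hw, hmin⟩ := Finset.exists_min_image R
      (fun a => if ha : a < n then pos ⟨a, ha⟩ else 0) hR
    obtain ⟨hwn, y, hy, z, hz, hne, h1, h2⟩ := h w hw
    have hyn := hRn y hy
    have hzn := hRn z hz
    have m1 := hmin y hy
    have m2 := hmin z hz
    have c0 := hcon w hw
    have c1 := hcon y hy
    have c2 := hcon z hz
    lift w to Fin n using hwn
    lift y to Fin n using hyn
    lift z to Fin n using hzn
    rw [distFn_eq_one] at h1 h2
    rw [hmem] at c0 c1 c2
    simp only [Fin.is_lt, dif_pos, Fin.eta] at m1 m2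
    have b12 := hpos w y z c0 c1 c2 h1 h2
    have b2 := hpos w z z c0 c2 c2 h2 h2
    exact hne (congrArg _ (b12.2 (by omega)))

theorem exists_meets (G : SimpleGraph (Fin n)) :
    ∃ X : Finset ℕ, X ⊆ Finset.range n ∧ X.card = distToDisjointPaths G ∧
      Meets n (distFn G) X := by
  have hne : {s | ∃ X : Finset (Fin n), IsModulator G X ∧ X.card = s}.Nonempty := by
    refine ⟨_, Finset.univ, fun K => ?_, rfl⟩
    obtain ⟨⟨v, hv⟩, -⟩ := K.exists_rep
    simp at hv
  obtain ⟨X, hX, hc⟩ := Nat.sInf_mem hne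
  refine ⟨X.map Fin.valEmbedding, fun a ha => ?_, by rw [Finset.card_map, hc]; rfl,
    meets_of_isModulator hX⟩
  obtain ⟨b, -, rfl⟩ := Finset.mem_map.1 ha
  simp

end MESP

/-! ### Computing the distance matrix

Registers `0` and `1` hold `n` and `k`; array `0` is the adjacency matrix, array `1` the table of the
multiples of `n`, array `2` the distance matrix. -/

namespace MESP

open RAM

variable {n k : ℕ} {G : SimpleGraph (Fin n)} {M : Memory}

/-- Entry of the adjacency matrix. -/
def adjE (a b : Expr) : Expr := .get 0 (.add (.get 1 a) b)

/-- Entry of the distance matrix. -/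
def distE (a b : Expr) : Expr := .get 2 (.add (.get 1 a) b)

@[simp] theorem eval_adjE (a b : Expr) :
    (adjE a b).eval M = M.arr 0 (M.arr 1 (a.eval M) + b.eval M) := rfl

@[simp] theorem eval_distE (a b : Expr) :
    (distE a b).eval M = M.arr 2 (M.arr 1 (a.eval M) + b.eval M) := rfl

@[simp] theorem cost_adjE (a b : Expr) : (adjE a b).cost = a.cost + b.cost + 3 := by
  simp [adjE]
  omega

@[simp] theorem cost_distE (a b : Expr) : (distE a b).cost = a.cost + b.cost + 3 := by
  simp [distE]
  omega

/-- Table of the multiples of `n`. -/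
def rowProg : Prog :=
  .forLoop 2 (.add (.reg 0) (.lit 1)) (.put 1 (.reg 2) (.reg 3) ;; .assign 3 (.add (.reg 3) (.reg 0)))

theorem runs_rowProg (h0 : M.reg 0 = n) (h3 : M.reg 3 = 0) :
    Runs rowProg M (30 * n + 40) fun M' => ∀ a ≤ n, M'.arr 1 a = a * n := by
  -- Row n is included because n serves as a dummy vertex while the layout is empty.
  refine Runs.mono (Runs.forLoop (n := n + 1) (tb := 7)
    (fun i M' => M'.reg 3 = i * n ∧ ∀ a < i, M'.arr 1 a = a * n) rfl ?_ ?_ ?_) ?_ ?_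
  · intro M' hF
    simp [hF.reg 0 rfl, h0]
  · simp [h3]
  · rintro i hi M' hF hMi ⟨h1, h2⟩
    refine Runs.time (Runs.put_seq (Runs.assign ?_)) (by simp)
    refine ⟨?_, fun a ha => ?_⟩
    · simp [h1, hF.reg 0 rfl, h0]
      ring
    · simp only [Expr.eval_reg, hMi, h1, Memory.setReg_arr, Memory.setArr_arr_self,
        Function.update_apply]
      split_ifs with h
      · rw [h]
      · exact h2 a (by omega)
  · simp
    omega
  · exact fun M' h a ha => h.1.2 a (by omega)

theorem cell_inj {a b a' b' : ℕ} (hb : b < n) (hb' : b' < n) :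
    a * n + b = a' * n + b' ↔ a = a' ∧ b = b' := by
  constructor
  · intro h
    have h1 : (a * n + b) / n = (a' * n + b') / n := by rw [h]
    rw [mul_comm a, mul_comm a', Nat.mul_add_div (by omega), Nat.mul_add_div (by omega),
      Nat.div_eq_of_lt hb, Nat.div_eq_of_lt hb'] at h1
    obtain rfl : a = a' := by omega
    exact ⟨rfl, by omega⟩
  · rintro ⟨rfl, rfl⟩
    rfl

/-- Try to find the distance `t + 1` between the vertices in registers `2` and `3`, where `t` is in
register `4`. -/
def distCell : Prog :=
  .ite (.lt (distE (.reg 2) (.reg 3)) (.reg 0)) .skip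
    (.find 5 6 (.reg 0) .skip
        (.and (.eq (distE (.reg 2) (.reg 5)) (.reg 4)) (adjE (.reg 5) (.reg 3))) ;;
      .ite (.lt (.reg 6) (.reg 0))
        (.put 2 (.add (.get 1 (.reg 2)) (.reg 3)) (.add (.reg 4) (.lit 1))) .skip)

/-- The distances from the vertex in register `2`. -/
def distRow : Prog :=
  .forLoop 3 (.reg 0) (.put 2 (.add (.get 1 (.reg 2)) (.reg 3)) (.reg 0)) ;;
    .put 2 (.add (.get 1 (.reg 2)) (.reg 2)) (.lit 0) ;;
    .forLoop 4 (.reg 0) (.forLoop 3 (.reg 0) distCell)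

/-- The distance matrix. -/
def distProg : Prog := .forLoop 2 (.reg 0) distRow

/-- Distances above the threshold `t` are replaced by `n`. -/
noncomputable def cutDist (G : SimpleGraph (Fin n)) (t a b : ℕ) : ℕ :=
  if distFn G a b ≤ t then distFn G a b else n

/-- The registers and arrays that are never changed after the preparations. -/
structure Prepared (G : SimpleGraph (Fin n)) (k : ℕ) (M : Memory) : Prop where
  n_eq : M.reg 0 = n
  k_eq : M.reg 1 = k
  row : ∀ a ≤ n, M.arr 1 a = a * n
  adj : ∀ a ≤ n, ∀ b < n, M.arr 0 (a * n + b) = 0 ↔ ¬ distFn G a b = 1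

theorem Prepared.congr {M' : Memory} (h : Prepared G k M) (h0 : M'.reg 0 = M.reg 0)
    (h1 : M'.reg 1 = M.reg 1) (h2 : M'.arr 0 = M.arr 0) (h3 : M'.arr 1 = M.arr 1) :
    Prepared G k M' :=
  ⟨h0.trans h.n_eq, h1.trans h.k_eq, h3 ▸ h.row, h2 ▸ h.adj⟩

/-- Breadth-first search by rounds: an entry not yet known becomes t + 1 exactly if j has a
neighbour at distance t from i. -/
theorem runs_distCell {i j t : ℕ} (hG : G.Connected) (hP : Prepared G k M) (hi : i < n)
    (hj : j < n) (ht : t < n)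
    (hMi : M.reg 2 = i) (hMj : M.reg 3 = j) (hMt : M.reg 4 = t)
    (hD : ∀ b < n, M.arr 2 (i * n + b) =
      if b < j then cutDist G (t + 1) i b else cutDist G t i b) :
    Runs distCell M (42 * n + 40) fun M' =>
      M'.arr 2 = Function.update (M.arr 2) (i * n + j) (cutDist G (t + 1) i j) := by
  have hM := graphMetric_distFn hG
  have hlt : ∀ b < n, distFn G i b < n := fun b hb => distFn_lt hG hi hb
  have hval : M.arr 2 (i * n + j) = cutDist G t i j := by simp [hD j hj]
  have heq : ∀ v, M.arr 2 (i * n + j) = v →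
      M.arr 2 = Function.update (M.arr 2) (i * n + j) v := by
    rintro v rfl
    simp
  refine Runs.time (Runs.ite (t := 42 * n + 30) (fun h => ?_) fun h => ?_) (by simp; omega)
  · refine Runs.time (Runs.skip (heq _ ?_)) (by omega)
    have h1 : cutDist G t i j < n := by
      simpa [hMi, hMj, hP.row i hi.le, hval, hP.n_eq] using h
    unfold cutDist at h1 hval ⊢
    split_ifs at h1 with h2
    · rw [hval, if_pos h2, if_pos (by omega)]
    · omega
  · have h1 : n ≤ cutDist G t i j := by
      simpa [hMi, hMj, hP.row i hi.le, hval, hP.n_eq] using h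
    have h2 : ¬ distFn G i j ≤ t := by
      intro h2
      have := hlt j hj
      rw [cutDist, if_pos h2] at h1
      omega
    refine Runs.time (Runs.seq (Runs.findExpr (n := n)
      (fun l => distFn G i l = t ∧ distFn G l j = 1) (by decide) ?_ ?_)
      (t₂ := 15) fun M' hM' hF => ?_) ?_
    · intro M' hF
      simp [hF.reg 0 rfl, hP.n_eq]
    · intro l hl M' hF hMl
      -- Entries already updated in this round have threshold t + 1 instead of t, which does not
      -- affect equality with t; the mark n differs from t because t < n.
      have h3 : M.arr 2 (i * n + l) = t ↔ distFn G i l = t := by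
        have := hlt l hl
        rw [hD l hl]
        unfold cutDist
        split_ifs <;> omega
      simp [hF.reg 2 rfl, hF.reg 3 rfl, hF.reg 4 rfl, hF.arr 0 rfl, hF.arr 1 rfl, hF.arr 2 rfl, hMl,
        hMi, hMj, hMt, hP.row i hi.le, hP.row l hl.le, hP.adj l hl.le j hj, h3]
    · have hex : lastIdx n (fun l => distFn G i l = t ∧ distFn G l j = 1) < n ↔
          distFn G i j = t + 1 := by
        rw [lastIdx_lt]
        constructor
        · rintro ⟨l, hl, h3, h4⟩
          have := hM.tri i hi l hl j hj
          omega
        · intro h3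
          obtain ⟨l, hl, h4⟩ := hM.step i hi j hj t h3
          exact ⟨l, hl, h4⟩
      refine Runs.time (Runs.ite (t := 9) (fun h => ?_) fun h => ?_) (by simp)
      · have h3 : distFn G i j = t + 1 := by
          simpa [hM', hF.reg 0 rfl, hP.n_eq, hex] using h
        refine Runs.time (Runs.put ?_) (by simp)
        simp [hF.reg 2 rfl, hF.reg 3 rfl, hF.reg 4 rfl, hF.arr 1 rfl, hF.arr 2 rfl, hMi, hMj, hMt,
          hP.row i hi.le, cutDist, h3]
      · have h3 : ¬ distFn G i j = t + 1 := by
          rw [← hex]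
          simpa [hM', hF.reg 0 rfl, hP.n_eq] using h
        refine Runs.time (Runs.skip ?_) (by omega)
        rw [hF.arr 2 rfl]
        refine heq _ ?_
        rw [hval, cutDist, cutDist, if_neg h2, if_neg (by omega)]
    · simp
      ring_nf
      omega

/-- The initial row, 0 on the diagonal and n elsewhere, is `cutDist` with threshold 0. As all
distances are below n, n rounds make the threshold irrelevant. -/
theorem runs_distRow {i : ℕ} (hG : G.Connected) (hP : Prepared G k M) (hi : i < n)
    (hMi : M.reg 2 = i) (hD : ∀ a < i, ∀ b < n, M.arr 2 (a * n + b) = distFn G a b) :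
    Runs distRow M (200 * n ^ 3) fun M' =>
      ∀ a < i + 1, ∀ b < n, M'.arr 2 (a * n + b) = distFn G a b := by
  have hlt : ∀ b < n, distFn G i b < n := fun b hb => distFn_lt hG hi hb
  have hM := graphMetric_distFn hG
  refine Runs.time (Runs.seq (Runs.forLoop (n := n) (tb := 6)
    (fun j M' => (∀ a < i, ∀ b < n, M'.arr 2 (a * n + b) = distFn G a b) ∧
      ∀ b < j, M'.arr 2 (i * n + b) = n) rfl ?_ ?_ ?_)
    (t₂ := 6 + 1 + (n * ((n * (42 * n + 40 + 9) + 7) + 9) + 7)) ?_) ?_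
  · intro M' hF
    simp [hF.reg 0 rfl, hP.n_eq]
  · simpa using hD
  · rintro j hj M' hF hMj ⟨h1, h2⟩
    refine Runs.time (Runs.put ?_) (by simp)
    simp only [Memory.setReg_arr, Memory.setArr_arr_self, Expr.eval_add, Expr.eval_get,
      Expr.eval_reg, hF.reg 2 rfl, hMi, hF.arr 1 rfl, hP.row i hi.le, hMj, hF.reg 0 rfl, hP.n_eq,
      Function.update_apply]
    refine ⟨fun a ha b hb => ?_, fun b hb => ?_⟩
    · rw [if_neg, h1 a ha b hb]
      rw [cell_inj hb hj]
      omega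
    · split_ifs with h
      · rfl
      · refine h2 b ?_
        rcases Nat.lt_succ_iff_lt_or_eq.1 hb with h' | rfl
        · exact h'
        · exact absurd rfl h
  · rintro M₁ ⟨⟨h1, h2⟩, -⟩ hF
    refine Runs.time (Runs.put_seq (t := n * ((n * (42 * n + 40 + 9) + 7) + 9) + 7) ?_)
      (by simp only [Expr.cost]; omega)
    simp only [Expr.eval_add, Expr.eval_get, Expr.eval_reg, Expr.eval_lit, hF.reg 2 rfl, hMi,
      hF.arr 1 rfl, hP.row i hi.le]
    set M₂ := M₁.setArr 2 (i * n + i) 0 with hM₂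
    have hP₂ : Prepared G k M₂ := hP.congr (hF.reg 0 rfl) (hF.reg 1 rfl)
      (by simp [hM₂, hF.arr 0 rfl]) (by simp [hM₂, hF.arr 1 rfl])
    refine Runs.mono (Runs.forLoop (n := n) (tb := n * (42 * n + 40 + 9) + 7)
      (fun t M' => (∀ a < i, ∀ b < n, M'.arr 2 (a * n + b) = distFn G a b) ∧
        ∀ b < n, M'.arr 2 (i * n + b) = cutDist G t i b) rfl ?_ ?_ ?_)
      (le_of_eq (by simp only [Expr.cost])) ?_
    · intro M' hF'
      simp [hF'.reg 0 rfl, hP₂.n_eq]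
    · simp only [hM₂, Memory.setReg_arr, Memory.setArr_arr_self, Function.update_apply]
      refine ⟨fun a ha b hb => ?_, fun b hb => ?_⟩
      · rw [if_neg, h1 a ha b hb]
        rw [cell_inj hb hi]
        omega
      · unfold cutDist
        rcases eq_or_ne b i with rfl | h
        · simp [hM.self b hb]
        · rw [if_neg (by omega), h2 b hb, if_neg]
          intro h'
          exact h (hM.eq i hi b hb (by omega)).symm
    · rintro t ht M₃ hF₃ hMt ⟨h3, h4⟩
      have hP₃ : Prepared G k M₃ := hP₂.congr (hF₃.reg 0 rfl) (hF₃.reg 1 rfl) (hF₃.arr 0 rfl)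
        (hF₃.arr 1 rfl)
      refine Runs.mono (Runs.forLoop (n := n) (tb := 42 * n + 40)
        (fun j M' => (∀ a < i, ∀ b < n, M'.arr 2 (a * n + b) = distFn G a b) ∧
          ∀ b < n, M'.arr 2 (i * n + b) =
            if b < j then cutDist G (t + 1) i b else cutDist G t i b) rfl ?_ ?_ ?_)
        (le_of_eq (by simp only [Expr.cost])) ?_
      · intro M' hF'
        simp [hF'.reg 0 rfl, hP₃.n_eq]
      · simpa using ⟨h3, h4⟩
      · rintro j hj M₄ hF₄ hMj ⟨h5, h6⟩
        have hMi4 : M₄.reg 2 = i := by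
          rw [hF₄.reg 2 rfl, hF₃.reg 2 rfl, hM₂, Memory.setArr_reg, hF.reg 2 rfl, hMi]
        refine Runs.post (runs_distCell hG (hP₃.congr (hF₄.reg 0 rfl) (hF₄.reg 1 rfl)
          (hF₄.arr 0 rfl) (hF₄.arr 1 rfl)) hi hj ht hMi4 hMj (by rw [hF₄.reg 4 rfl, hMt]) h6) ?_
        intro M₅ hM₅ hF₅
        simp only [Memory.setReg_arr, hM₅, Function.update_apply]
        refine ⟨fun a ha b hb => ?_, fun b hb => ?_⟩
        · rw [if_neg, h5 a ha b hb]
          rw [cell_inj hb hj]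
          omega
        · simp only [cell_inj hb hj, true_and]
          rcases lt_trichotomy b j with h | rfl | h
          · rw [if_neg (by omega), h6 b hb, if_pos h, if_pos (by omega)]
          · simp
          · rw [if_neg (by omega), h6 b hb, if_neg (by omega), if_neg (by omega)]
      · rintro M₅ ⟨⟨h5, h6⟩, -⟩
        refine ⟨h5, fun b hb => ?_⟩
        have h7 := h6 b hb
        rw [if_pos hb] at h7
        exact h7
    · rintro M' ⟨⟨h3, h4⟩, -⟩ a ha b hb
      rcases Nat.lt_succ_iff_lt_or_eq.1 ha with h | rfl
      · exact h3 a h b hb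
      · rw [h4 b hb, cutDist, if_pos (hlt b hb).le]
  -- Here n is positive because i < n; in terms of d = n - 1 the bound is a comparison of
  -- coefficients.
  · obtain ⟨d, rfl⟩ : ∃ d, n = d + 1 := ⟨n - 1, by omega⟩
    simp
    ring_nf
    nlinarith [Nat.zero_le d, Nat.zero_le (d ^ 2), Nat.zero_le (d ^ 3)]

/-- The distance matrix has been computed. -/
structure Ready (G : SimpleGraph (Fin n)) (k : ℕ) (M : Memory) : Prop where
  n_eq : M.reg 0 = n
  k_eq : M.reg 1 = k
  adj : ∀ a ≤ n, ∀ b < n, M.arr 0 (M.arr 1 a + b) = 0 ↔ ¬ distFn G a b = 1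
  dist : ∀ a < n, ∀ b < n, M.arr 2 (M.arr 1 a + b) = distFn G a b

theorem Ready.congr {M' : Memory} (h : Ready G k M) (h0 : M'.reg 0 = M.reg 0)
    (h1 : M'.reg 1 = M.reg 1) (h2 : M'.arr 0 = M.arr 0) (h3 : M'.arr 1 = M.arr 1)
    (h4 : M'.arr 2 = M.arr 2) : Ready G k M' :=
  ⟨h0.trans h.n_eq, h1.trans h.k_eq, by rw [h2, h3]; exact h.adj, by rw [h3, h4]; exact h.dist⟩

theorem runs_distProg (hG : G.Connected) (hP : Prepared G k M) :
    Runs distProg M (300 * n ^ 4) (Ready G k) := by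
  have hn : 0 < n := by
    have := hG.nonempty
    exact Fin.pos_iff_nonempty.2 this
  refine Runs.post (Runs.time (Runs.forLoop (n := n) (tb := 200 * n ^ 3)
    (fun i M' => ∀ a < i, ∀ b < n, M'.arr 2 (a * n + b) = distFn G a b) rfl ?_ ?_ ?_) ?_) ?_
  · intro M' hF
    simp [hF.reg 0 rfl, hP.n_eq]
  · simp
  · intro i hi M' hF hMi hI
    exact runs_distRow hG (hP.congr (hF.reg 0 rfl) (hF.reg 1 rfl) (hF.arr 0 rfl) (hF.arr 1 rfl)) hi
      hMi hI
  · obtain ⟨d, rfl⟩ : ∃ d, n = d + 1 := ⟨n - 1, by omega⟩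
    simp
    ring_nf
    nlinarith [Nat.zero_le d, Nat.zero_le (d ^ 2), Nat.zero_le (d ^ 3), Nat.zero_le (d ^ 4)]
  · rintro M' ⟨hI, -⟩ hF
    have hP' := hP.congr (hF.reg 0 rfl) (hF.reg 1 rfl) (hF.arr 0 rfl) (hF.arr 1 rfl)
    exact ⟨hP'.n_eq, hP'.k_eq, fun a ha b hb => by rw [hP'.row a ha, hP'.adj a ha b hb],
      fun a ha b hb => by rw [hP'.row a ha.le, hI a ha b hb]⟩

theorem runs_prepare (hG : G.Connected) :
    Runs (rowProg ;; distProg) (input G k) (400 * n ^ 4) (Ready G k) := by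
  have hn : 0 < n := Fin.pos_iff_nonempty.2 hG.nonempty
  refine Runs.time (Runs.seq (runs_rowProg (n := n) rfl rfl) fun M hrow hF =>
    runs_distProg (k := k) hG ⟨hF.reg 0 rfl, hF.reg 1 rfl, hrow, fun a ha b hb => ?_⟩) ?_
  · rw [hF.arr 0 rfl]
    simp only [input, true_and, ite_eq_right_iff, one_ne_zero, imp_false, not_iff_not]
    constructor
    · rintro ⟨i, j, h1, h2⟩
      obtain ⟨rfl, rfl⟩ := (cell_inj hb j.2).1 h1
      exact (distFn_eq_one i j).2 h2
    · intro h
      -- The dummy row a = n holds no edges, in accordance with `distFn` being 0 outside the vertex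
      -- set.
      have ha' : a < n := by
        by_contra h'
        simp [distFn, h'] at h
      exact ⟨⟨a, ha'⟩, ⟨b, hb⟩, rfl, (distFn_eq_one ⟨a, ha'⟩ ⟨b, hb⟩).1 h⟩
  · have : n ≤ n ^ 4 := Nat.le_self_pow (by omega) n
    omega

end MESP

/-! ### Branching on claws -/

namespace MESP

open RAM

variable {n : ℕ} {D : ℕ → ℕ → ℕ} {R R₀ X : Finset ℕ}

/-- A neighbour of `w` in `R`. -/
noncomputable def nbr₁ (n : ℕ) (D : ℕ → ℕ → ℕ) (R : Finset ℕ) (w : ℕ) : ℕ :=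
  lastIdx n fun y => y ∈ R ∧ D w y = 1

/-- A second neighbour of `w` in `R`. -/
noncomputable def nbr₂ (n : ℕ) (D : ℕ → ℕ → ℕ) (R : Finset ℕ) (w : ℕ) : ℕ :=
  lastIdx n fun y => y ∈ R ∧ D w y = 1 ∧ y ≠ nbr₁ n D R w

/-- A third neighbour of `w` in `R`. -/
noncomputable def nbr₃ (n : ℕ) (D : ℕ → ℕ → ℕ) (R : Finset ℕ) (w : ℕ) : ℕ :=
  lastIdx n fun y => y ∈ R ∧ D w y = 1 ∧ y ≠ nbr₁ n D R w ∧ y ≠ nbr₂ n D R w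

/-- A vertex of `R` with three neighbours in `R`, or `n` if there is none. -/
noncomputable def clawVertex (n : ℕ) (D : ℕ → ℕ → ℕ) (R : Finset ℕ) : ℕ :=
  lastIdx n fun w => w ∈ R ∧ nbr₃ n D R w < n

/-- The vertex with number `d` of the claw at `clawVertex n D R`. -/
noncomputable def pick (n : ℕ) (D : ℕ → ℕ → ℕ) (R : Finset ℕ) (d : ℕ) : ℕ :=
  if d = 0 then clawVertex n D R else if d = 1 then nbr₁ n D R (clawVertex n D R)
  else if d = 2 then nbr₂ n D R (clawVertex n D R) else nbr₃ n D R (clawVertex n D R)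

open Classical in
/-- Remove a vertex of a claw. -/
noncomputable def clawStep (n : ℕ) (D : ℕ → ℕ → ℕ) (R : Finset ℕ) (d : ℕ) : Finset ℕ :=
  if clawVertex n D R < n then R.erase (pick n D R d) else R

/-- The vertices that remain after `j` steps. -/
noncomputable def remaining (n : ℕ) (D : ℕ → ℕ → ℕ) (d : ℕ → ℕ) : ℕ → Finset ℕ
  | 0 => Finset.range n
  | j + 1 => clawStep n D (remaining n D d j) (d j)

theorem nbr₂_lt {w : ℕ} (h : nbr₂ n D R w < n) : nbr₁ n D R w ∈ R ∧ nbr₂ n D R w ∈ R ∧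
    D w (nbr₁ n D R w) = 1 ∧ D w (nbr₂ n D R w) = 1 ∧ nbr₁ n D R w ≠ nbr₂ n D R w := by
  obtain ⟨h1, h2, h3⟩ := lastIdx_spec h
  obtain ⟨h4, h5⟩ := lastIdx_spec (lastIdx_lt.2 ⟨_, h, h1, h2⟩ : nbr₁ n D R w < n)
  exact ⟨h4, h1, h5, h2, h3.symm⟩

theorem nbr₂_lt_iff (hR : R ⊆ Finset.range n) {w : ℕ} : nbr₂ n D R w < n ↔
    ∃ y ∈ R, ∃ z ∈ R, y ≠ z ∧ D w y = 1 ∧ D w z = 1 := by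
  constructor
  · intro h
    obtain ⟨h1, h2, h3, h4, h5⟩ := nbr₂_lt h
    exact ⟨_, h1, _, h2, h5, h3, h4⟩
  · rintro ⟨y, hy, z, hz, hne, h1, h2⟩
    by_cases h : y = nbr₁ n D R w
    · exact lastIdx_lt.2 ⟨z, Finset.mem_range.1 (hR hz), hz, h2, fun h' => hne (h.trans h'.symm)⟩
    · exact lastIdx_lt.2 ⟨y, Finset.mem_range.1 (hR hy), hy, h1, h⟩

theorem nbr₃_lt {w : ℕ} (h : nbr₃ n D R w < n) : nbr₂ n D R w < n ∧ nbr₃ n D R w ∈ R ∧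
    D w (nbr₃ n D R w) = 1 ∧ nbr₁ n D R w ≠ nbr₃ n D R w ∧ nbr₂ n D R w ≠ nbr₃ n D R w := by
  obtain ⟨h1, h2, h3, h4⟩ := lastIdx_spec h
  exact ⟨lastIdx_lt.2 ⟨_, h, h1, h2, h3⟩, h1, h2, h3.symm, h4.symm⟩

/-- Of three different neighbours of w, at least one is neither `nbr₁` nor `nbr₂`, so the search for
a third neighbour succeeds. -/
theorem no_claw (hR : R ⊆ Finset.range n) (h : ¬ clawVertex n D R < n) {w y₁ y₂ y₃ : ℕ}
    (hw : w ∈ R) (h₁ : y₁ ∈ R) (h₂ : y₂ ∈ R) (h₃ : y₃ ∈ R) (a₁ : D w y₁ = 1) (a₂ : D w y₂ = 1)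
    (a₃ : D w y₃ = 1) (n₁₂ : y₁ ≠ y₂) (n₁₃ : y₁ ≠ y₃) (n₂₃ : y₂ ≠ y₃) : False := by
  refine h (lastIdx_lt.2 ⟨w, Finset.mem_range.1 (hR hw), hw, lastIdx_lt.2 ?_⟩)
  by_cases b₁ : y₁ ≠ nbr₁ n D R w ∧ y₁ ≠ nbr₂ n D R w
  · exact ⟨y₁, Finset.mem_range.1 (hR h₁), h₁, a₁, b₁⟩
  by_cases b₂ : y₂ ≠ nbr₁ n D R w ∧ y₂ ≠ nbr₂ n D R w
  · exact ⟨y₂, Finset.mem_range.1 (hR h₂), h₂, a₂, b₂⟩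
  exact ⟨y₃, Finset.mem_range.1 (hR h₃), h₃, a₃, by omega, by omega⟩

theorem pick_mem (h : clawVertex n D R < n) (d : ℕ) : pick n D R d ∈ R := by
  obtain ⟨h1, h2⟩ := lastIdx_spec h
  obtain ⟨h3, h4, -⟩ := nbr₃_lt h2
  obtain ⟨h5, h6, -⟩ := nbr₂_lt h3
  unfold pick
  split_ifs
  exacts [h1, h5, h6, h4]

theorem clawStep_subset (d : ℕ) : clawStep n D R d ⊆ R := by
  unfold clawStep
  split_ifs
  exacts [Finset.erase_subset _ _, subset_rfl]

theorem remaining_subset (d : ℕ → ℕ) (j : ℕ) : remaining n D d j ⊆ Finset.range n := by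
  induction j with
  | zero => exact subset_rfl
  | succ j ih => exact (clawStep_subset _).trans ih

theorem remaining_congr {d d' : ℕ → ℕ} {j : ℕ} (h : ∀ i < j, d i = d' i) :
    remaining n D d j = remaining n D d' j := by
  induction j with
  | zero => rfl
  | succ j ih => rw [remaining, remaining, ih fun i hi => h i (by omega), h j (by omega)]

theorem exists_pick_mem (hX : Meets n D X) (hR : R ⊆ Finset.range n)
    (h : clawVertex n D R < n) : ∃ d < 4, pick n D R d ∈ X := by
  have hp := fun d => Finset.mem_range.1 (hR (pick_mem h d))
  obtain ⟨h1, h2⟩ := lastIdx_spec h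
  obtain ⟨h3, h4, h5, h6, h7⟩ := nbr₃_lt h2
  obtain ⟨h8, h9, h10, h11, h12⟩ := nbr₂_lt h3
  have hc := hX.claw _ (hp 0) _ (hp 1) _ (hp 2) _ (hp 3) h10 h11 h5 h12 h6 h7
  rcases hc with hc | hc | hc | hc
  exacts [⟨0, by omega, hc⟩, ⟨1, by omega, hc⟩, ⟨2, by omega, hc⟩, ⟨3, by omega, hc⟩]

/-- Some string of choices removes only vertices of `X` and destroys all claws. -/
theorem exists_digits (hX : Meets n D X) (hXn : X ⊆ Finset.range n) :
    ∃ d : ℕ → ℕ, (∀ j, d j < 4) ∧ Finset.range n \ X ⊆ remaining n D d X.card ∧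
      ¬ clawVertex n D (remaining n D d X.card) < n := by
  classical
  -- The choice depends only on the remaining set, so the whole run is an iteration of one map and
  -- the digits can be read off afterwards.
  have hδ : ∀ R : Finset ℕ, ∃ d < 4, R ⊆ Finset.range n → clawVertex n D R < n →
      pick n D R d ∈ X := by
    intro R
    by_cases h : R ⊆ Finset.range n ∧ clawVertex n D R < n
    · obtain ⟨d, hd, h'⟩ := exists_pick_mem hX h.1 h.2
      exact ⟨d, hd, fun _ _ => h'⟩
    · exact ⟨0, by omega, fun h1 h2 => absurd ⟨h1, h2⟩ h⟩
  choose δ hδ4 hδ using hδ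
  let S : ℕ → Finset ℕ := fun j => (fun R => clawStep n D R (δ R))^[j] (Finset.range n)
  have hS : ∀ j, remaining n D (fun i => δ (S i)) j = S j := by
    intro j
    induction j with
    | zero => rfl
    | succ j ih =>
      rw [remaining, ih]
      simp only [S, Function.iterate_succ_apply']
  have hSn : ∀ j, S j ⊆ Finset.range n := fun j => hS j ▸ remaining_subset _ j
  have hstep : ∀ j, S (j + 1) = clawStep n D (S j) (δ (S j)) := fun j => by
    simp only [S, Function.iterate_succ_apply']
  -- Only vertices of X are removed, and while claws persist every step has removed exactly one
  -- vertex.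
  have key : ∀ j, Finset.range n \ X ⊆ S j ∧
      (clawVertex n D (S j) < n → (S j).card + j = n) := by
    intro j
    induction j with
    | zero => exact ⟨Finset.sdiff_subset, fun _ => by simp [S]⟩
    | succ j ih =>
      rw [hstep]
      unfold clawStep
      split_ifs with h
      · refine ⟨fun a ha => Finset.mem_erase.2 ⟨?_, ih.1 ha⟩, fun _ => ?_⟩
        · rintro rfl
          exact (Finset.mem_sdiff.1 ha).2 (hδ _ (hSn j) h)
        · have := ih.2 h
          have h1 := Finset.card_erase_add_one (pick_mem h (δ (S j)))
          omega
      · exact ⟨ih.1, fun h' => absurd h' h⟩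
  refine ⟨fun i => δ (S i), fun j => hδ4 _, ?_, ?_⟩
  · rw [hS]
    exact (key _).1
  · rw [hS]
    intro h
    have h1 := (key X.card).2 h
    have h2 := Finset.card_sdiff_add_card_eq_card hXn
    rw [Finset.card_range] at h2
    -- If a claw survived |X| removals, all of X would be gone, but the claw still has to meet X.
    have h3 : Finset.range n \ X = S X.card :=
      Finset.eq_of_subset_of_card_le (key X.card).1 (by omega)
    obtain ⟨d, -, hd⟩ := exists_pick_mem hX (hSn _) h
    have h4 : ∀ a ∈ S X.card, a ∉ X := fun a ha => by
      rw [← h3] at ha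
      exact (Finset.mem_sdiff.1 ha).2
    exact h4 _ (pick_mem h d) hd

/-! ### Greedy layout of graphs of maximum degree two -/

/-- The set contains two neighbours of each of its members. -/
def IsCore (D : ℕ → ℕ → ℕ) (R : Finset ℕ) : Prop :=
  ∀ w ∈ R, ∃ y ∈ R, ∃ z ∈ R, y ≠ z ∧ D w y = 1 ∧ D w z = 1

/-- Invariant of the greedy layout of `R₀`: the vertices in `R` are still to be treated, those in
`ord` are in the layout, and those in `C` are removed. -/
structure Partial (n : ℕ) (D : ℕ → ℕ → ℕ) (R₀ R : Finset ℕ) (C : ℕ → ℕ) (c : ℕ) (ord : ℕ → ℕ)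
    (len cur : ℕ) : Prop where
  sub : R ⊆ R₀
  cover : ∀ a < n, a ∉ R → (∃ j < c, C j = a) ∨ ∃ i < len, ord i = a
  C_lt : ∀ j < c, C j < n
  ord_mem : ∀ i < len, ord i ∈ R₀ ∧ ord i ∉ R
  lay : Layout n D ord len
  last : ∀ i < len, ∀ y ∈ R, D (ord i) y = 1 → i + 1 = len
  uniq : ∀ i < len, ∀ y ∈ R, ∀ z ∈ R, D (ord i) y = 1 → D (ord i) z = 1 → y = z
  cur_eq : len = 0 ∧ cur = n ∨ 0 < len ∧ cur = ord (len - 1)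
  bound : ∀ X, Meets n D X → Finset.range n \ X ⊆ R₀ → c ≤ (X \ R).card ∨
    ∃ R₁, R ⊂ R₁ ∧ R₁ ⊆ R₀ ∧ IsCore D R₁ ∧ c ≤ (X \ R₁).card + 1

namespace Partial

variable {C ord : ℕ → ℕ} {c len cur : ℕ}

/-- The c removed vertices are those outside R₀, and they belong to X since everything outside X is
still in R₀. -/
theorem init (hR : R₀ ⊆ Finset.range n)
    (hcov : ∀ a < n, a ∉ R₀ → ∃ j < c, C j = a) (hC : ∀ j < c, C j < n)
    (hc : c + R₀.card = n) : Partial n D R₀ R₀ C c ord 0 n := by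
  refine ⟨subset_rfl, fun a ha h => .inl (hcov a ha h), hC, by simp, ⟨by simp, by simp, by simp⟩,
    by simp, by simp, .inl ⟨rfl, rfl⟩, fun X _ hX => .inl ?_⟩
  have h1 := Finset.card_sdiff_add_card_eq_card hR
  rw [Finset.card_range] at h1
  have h2 : Finset.range n \ R₀ ⊆ X \ R₀ := by
    intro a ha
    rw [Finset.mem_sdiff] at ha ⊢
    refine ⟨?_, ha.2⟩
    by_contra h
    exact ha.2 (hX (Finset.mem_sdiff.2 ⟨ha.1, h⟩))
  have h3 := Finset.card_le_card h2
  omega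

theorem bound_erase (h : Partial n D R₀ R C c ord len cur) (a : ℕ) {X : Finset ℕ}
    (hX : Meets n D X) (hX' : Finset.range n \ X ⊆ R₀) : c ≤ (X \ R.erase a).card ∨
      ∃ R₁, R.erase a ⊂ R₁ ∧ R₁ ⊆ R₀ ∧ IsCore D R₁ ∧ c ≤ (X \ R₁).card + 1 := by
  rcases h.bound X hX hX' with h1 | ⟨R₁, h1, h2⟩
  · exact .inl (h1.trans (Finset.card_le_card
      (Finset.sdiff_subset_sdiff subset_rfl (Finset.erase_subset _ _))))
  · exact .inr ⟨R₁, lt_of_le_of_lt (Finset.erase_subset _ _) h1, h2⟩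

/-- In both cases a earlier layout vertex has no neighbour in R other than a, which is erased. The
new last vertex a has at most one neighbour left: if it continues from `cur`, two more would form a
claw with `cur`; if it starts anew, this is how it was chosen. -/
theorem append (h : Partial n D R₀ R C c ord len cur) (hM : GraphMetric n D)
    (hR : R₀ ⊆ Finset.range n) (hclaw : ¬ clawVertex n D R₀ < n) {a : ℕ} (ha : a ∈ R)
    (hcase : D cur a = 1 ∧ cur < n ∨ (∀ y ∈ R, ¬ D cur y = 1) ∧
      ∀ y ∈ R, ∀ z ∈ R, D a y = 1 → D a z = 1 → y = z) :
    Partial n D R₀ (R.erase a) C c (Function.update ord len a) (len + 1) a := by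
  have hlt : ∀ {i}, i < len → Function.update ord len a i = ord i := fun {i} hi => by
    rw [Function.update_of_ne (by omega)]
  have han : a < n := Finset.mem_range.1 (hR (h.sub ha))
  have hnone : ∀ i < len, ∀ y ∈ R, D (ord i) y = 1 → y = a := by
    intro i hi y hy hd
    have h1 := h.last i hi y hy hd
    have hcur : cur = ord i := by
      rcases h.cur_eq with h2 | h2
      · omega
      · rw [h2.2]
        congr 1
        omega
    rcases hcase with h2 | h2
    · rw [hcur] at h2
      exact h.uniq i hi y hy a ha hd h2.1
    · exact absurd (hcur ▸ hd) (h2.1 y hy)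
  refine ⟨(Finset.erase_subset _ _).trans h.sub, fun b hb hbR => ?_, h.C_lt, fun i hi => ?_,
    ⟨fun i hi => ?_, fun i hi j hj hij => ?_, fun i j hij hj hd => ?_⟩, fun i hi y hy hd => ?_,
    fun i hi y hy z hz hd hd' => ?_, .inr ⟨by omega, by simp⟩, fun X hX hX' => h.bound_erase a hX hX'⟩
  · rcases eq_or_ne b a with rfl | hne
    · exact .inr ⟨len, by omega, by simp⟩
    · rcases h.cover b hb fun h' => hbR (Finset.mem_erase.2 ⟨hne, h'⟩) with h1 | ⟨i, hi, h1⟩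
      · exact .inl h1
      · exact .inr ⟨i, by omega, by rw [hlt hi, h1]⟩
  · rcases Nat.lt_succ_iff_lt_or_eq.1 hi with h1 | rfl
    · rw [hlt h1]
      exact ⟨(h.ord_mem i h1).1, fun h' => (h.ord_mem i h1).2 (Finset.mem_of_mem_erase h')⟩
    · simpa using h.sub ha
  · rcases Nat.lt_succ_iff_lt_or_eq.1 hi with h1 | rfl
    · rw [hlt h1]
      exact h.lay.lt i h1
    · simpa using han
  · rcases Nat.lt_succ_iff_lt_or_eq.1 hi with h1 | rfl <;>
    rcases Nat.lt_succ_iff_lt_or_eq.1 hj with h2 | rfl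
    · rw [hlt h1, hlt h2] at hij
      exact h.lay.inj i h1 j h2 hij
    · rw [hlt h1, Function.update_self] at hij
      exact absurd ha (hij ▸ (h.ord_mem i h1).2)
    · rw [hlt h2, Function.update_self] at hij
      exact absurd ha (hij ▸ (h.ord_mem j h2).2)
    · rfl
  · rcases Nat.lt_succ_iff_lt_or_eq.1 hj with h2 | rfl
    · rw [hlt h2, hlt (by omega)] at hd
      exact h.lay.adj i j hij h2 hd
    · rw [hlt hij, Function.update_self] at hd
      exact (h.last i hij a ha hd).symm
  · rcases Nat.lt_succ_iff_lt_or_eq.1 hi with h1 | rfl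
    · rw [hlt h1] at hd
      exact absurd (hnone i h1 y (Finset.mem_of_mem_erase hy) hd) (Finset.ne_of_mem_erase hy)
    · rfl
  · rcases Nat.lt_succ_iff_lt_or_eq.1 hi with h1 | rfl
    · rw [hlt h1] at hd
      exact absurd (hnone i h1 y (Finset.mem_of_mem_erase hy) hd) (Finset.ne_of_mem_erase hy)
    · rw [Function.update_self] at hd hd'
      have hy' := Finset.mem_of_mem_erase hy
      have hz' := Finset.mem_of_mem_erase hz
      rcases hcase with ⟨h2, h2n⟩ | h2
      · by_contra hne
        have hcur : cur ∈ R₀ ∧ cur ∉ R := by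
          rcases h.cur_eq with h3 | h3
          · omega
          · rw [h3.2]
            exact h.ord_mem _ (by omega)
        refine no_claw hR hclaw (h.sub ha) hcur.1 (h.sub hy') (h.sub hz')
          (by rw [hM.symm _ han _ h2n, h2]) hd hd' ?_ ?_ hne
        · rintro rfl
          exact hcur.2 hy'
        · rintro rfl
          exact hcur.2 hz'
      · exact h2.2 y hy' z hz' hd hd'

/-- The alternative in `bound` allows for one removal not yet paid for, made when the remaining set
was the core R₁. When the next removal occurs, R ⊂ R₁ is a core as well, and the part R₁ \ R
supplies a vertex of X that pays for the earlier one. -/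
theorem remove (h : Partial n D R₀ R C c ord len cur) (hM : GraphMetric n D)
    (hR : R₀ ⊆ Finset.range n) (hclaw : ¬ clawVertex n D R₀ < n) {a : ℕ} (ha : a ∈ R)
    (hcore : IsCore D R) :
    Partial n D R₀ (R.erase a) (Function.update C c a) (c + 1) ord len cur := by
  have hlt : ∀ {i}, i < c → Function.update C c a i = C i := fun {i} hi => by
    rw [Function.update_of_ne (by omega)]
  have han : a < n := Finset.mem_range.1 (hR (h.sub ha))
  have her := Finset.erase_subset a R
  refine ⟨her.trans h.sub, fun b hb hbR => ?_, fun j hj => ?_,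
    fun i hi => ⟨(h.ord_mem i hi).1, fun h' => (h.ord_mem i hi).2 (her h')⟩, h.lay,
    fun i hi y hy => h.last i hi y (her hy),
    fun i hi y hy z hz => h.uniq i hi y (her hy) z (her hz), h.cur_eq, fun X hX hX' => .inr ?_⟩
  · rcases eq_or_ne b a with rfl | hne
    · exact .inl ⟨c, by omega, by simp⟩
    · rcases h.cover b hb fun h' => hbR (Finset.mem_erase.2 ⟨hne, h'⟩) with ⟨j, hj, h1⟩ | h1
      · exact .inl ⟨j, by omega, by rw [hlt hj, h1]⟩
      · exact .inr h1
  · rcases Nat.lt_succ_iff_lt_or_eq.1 hj with h1 | rfl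
    · rw [hlt h1]
      exact h.C_lt j h1
    · simpa using han
  · refine ⟨R, Finset.erase_ssubset ha, h.sub, hcore, ?_⟩
    rcases h.bound X hX hX' with h1 | ⟨R₁, h1, h2, h3, h4⟩
    · omega
    -- There are no edges between R and R₁ \ R: a vertex of R already has two neighbours in R, and a
    -- third in R₁ would give a claw in R₀. So R₁ \ R inherits minimum degree two and meets X.
    · have hsub : ∀ w ∈ R₁ \ R, w < n ∧ ∃ y ∈ R₁ \ R, ∃ z ∈ R₁ \ R, y ≠ z ∧ D w y = 1 ∧
          D w z = 1 := by
        intro w hw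
        rw [Finset.mem_sdiff] at hw
        have hwn := Finset.mem_range.1 (hR (h2 hw.1))
        have hout : ∀ y ∈ R₁, D w y = 1 → y ∈ R₁ \ R := by
          intro y hy hd
          refine Finset.mem_sdiff.2 ⟨hy, fun hyR => ?_⟩
          obtain ⟨y₁, hy₁, y₂, hy₂, hne, h5, h6⟩ := hcore y hyR
          refine no_claw hR hclaw (h2 hy) (h2 hw.1) (h.sub hy₁) (h.sub hy₂)
            (by rw [hM.symm _ (Finset.mem_range.1 (hR (h2 hy))) _ hwn, hd]) h5 h6 ?_ ?_ hne
          · rintro rfl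
            exact hw.2 hy₁
          · rintro rfl
            exact hw.2 hy₂
        obtain ⟨y, hy, z, hz, hne, h5, h6⟩ := h3 w hw.1
        exact ⟨hwn, y, hout y hy h5, z, hout z hz h6, hne, h5, h6⟩
      obtain ⟨w, hw, hwX⟩ := hX.core _ (Finset.sdiff_nonempty.2 (not_subset_of_ssubset h1)) hsub
      rw [Finset.mem_sdiff] at hw
      have h5 : (X \ R₁) ⊂ (X \ R) := by
        refine (Finset.ssubset_iff_of_subset (Finset.sdiff_subset_sdiff subset_rfl h1.subset)).2
          ⟨w, Finset.mem_sdiff.2 ⟨hwX, hw.2⟩, fun h' => (Finset.mem_sdiff.1 h').2 hw.1⟩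
      have := Finset.card_lt_card h5
      omega

/-- A last removal that is still unpaid is paid for by a vertex of X in the core R₁ itself. -/
theorem le_card (h : Partial n D R₀ ∅ C c ord len cur) (hR : R₀ ⊆ Finset.range n)
    (hX : Meets n D X) (hX' : Finset.range n \ X ⊆ R₀) : c ≤ X.card := by
  rcases h.bound X hX hX' with h1 | ⟨R₁, h1, h2, h3, h4⟩
  · simpa using h1
  · obtain ⟨w, hw, hwX⟩ := hX.core R₁ (Finset.empty_ssubset.1 h1)
      fun w hw => ⟨Finset.mem_range.1 (hR (h2 hw)), h3 w hw⟩
    have h5 : (X \ R₁) ⊂ X := by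
      refine (Finset.ssubset_iff_of_subset Finset.sdiff_subset).2
        ⟨w, hwX, fun h' => (Finset.mem_sdiff.1 h').2 hw⟩
    have := Finset.card_lt_card h5
    omega

end Partial

end MESP

/-! ### Searching a layout

Array `3` marks the treated vertices, array `4` lists the removed vertices, array `5` is the layout,
array `6` holds the string of choices, array `8` the vertices of a claw. Register `7` is the number
of removed vertices, register `8` the length of the layout, register `9` its last vertex, register
`10` tells whether a layout has been found, and register `11` is the length of the string. -/

namespace MESP

open RAM

variable {n k : ℕ} {G : SimpleGraph (Fin n)} {M : Memory}

/-- The vertices that are not marked. -/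
def free (n : ℕ) (M : Memory) : Finset ℕ := (Finset.range n).filter fun w => M.arr 3 w = 0

theorem mem_free {w : ℕ} : w ∈ free n M ↔ w < n ∧ M.arr 3 w = 0 := by
  simp [free]

theorem free_subset : free n M ⊆ Finset.range n := Finset.filter_subset _ _

theorem free_congr {M' : Memory} (h : M'.arr 3 = M.arr 3) : free n M' = free n M := by
  simp [free, h]

theorem free_mark {M' : Memory} {a : ℕ} (h : M'.arr 3 = Function.update (M.arr 3) a 1) :
    free n M' = (free n M).erase a := by
  ext w
  rw [Finset.mem_erase, mem_free, mem_free, h, Function.update_apply]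
  split_ifs with h1
  · simp [h1]
  · simp [h1]

/-- Three neighbours of the vertex in register `12`. -/
def nbrProg : Prog :=
  .find 13 14 (.reg 0) .skip
      (.and (.not (.get 3 (.reg 13))) (adjE (.reg 12) (.reg 13))) ;;
    .find 13 15 (.reg 0) .skip
      (.and (.not (.get 3 (.reg 13))) (.and (adjE (.reg 12) (.reg 13))
        (.not (.eq (.reg 13) (.reg 14))))) ;;
    .find 13 16 (.reg 0) .skip
      (.and (.not (.get 3 (.reg 13))) (.and (adjE (.reg 12) (.reg 13))
        (.and (.not (.eq (.reg 13) (.reg 14))) (.not (.eq (.reg 13) (.reg 15))))))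

theorem runs_nbrProg {w : ℕ} (hM : Ready G k M) (hw : M.reg 12 = w) (hwn : w < n) :
    Runs nbrProg M (160 * n + 30) fun M' => M'.reg 14 = nbr₁ n (distFn G) (free n M) w ∧
      M'.reg 15 = nbr₂ n (distFn G) (free n M) w ∧
      M'.reg 16 = nbr₃ n (distFn G) (free n M) w := by
  refine Runs.time (Runs.seq (Runs.findExpr (n := n)
    (fun y => y ∈ free n M ∧ distFn G w y = 1) (by decide) ?_ ?_)
    (t₂ := n * 112 + 18) fun M₁ h1 hF₁ => ?_) ?_
  · intro M' hF
    simp [hF.reg 0 rfl, hM.n_eq]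
  · intro y hy M' hF hMy
    simp [hF.reg 12 rfl, hF.arr 0 rfl, hF.arr 1 rfl, hF.arr 3 rfl, hMy, hw, hM.adj w hwn.le y hy,
      mem_free, hy]
  · refine Runs.time (Runs.seq (Runs.findExpr (n := n) (fun y => y ∈ free n M ∧
      distFn G w y = 1 ∧ y ≠ nbr₁ n (distFn G) (free n M) w) (by decide) ?_ ?_)
      (t₂ := n * 65 + 9) fun M₂ h2 hF₂ => ?_) ?_
    · intro M' hF
      simp [hF.reg 0 rfl, hF₁.reg 0 rfl, hM.n_eq]
    · intro y hy M' hF hMy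
      simp [hF.reg 12 rfl, hF.arr 0 rfl, hF.arr 1 rfl, hF.arr 3 rfl, hF.reg 14 rfl, h1,
        hF₁.reg 12 rfl, hF₁.arr 0 rfl, hF₁.arr 1 rfl, hF₁.arr 3 rfl, hMy, hw,
        hM.adj w hwn.le y hy, mem_free, hy, nbr₁]
    · refine Runs.post (Runs.time (Runs.findExpr (n := n) (fun y => y ∈ free n M ∧
        distFn G w y = 1 ∧ y ≠ nbr₁ n (distFn G) (free n M) w ∧
        y ≠ nbr₂ n (distFn G) (free n M) w) (by decide) ?_ ?_) ?_) ?_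
      · intro M' hF
        simp [hF.reg 0 rfl, hF₂.reg 0 rfl, hF₁.reg 0 rfl, hM.n_eq]
      · intro y hy M' hF hMy
        simp [hF.reg 12 rfl, hF.arr 0 rfl, hF.arr 1 rfl, hF.arr 3 rfl, hF.reg 14 rfl,
          hF.reg 15 rfl, hF₂.reg 12 rfl, hF₂.arr 0 rfl, hF₂.arr 1 rfl, hF₂.arr 3 rfl,
          hF₂.reg 14 rfl, h1, h2,
          hF₁.reg 12 rfl, hF₁.arr 0 rfl, hF₁.arr 1 rfl, hF₁.arr 3 rfl, hMy, hw,
          hM.adj w hwn.le y hy, mem_free, hy, nbr₁, nbr₂]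
      · simp
      · intro M₃ h3 hF₃
        exact ⟨by rw [hF₃.reg 14 rfl, hF₂.reg 14 rfl, h1, nbr₁], by rw [hF₃.reg 15 rfl, h2, nbr₂],
          by rw [h3, nbr₃]⟩
    · simp
      omega
  · simp
    omega

/-- Set register `17` to the center of a claw. -/
def clawProg : Prog :=
  .find 12 17 (.reg 0) nbrProg (.and (.not (.get 3 (.reg 12))) (.lt (.reg 16) (.reg 0)))

theorem runs_clawProg (hM : Ready G k M) :
    Runs clawProg M (160 * n ^ 2 + 100 * n + 10) fun M' =>
      M'.reg 17 = clawVertex n (distFn G) (free n M) := by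
  refine Runs.time (Runs.find (n := n) (tb := 160 * n + 30)
    (fun w => w ∈ free n M ∧ nbr₃ n (distFn G) (free n M) w < n) (by decide) rfl rfl ?_ ?_) ?_
  · intro M' hF
    simp [hF.reg 0 rfl, hM.n_eq]
  · intro w hw M' hF hMw
    have hM' : Ready G k M' := hM.congr (hF.reg 0 rfl) (hF.reg 1 rfl) (hF.arr 0 rfl)
      (hF.arr 1 rfl) (hF.arr 2 rfl)
    refine Runs.post (runs_nbrProg hM' hMw hw) ?_
    rintro M'' ⟨-, -, h⟩ hF'
    have h' := free_congr (n := n) (hF.arr 3 rfl)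
    rw [h'] at h
    simp [h, hF'.reg 12 rfl, hMw, hF'.arr 3 rfl, hF.arr 3 rfl, hF'.reg 0 rfl, hF.reg 0 rfl,
      hM.n_eq, mem_free, hw]
  · simp
    ring_nf
    omega

/-- All marked vertices have been removed. -/
structure Removed (n : ℕ) (M : Memory) : Prop where
  cover : ∀ a < n, a ∉ free n M → ∃ i < M.reg 7, M.arr 4 i = a
  lt : ∀ i < M.reg 7, M.arr 4 i < n
  card : M.reg 7 + (free n M).card = n

theorem Removed.congr {M' : Memory} (h : Removed n M) (h7 : M'.reg 7 = M.reg 7)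
    (h3 : M'.arr 3 = M.arr 3) (h4 : M'.arr 4 = M.arr 4) : Removed n M' := by
  have h5 := free_congr (n := n) h3
  exact ⟨by rw [h7, h4, h5]; exact h.cover, by rw [h7, h4]; exact h.lt, by rw [h7, h5]; exact h.card⟩

theorem Removed.step {M' : Memory} {a : ℕ} (h : Removed n M) (ha : a ∈ free n M)
    (h7 : M'.reg 7 = M.reg 7 + 1) (h3 : M'.arr 3 = Function.update (M.arr 3) a 1)
    (h4 : M'.arr 4 = Function.update (M.arr 4) (M.reg 7) a) : Removed n M' := by
  have h5 := free_mark (n := n) h3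
  refine ⟨fun b hb hbf => ?_, fun i hi => ?_, ?_⟩
  · rw [h7, h4]
    rcases eq_or_ne b a with rfl | hne
    · exact ⟨M.reg 7, by omega, by simp⟩
    · obtain ⟨i, hi, h6⟩ := h.cover b hb fun h' => hbf (h5 ▸ Finset.mem_erase.2 ⟨hne, h'⟩)
      exact ⟨i, by omega, by rw [Function.update_of_ne (by omega), h6]⟩
  · rw [h7] at hi
    rw [h4, Function.update_apply]
    split_ifs with h6
    · exact (mem_free.1 ha).1
    · exact h.lt i (by omega)
  · have h6 := Finset.card_erase_add_one ha
    have h8 := h.card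
    rw [h7, h5]
    omega

/-- Remove a vertex of a claw; the choice is the digit whose index is in register `18`. -/
def pickProg : Prog :=
  clawProg ;;
    .ite (.lt (.reg 17) (.reg 0))
      (.assign 12 (.reg 17) ;; nbrProg ;;
        .put 8 (.lit 0) (.reg 17) ;; .put 8 (.lit 1) (.reg 14) ;; .put 8 (.lit 2) (.reg 15) ;;
        .put 8 (.lit 3) (.reg 16) ;; .assign 20 (.get 8 (.get 6 (.reg 18))) ;;
        .put 3 (.reg 20) (.lit 1) ;; .put 4 (.reg 7) (.reg 20) ;;
        .assign 7 (.add (.reg 7) (.lit 1))) .skip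

theorem runs_pickProg {d : ℕ} (hM : Ready G k M) (hR : Removed n M) (hd : M.arr 6 (M.reg 18) = d)
    (hd4 : d < 4) :
    Runs pickProg M (160 * n ^ 2 + 300 * n + 100) fun M' =>
      free n M' = clawStep n (distFn G) (free n M) d ∧ Removed n M' := by
  refine Runs.time (Runs.seq (runs_clawProg hM) (t₂ := 160 * n + 80) fun M₁ h1 hF₁ => ?_)
    (by omega)
  have hM₁ : Ready G k M₁ := hM.congr (hF₁.reg 0 rfl) (hF₁.reg 1 rfl) (hF₁.arr 0 rfl)
    (hF₁.arr 1 rfl) (hF₁.arr 2 rfl)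
  have hf₁ := free_congr (n := n) (hF₁.arr 3 rfl)
  have hR₁ : Removed n M₁ := hR.congr (hF₁.reg 7 rfl) (hF₁.arr 3 rfl) (hF₁.arr 4 rfl)
  refine Runs.time (Runs.ite (t := 160 * n + 70) (fun h => ?_) fun h => ?_) (by simp; omega)
  · have hc : clawVertex n (distFn G) (free n M) < n := by
      simpa [h1, hM₁.n_eq] using h
    refine Runs.time (Runs.assign_seq (Runs.seq (runs_nbrProg (k := k) (G := G)
      (w := clawVertex n (distFn G) (free n M))
      (hM₁.congr (by simp) (by simp) rfl rfl rfl) (by simp [h1]) hc) (t₂ := 36) ?_)) ?_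
    · rintro M₂ ⟨h14, h15, h16⟩ hF₂
      have hf₂ := free_congr (n := n) (hF₂.arr 3 rfl)
      rw [show free n (M₁.setReg 12 ((Expr.reg 17).eval M₁)) = free n M from hf₁] at h14 h15 h16
      have hp : (if d = 0 then M₂.reg 17 else if d = 1 then M₂.reg 14 else if d = 2 then
          M₂.reg 15 else M₂.reg 16) = pick n (distFn G) (free n M) d := by
        have h17 : M₂.reg 17 = M₁.reg 17 := hF₂.reg 17 rfl
        rw [h14, h15, h16, h17, h1, pick]
      refine Runs.time (Runs.put_seq (Runs.put_seq (Runs.put_seq (Runs.put_seq (Runs.assign_seq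
        (Runs.put_seq (Runs.put_seq (Runs.assign ?_)))))))) (by simp)
      -- Array `8` serves as a lookup table, so that the digit selects among the four claw vertices
      -- without branching.
      have hval : (Function.update (Function.update (Function.update (Function.update (M₂.arr 8) 0
          (M₂.reg 17)) 1 (M₂.reg 14)) 2 (M₂.reg 15)) 3 (M₂.reg 16)) d =
          pick n (distFn G) (free n M) d := by
        rw [← hp]
        interval_cases d <;> simp
      have hd' : M₂.arr 6 (M₂.reg 18) = d := by
        rw [hF₂.arr 6 rfl, hF₂.reg 18 rfl, Memory.setReg_arr, Memory.setReg_reg,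
          if_neg (by decide), hF₁.arr 6 rfl, hF₁.reg 18 rfl, hd]
      have hmem := pick_mem hc d
      have h7 : M₂.reg 7 = M.reg 7 := (hF₂.reg 7 rfl).trans (hF₁.reg 7 rfl)
      have h3 : M₂.arr 3 = M.arr 3 := (hF₂.arr 3 rfl).trans (hF₁.arr 3 rfl)
      have h4 : M₂.arr 4 = M.arr 4 := (hF₂.arr 4 rfl).trans (hF₁.arr 4 rfl)
      refine ⟨?_, hR.step hmem ?_ ?_ ?_⟩
      · rw [clawStep, if_pos hc]
        exact free_mark (by simp [hd', hval, h3])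
      all_goals simp [hd', hval, h7, h3, h4]
    · simp
      omega
  · have hc : ¬ clawVertex n (distFn G) (free n M) < n := by
      simpa [h1, hM₁.n_eq] using h
    refine Runs.time (Runs.skip ⟨?_, hR₁⟩) (by omega)
    rw [hf₁, clawStep, if_neg hc]

end MESP

/-! ### Computing the layout -/

namespace MESP

open RAM

variable {n k : ℕ} {G : SimpleGraph (Fin n)} {M : Memory}

/-- Set register `20` to a vertex by which the layout can be continued. -/
def nextProg : Prog :=
  .find 13 20 (.reg 0) .skip (.and (.not (.get 3 (.reg 13))) (adjE (.reg 9) (.reg 13))) ;;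
    .ite (.lt (.reg 20) (.reg 0)) .skip
      (.find 12 20 (.reg 0) nbrProg
        (.and (.not (.get 3 (.reg 12))) (.not (.lt (.reg 15) (.reg 0)))))

/-- The search for a neighbour of the last layout vertex comes first; if there is none, a vertex
with at most one free neighbour starts a new run. If both searches fail, every free vertex has two
free neighbours, and only then a removal is permitted. -/
theorem runs_nextProg (hM : Ready G k M) (hcur : M.reg 9 ≤ n) :
    Runs nextProg M (160 * n ^ 2 + 200 * n + 100) fun M' =>
      (M'.reg 20 < n → M'.reg 20 ∈ free n M ∧
        (distFn G (M.reg 9) (M'.reg 20) = 1 ∧ M.reg 9 < n ∨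
          (∀ y ∈ free n M, ¬ distFn G (M.reg 9) y = 1) ∧ ∀ y ∈ free n M, ∀ z ∈ free n M,
            distFn G (M'.reg 20) y = 1 → distFn G (M'.reg 20) z = 1 → y = z)) ∧
      (¬ M'.reg 20 < n → IsCore (distFn G) (free n M)) := by
  refine Runs.time (Runs.seq (Runs.findExpr (n := n)
    (fun y => y ∈ free n M ∧ distFn G (M.reg 9) y = 1) (by decide) ?_ ?_)
    (t₂ := 160 * n ^ 2 + 100 * n + 50) fun M₁ h1 hF₁ => ?_) ?_
  · intro M' hF
    simp [hF.reg 0 rfl, hM.n_eq]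
  · intro y hy M' hF hMy
    simp [hF.reg 9 rfl, hF.arr 0 rfl, hF.arr 1 rfl, hF.arr 3 rfl, hMy, hM.adj _ hcur y hy,
      mem_free, hy]
  · have hM₁ : Ready G k M₁ := hM.congr (hF₁.reg 0 rfl) (hF₁.reg 1 rfl) (hF₁.arr 0 rfl)
      (hF₁.arr 1 rfl) (hF₁.arr 2 rfl)
    refine Runs.time (Runs.ite (t := 160 * n ^ 2 + 100 * n + 40) (fun h => ?_) fun h => ?_)
      (by simp; omega)
    · have hlt : M₁.reg 20 < n := by
        simpa [hM₁.n_eq] using h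
      refine Runs.time (Runs.skip ⟨fun _ => ?_, fun h' => absurd hlt h'⟩) (by omega)
      have h2 := lastIdx_spec (h1 ▸ hlt)
      rw [← h1] at h2
      refine ⟨h2.1, .inl ⟨h2.2, ?_⟩⟩
      by_contra h3
      have h4 := h2.2
      simp [distFn, h3] at h4
    · have hnot : ¬ M₁.reg 20 < n := by
        simpa [hM₁.n_eq] using h
      have hcurn : ∀ y ∈ free n M, ¬ distFn G (M.reg 9) y = 1 := by
        intro y hy hd
        rw [h1, lastIdx_lt] at hnot
        exact hnot ⟨y, (mem_free.1 hy).1, hy, hd⟩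
      have hf₁ := free_congr (n := n) (hF₁.arr 3 rfl)
      refine Runs.mono (Runs.find (n := n) (tb := 160 * n + 30)
        (fun w => w ∈ free n M ∧ ¬ nbr₂ n (distFn G) (free n M) w < n) (by decide) rfl rfl ?_ ?_)
        ?_ ?_
      · intro M' hF
        simp [hF.reg 0 rfl, hM₁.n_eq]
      · intro w hw M' hF hMw
        have hM' : Ready G k M' := hM₁.congr (hF.reg 0 rfl) (hF.reg 1 rfl) (hF.arr 0 rfl)
          (hF.arr 1 rfl) (hF.arr 2 rfl)
        refine Runs.post (runs_nbrProg hM' hMw hw) ?_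
        rintro M'' ⟨-, h, -⟩ hF'
        have h' := free_congr (n := n) (hF.arr 3 rfl)
        rw [h', hf₁] at h
        simp [h, hF'.reg 12 rfl, hMw, hF'.arr 3 rfl, hF.arr 3 rfl, hF'.reg 0 rfl, hF.reg 0 rfl,
          hM₁.n_eq, mem_free, hw, hF₁.arr 3 rfl]
      · simp
        ring_nf
        omega
      · intro M' h2
        refine ⟨fun hlt => ?_, fun hnot w hw => ?_⟩
        · have h3 := lastIdx_spec (h2 ▸ hlt)
          rw [← h2, nbr₂_lt_iff free_subset] at h3
          refine ⟨h3.1, .inr ⟨hcurn, fun y hy z hz h4 h5 => ?_⟩⟩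
          by_contra hne
          exact h3.2 ⟨y, hy, z, hz, hne, h4, h5⟩
        · rw [h2, lastIdx_lt] at hnot
          rw [← nbr₂_lt_iff free_subset]
          by_contra h3
          exact hnot ⟨w, (mem_free.1 hw).1, hw, h3⟩
  · simp
    omega

/-- Extend the layout by one vertex, or remove a vertex. -/
def layoutStep : Prog :=
  nextProg ;;
    .ite (.lt (.reg 20) (.reg 0))
      (.put 5 (.reg 8) (.reg 20) ;; .assign 8 (.add (.reg 8) (.lit 1)) ;;
        .put 3 (.reg 20) (.lit 1) ;; .assign 9 (.reg 20))
      (.find 13 20 (.reg 0) .skip (.not (.get 3 (.reg 13))) ;;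
        .ite (.lt (.reg 20) (.reg 0))
          (.put 4 (.reg 7) (.reg 20) ;; .assign 7 (.add (.reg 7) (.lit 1)) ;;
            .put 3 (.reg 20) (.lit 1)) .skip)

/-- The invariant of the greedy layout for the current memory. -/
def PartialAt (G : SimpleGraph (Fin n)) (R₀ : Finset ℕ) (M : Memory) : Prop :=
  Partial n (distFn G) R₀ (free n M) (M.arr 4) (M.reg 7) (M.arr 5) (M.reg 8) (M.reg 9)

theorem PartialAt.congr {R₀ : Finset ℕ} {M' : Memory} (h : PartialAt G R₀ M)
    (h3 : M'.arr 3 = M.arr 3) (h4 : M'.arr 4 = M.arr 4) (h5 : M'.arr 5 = M.arr 5)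
    (h7 : M'.reg 7 = M.reg 7) (h8 : M'.reg 8 = M.reg 8) (h9 : M'.reg 9 = M.reg 9) :
    PartialAt G R₀ M' := by
  unfold PartialAt at h ⊢
  rwa [free_congr h3, h4, h5, h7, h8, h9]

theorem runs_layoutStep {R₀ : Finset ℕ} (hG : G.Connected) (hM : Ready G k M)
    (hR : R₀ ⊆ Finset.range n) (hclaw : ¬ clawVertex n (distFn G) R₀ < n)
    (hI : PartialAt G R₀ M) :
    Runs layoutStep M (160 * n ^ 2 + 300 * n + 200) fun M' =>
      PartialAt G R₀ M' ∧ (free n M').card ≤ (free n M).card - 1 := by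
  have hGM := graphMetric_distFn hG
  have hcur : M.reg 9 ≤ n := by
    rcases hI.cur_eq with h | h
    · exact h.2.le
    · rw [h.2]
      exact (hI.lay.lt _ (by omega)).le
  refine Runs.time (Runs.seq (runs_nextProg hM hcur) (t₂ := 30 * n + 80) fun M₁ h1 hF₁ => ?_)
    (by omega)
  have hM₁ : Ready G k M₁ := hM.congr (hF₁.reg 0 rfl) (hF₁.reg 1 rfl) (hF₁.arr 0 rfl)
    (hF₁.arr 1 rfl) (hF₁.arr 2 rfl)
  have hf₁ := free_congr (n := n) (hF₁.arr 3 rfl)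
  refine Runs.time (Runs.ite (t := 30 * n + 70) (fun h => ?_) fun h => ?_) (by simp; omega)
  · have hlt : M₁.reg 20 < n := by
      simpa [hM₁.n_eq] using h
    obtain ⟨hmem, hcase⟩ := h1.1 hlt
    refine Runs.time (Runs.put_seq (Runs.assign_seq (Runs.put_seq (Runs.assign ?_))))
      (by simp)
    have h3 := hF₁.arr 3 rfl
    have hfr : free n ((((M₁.setArr 5 ((Expr.reg 8).eval M₁) ((Expr.reg 20).eval M₁)).setReg 8
        (M₁.reg 8 + 1)).setArr 3 (M₁.reg 20) 1).setReg 9 (M₁.reg 20)) =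
        (free n M).erase (M₁.reg 20) := free_mark (by simp [h3])
    have h2 := Partial.append hI hGM hR hclaw hmem hcase
    unfold PartialAt
    simp only [Expr.eval_reg, Expr.eval_add, Expr.eval_lit, Memory.setReg_reg,
      Memory.setArr_reg] at hfr ⊢
    norm_num only [if_true, if_false] at hfr ⊢
    rw [hfr]
    refine ⟨?_, ?_⟩
    · simpa [hF₁.arr 4 rfl, hF₁.arr 5 rfl, hF₁.reg 7 rfl, hF₁.reg 8 rfl] using h2
    · rw [Finset.card_erase_of_mem hmem]
  · have hnot : ¬ M₁.reg 20 < n := by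
      simpa [hM₁.n_eq] using h
    have hcore := h1.2 hnot
    refine Runs.time (Runs.seq (Runs.findExpr (n := n) (fun y => y ∈ free n M) (by decide) ?_ ?_)
      (t₂ := 30) fun M₂ h2 hF₂ => ?_) ?_
    · intro M' hF
      simp [hF.reg 0 rfl, hM₁.n_eq]
    · intro y hy M' hF hMy
      simp [hF.arr 3 rfl, hF₁.arr 3 rfl, hMy, mem_free, hy]
    · have h3 : M₂.arr 3 = M.arr 3 := (hF₂.arr 3 rfl).trans (hF₁.arr 3 rfl)
      have h4 : M₂.arr 4 = M.arr 4 := (hF₂.arr 4 rfl).trans (hF₁.arr 4 rfl)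
      have h5 : M₂.arr 5 = M.arr 5 := (hF₂.arr 5 rfl).trans (hF₁.arr 5 rfl)
      have h7 : M₂.reg 7 = M.reg 7 := (hF₂.reg 7 rfl).trans (hF₁.reg 7 rfl)
      have h8 : M₂.reg 8 = M.reg 8 := (hF₂.reg 8 rfl).trans (hF₁.reg 8 rfl)
      have h9 : M₂.reg 9 = M.reg 9 := (hF₂.reg 9 rfl).trans (hF₁.reg 9 rfl)
      have h0 : M₂.reg 0 = n := (hF₂.reg 0 rfl).trans hM₁.n_eq
      refine Runs.time (Runs.ite (t := 20) (fun h' => ?_) fun h' => ?_) (by simp)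
      · have hlt : M₂.reg 20 < n := by
          simpa [h0] using h'
        have hmem : M₂.reg 20 ∈ free n M := by
          rw [h2]
          exact lastIdx_spec (h2 ▸ hlt)
        refine Runs.time (Runs.put_seq (Runs.assign_seq (Runs.put ?_))) (by simp)
        have hp := Partial.remove hI hGM hR hclaw hmem hcore
        have hfr : free n (((M₂.setArr 4 (M₂.reg 7) (M₂.reg 20)).setReg 7
            (M₂.reg 7 + 1)).setArr 3 (M₂.reg 20) 1) =
            (free n M).erase (M₂.reg 20) := free_mark (by simp [h3])
        unfold PartialAt
        simp only [Expr.eval_reg, Expr.eval_add, Expr.eval_lit, Memory.setReg_reg,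
          Memory.setArr_reg] at hfr ⊢
        norm_num only [if_true, if_false] at hfr ⊢
        rw [hfr]
        refine ⟨?_, ?_⟩
        · simpa [h4, h5, h7, h8, h9] using hp
        · rw [Finset.card_erase_of_mem hmem]
      · have hnot' : ¬ M₂.reg 20 < n := by
          simpa [h0] using h'
        refine Runs.time (Runs.skip ⟨hI.congr h3 h4 h5 h7 h8 h9, ?_⟩) (by omega)
        have hemp : free n M = ∅ := by
          by_contra hne
          obtain ⟨y, hy⟩ := Finset.nonempty_iff_ne_empty.2 hne
          rw [h2, lastIdx_lt] at hnot'
          exact hnot' ⟨y, (mem_free.1 hy).1, hy⟩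
        rw [free_congr h3, hemp]
        simp
    · simp
      omega

/-- Greedy layout of the vertices that are not marked. -/
def layoutProg : Prog :=
  .assign 8 (.lit 0) ;; .assign 9 (.reg 0) ;; .forLoop 19 (.reg 0) layoutStep

/-- Every step takes a vertex out of the free set as long as there is one, so n steps empty it. -/
theorem runs_layoutProg (hG : G.Connected) (hM : Ready G k M) (hR : Removed n M)
    (hclaw : ¬ clawVertex n (distFn G) (free n M) < n) :
    Runs layoutProg M (160 * n ^ 3 + 300 * n ^ 2 + 300 * n + 100) fun M' =>
      PartialAt G (free n M) M' ∧ free n M' = ∅ := by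
  refine Runs.time (Runs.assign_seq (Runs.assign_seq (Runs.mono (Runs.forLoop (n := n)
    (tb := 160 * n ^ 2 + 300 * n + 200)
    (fun i M' => PartialAt G (free n M) M' ∧ (free n M').card ≤ n - i) rfl ?_ ?_ ?_) le_rfl ?_))) ?_
  · intro M' hF
    simp [hF.reg 0 rfl, hM.n_eq]
  · have h := Partial.init (C := M.arr 4) (c := M.reg 7) (ord := M.arr 5) (D := distFn G)
      (free_subset (n := n) (M := M)) hR.cover hR.lt hR.card
    refine ⟨PartialAt.congr (M := (M.setReg 8 0).setReg 9 n) ?_ rfl rfl rfl rfl rfl ?_, ?_⟩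
    · unfold PartialAt
      change Partial n (distFn G) (free n M) (free n M) _ _ _ _ _
      simpa using h
    · simp [hM.n_eq]
    · have := hR.card
      change (free n M).card ≤ n - 0
      omega
  · rintro i hi M' hF hMi ⟨h1, h2⟩
    have hM' : Ready G k M' := hM.congr (hF.reg 0 rfl) (hF.reg 1 rfl) (hF.arr 0 rfl)
      (hF.arr 1 rfl) (hF.arr 2 rfl)
    refine Runs.mono (runs_layoutStep hG hM' free_subset hclaw h1) le_rfl ?_
    rintro M'' ⟨h3, h4⟩
    refine ⟨h3.congr rfl rfl rfl rfl rfl rfl, ?_⟩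
    change (free n M'').card ≤ n - (i + 1)
    omega
  · rintro M' ⟨⟨h1, h2⟩, -⟩
    refine ⟨h1, Finset.card_eq_zero.1 (by omega)⟩
  · simp
    ring_nf
    omega

end MESP

/-! ### Trying all strings of branching choices -/

namespace MESP

open RAM

variable {n k : ℕ} {G : SimpleGraph (Fin n)} {M : Memory}

/-- Every vertex has been removed or occurs in the layout. -/
structure Found (G : SimpleGraph (Fin n)) (M : Memory) : Prop where
  cover : ∀ a < n, (∃ j < M.reg 7, M.arr 4 j = a) ∨ ∃ i < M.reg 8, M.arr 5 i = a
  C_lt : ∀ j < M.reg 7, M.arr 4 j < n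
  lay : Layout n (distFn G) (M.arr 5) (M.reg 8)

theorem Found.congr {M' : Memory} (h : Found G M) (h4 : M'.arr 4 = M.arr 4)
    (h5 : M'.arr 5 = M.arr 5) (h7 : M'.reg 7 = M.reg 7) (h8 : M'.reg 8 = M.reg 8) :
    Found G M' :=
  ⟨by rw [h4, h5, h7, h8]; exact h.cover, by rw [h4, h7]; exact h.C_lt,
    by rw [h5, h8]; exact h.lay⟩

/-- The digits `d 0, …, d (j - 1)` are not the choices belonging to a modulator of size at most
`j`. -/
def Bad (n : ℕ) (D : ℕ → ℕ → ℕ) (d : ℕ → ℕ) (j : ℕ) : Prop :=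
  ∀ X, Meets n D X → X.card ≤ j → Finset.range n \ X ⊆ remaining n D d j →
    clawVertex n D (remaining n D d j) < n

/-- Try the choices in array `6`. -/
def attemptProg : Prog :=
  .forLoop 23 (.reg 0) (.put 3 (.reg 23) (.lit 0)) ;; .assign 7 (.lit 0) ;;
    .forLoop 18 (.reg 11) pickProg ;; clawProg ;;
    .ite (.lt (.reg 17) (.reg 0)) .skip
      (layoutProg ;; .ite (.lt (.reg 11) (.reg 7)) .skip (.assign 10 (.lit 1)))

theorem Ready.of_frame {p : Prog} {M' : Memory} (h : Ready G k M) (hF : Frame p M M')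
    (h0 : p.writesReg 0 = false := by rfl) (h1 : p.writesReg 1 = false := by rfl)
    (h2 : p.writesArr 0 = false := by rfl) (h3 : p.writesArr 1 = false := by rfl)
    (h4 : p.writesArr 2 = false := by rfl) : Ready G k M' :=
  h.congr (hF.reg 0 h0) (hF.reg 1 h1) (hF.arr 0 h2) (hF.arr 1 h3) (hF.arr 2 h4)

/-- The attempt fails either because a claw is left or because more than j vertices have been
removed. In the second case `Partial.le_card` shows that no X of size at most j is compatible with
the choices, so the string is `Bad` for both reasons. -/
theorem runs_attemptProg {j : ℕ} (hG : G.Connected) (hn : 0 < n) (hM : Ready G k M)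
    (h10 : M.reg 10 = 0) (h11 : M.reg 11 = j) (hd : ∀ i < j, M.arr 6 i < 4) :
    Runs attemptProg M ((j + 1) * (2000 * n ^ 3)) fun M' =>
      M'.reg 10 = 1 ∧ Found G M' ∧ M'.reg 7 ≤ j ∨
        M'.reg 10 = 0 ∧ Bad n (distFn G) (M.arr 6) j := by
  have hn2 : n ^ 2 ≤ n ^ 3 := Nat.pow_le_pow_right hn (by omega)
  have hn1 : n ≤ n ^ 3 := Nat.le_self_pow (by omega) n
  refine Runs.time (Runs.seq (Runs.forLoop (n := n) (tb := 3)
    (fun i M' => ∀ i' < i, M'.arr 3 i' = 0) rfl ?_ (by simp) ?_)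
      (t₂ := 2 + ((j * ((160 * n ^ 2 + 300 * n + 100) + 1 + 8) + (1 + 6)) +
        ((160 * n ^ 2 + 100 * n + 10) + (4 + (160 * n ^ 3 + 300 * n ^ 2 + 300 * n + 110)))))
      fun M₁ h1 hF₁ => ?_) ?_
  · intro M' hF
    simp [hF.reg 0 rfl, hM.n_eq]
  · intro i hi M' hF hMi hI
    refine Runs.put ?_
    intro i' hi'
    simp only [Memory.setReg_arr, Memory.setArr_arr_self, Expr.eval_reg, Expr.eval_lit, hMi,
      Function.update_apply]
    split_ifs with h
    · rfl
    · exact hI i' (by omega)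
  · have hM₁ := hM.of_frame hF₁
    have hfree : free n M₁ = Finset.range n := by
      ext a
      rw [mem_free, Finset.mem_range]
      exact ⟨fun h => h.1, fun h => ⟨h, h1.1 a h⟩⟩
    refine Runs.assign_seq (Runs.seq (Runs.forLoop (n := j) (tb := 160 * n ^ 2 + 300 * n + 100)
      (fun i M' => free n M' = remaining n (distFn G) (M.arr 6) i ∧ Removed n M') rfl ?_ ?_ ?_)
      fun M₂ h2 hF₂ => ?_)
    · intro M' hF
      simp [hF.reg 11 rfl, hF₁.reg 11 rfl, h11]
    · refine ⟨hfree, fun a ha h => absurd ?_ h, ?_, ?_⟩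
      · change a ∈ free n M₁
        rw [hfree]
        exact Finset.mem_range.2 ha
      · simp
      · change 0 + (free n M₁).card = n
        rw [hfree]
        simp
    · rintro i hi M' hF hMi ⟨h2, h3⟩
      have hM' : Ready G k M' := Ready.of_frame (M := M₁.setReg 7 0)
        (hM₁.congr rfl rfl rfl rfl rfl) hF
      have h6 : M'.arr 6 = M.arr 6 := (hF.arr 6 rfl).trans (hF₁.arr 6 rfl)
      refine Runs.mono (runs_pickProg (d := M.arr 6 i) hM' h3 (by rw [h6, hMi]) (hd i hi)) le_rfl ?_
      rintro M'' ⟨h4, h5⟩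
      refine ⟨?_, h5.congr rfl rfl rfl⟩
      change free n M'' = _
      rw [h4, h2, remaining]
    · obtain ⟨⟨hr, hR⟩, -⟩ := h2
      have hM₂ : Ready G k M₂ := Ready.of_frame (M := M₁.setReg 7 0)
        (hM₁.congr rfl rfl rfl rfl rfl) hF₂
      refine Runs.seq (runs_clawProg hM₂) fun M₃ h3 hF₃ => ?_
      have hM₃ := hM₂.of_frame hF₃
      have hR₃ : Removed n M₃ := hR.congr (hF₃.reg 7 rfl) (hF₃.arr 3 rfl) (hF₃.arr 4 rfl)
      have hf₃ : free n M₃ = remaining n (distFn G) (M.arr 6) j := by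
        rw [free_congr (hF₃.arr 3 rfl), hr]
      rw [hr] at h3
      have h10₃ : M₃.reg 10 = 0 := by
        rw [hF₃.reg 10 rfl, hF₂.reg 10 rfl, Memory.setReg_reg, if_neg (by decide),
          hF₁.reg 10 rfl, h10]
      have h11₃ : M₃.reg 11 = j := by
        rw [hF₃.reg 11 rfl, hF₂.reg 11 rfl, Memory.setReg_reg, if_neg (by decide),
          hF₁.reg 11 rfl, h11]
      refine Runs.ite (fun h => ?_) fun h => ?_
      · have hc : clawVertex n (distFn G) (remaining n (distFn G) (M.arr 6) j) < n := by
          simpa [h3, hM₃.n_eq] using h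
        exact Runs.time (Runs.skip (.inr ⟨h10₃, fun _ _ _ _ => hc⟩)) (by omega)
      · have hc : ¬ clawVertex n (distFn G) (free n M₃) < n := by
          rw [hf₃]
          simpa [h3, hM₃.n_eq] using h
        refine Runs.time (Runs.seq (runs_layoutProg hG hM₃ hR₃ hc) (t₂ := 7)
          fun M₄ h4 hF₄ => ?_) (by omega)
        obtain ⟨hp, hemp⟩ := h4
        unfold PartialAt at hp
        rw [hemp] at hp
        refine Runs.time (Runs.ite (t := 2) (fun h => ?_) fun h => ?_) (by simp)
        · have hlt : j < M₄.reg 7 := by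
            simpa [hF₄.reg 11 rfl, h11₃] using h
          refine Runs.time (Runs.skip (.inr ⟨by rw [hF₄.reg 10 rfl, h10₃], ?_⟩)) (by omega)
          intro X hX hX' hsub
          have := hp.le_card free_subset hX (hf₃ ▸ hsub)
          omega
        · have hle : M₄.reg 7 ≤ j := by
            simpa [hF₄.reg 11 rfl, h11₃] using h
          refine Runs.time (Runs.assign (.inl ⟨by simp, ?_, by simpa using hle⟩)) (by simp)
          exact Found.congr (M := M₄) ⟨fun a ha => hp.cover a ha (by simp), hp.C_lt, hp.lay⟩
            rfl rfl (by simp) (by simp)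
  · have h1 : 160 * n ^ 2 + 300 * n + 100 + 1 + 8 ≤ 600 * n ^ 3 := by omega
    have h2 := Nat.mul_le_mul_left j h1
    simp only [Expr.cost_reg]
    have h3 : (j + 1) * (2000 * n ^ 3) = 2000 * (j * n ^ 3) + 2000 * n ^ 3 := by ring
    have h4 : j * (600 * n ^ 3) = 600 * (j * n ^ 3) := by ring
    omega

/-- Find a modulator and a layout of the other vertices. -/
def searchProg : Prog :=
  .assign 10 (.lit 0) ;; .assign 11 (.lit 0) ;;
    .while (.not (.reg 10))
      (.enum 6 21 22 (.lit 4) (.reg 11) (.ite (.reg 10) .skip attemptProg) ;;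
        .assign 11 (.add (.reg 11) (.lit 1)))

/-- The algorithm does not know c and tries the lengths j = 0, 1, …; the string from `exists_digits`
prevents failure at j = c. The outcome need only be a layout with at most c removed vertices. -/
theorem runs_searchProg (hG : G.Connected) (hn : 0 < n) (hM : Ready G k M) :
    Runs searchProg M (3000 * (16 ^ distToDisjointPaths G * n ^ 3)) fun M' =>
      Found G M' ∧ M'.reg 7 ≤ distToDisjointPaths G := by
  obtain ⟨X, hXn, hXc, hX⟩ := exists_meets G
  obtain ⟨d, hd4, hd, hdc⟩ := exists_digits hX hXn
  rw [hXc] at hd hdc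
  set c := distToDisjointPaths G with hc
  have hM' : Ready G k ((M.setReg 10 0).setReg 11 0) := hM.congr (by simp) (by simp) rfl rfl rfl
  refine Runs.time (Runs.assign_seq (Runs.assign_seq (Runs.mono (Runs.whileLoop (N := c + 1)
    (tb := 4 ^ c * ((3 + (c + 1) * (2000 * n ^ 3)) + (c + 1) * (1 + 1 + 40)) +
      (c + 1) * (1 + 40) + 4)
    (Inv := fun j M' => M'.reg 10 = 1 ∧ Found G M' ∧ M'.reg 7 ≤ c ∨
      M'.reg 10 = 0 ∧ M'.reg 11 = j ∧ j ≤ c) ?_ ?_) le_rfl ?_))) ?_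
  · exact .inr ⟨by simp, by simp, by omega⟩
  · rintro j M₁ hF₁ hI he
    have h10 : M₁.reg 10 = 0 := by simpa using he
    obtain ⟨-, h11, hj⟩ : M₁.reg 10 = 0 ∧ M₁.reg 11 = j ∧ j ≤ c := by
      rcases hI with h | h
      · omega
      · exact h
    have hM₁ := hM'.of_frame hF₁
    refine ⟨by omega, Runs.time (Runs.seq (Runs.enum (bv := 4) (cv := j)
      (tb := 3 + (j + 1) * (2000 * n ^ 3))
      (fun g M' => M'.reg 10 = 1 ∧ Found G M' ∧ M'.reg 7 ≤ j ∨
        M'.reg 10 = 0 ∧ ∀ g' < g, Bad n (distFn G) (dig 4 g') j) (by decide) rfl (by omega)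
      (fun _ _ => rfl) ?_ ?_ ?_ ?_) (t₂ := 4) fun M₂ h2 hF₂ => Runs.assign ?_) ?_⟩
    · intro M' hF
      simp [hF.reg 11 rfl, h11]
    · rintro g M₂ M₃ h hr ha
      rw [hr 7 (by decide) (by decide), hr 10 (by decide) (by decide)]
      exact h.imp_left fun h => ⟨h.1, h.2.1.congr (ha 4 (by decide)) (ha 5 (by decide))
        (hr 7 (by decide) (by decide)) (hr 8 (by decide) (by decide)), h.2.2⟩
    · exact .inr ⟨h10, fun g hg => absurd hg (by omega)⟩
    · rintro g hg M₂ hF₂ hdig hI₂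
      refine Runs.time (Runs.ite (t := 1 + (j + 1) * (2000 * n ^ 3)) (fun h => ?_) fun h => ?_)
        (by simp; omega)
      · have h : M₂.reg 10 ≠ 0 := by simpa using h
        exact Runs.time (Runs.skip (.inl (hI₂.resolve_right fun h' => h h'.1))) (by omega)
      · have h : M₂.reg 10 = 0 := by simpa using h
        have hI₃ := hI₂.resolve_left fun h' => by omega
        refine Runs.mono (runs_attemptProg (j := j) hG hn (hM₁.of_frame hF₂) h
          (by rw [hF₂.reg 11 rfl, h11]) fun i hi => by rw [hdig i hi]; exact dig_lt (by omega) _ _)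
          (by omega) ?_
        intro M₃ h3
        refine h3.imp_right fun h3 => ⟨h3.1, fun g' hg' => ?_⟩
        rcases Nat.lt_succ_iff_lt_or_eq.1 hg' with h4 | rfl
        · exact hI₃.2 g' h4
        · have h5 := h3.2
          unfold Bad at h5 ⊢
          rwa [remaining_congr hdig] at h5
    · rcases h2 with h2 | h2
      · refine .inl ⟨by simpa using h2.1, h2.2.1.congr rfl rfl (by simp) (by simp), ?_⟩
        have := h2.2.2
        simp
        omega
      · refine .inr ⟨by simpa using h2.1, by simp [hF₂.reg 11 rfl, h11], ?_⟩
        rcases hj.lt_or_eq with h3 | rfl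
        · exact h3
        -- The string given by a least modulator is among those enumerated and is not bad.
        · have h4 := dig_ofDig (b := 4) (m := c) (s := d) (by omega) fun i _ => hd4 i
          refine absurd (h2.2 _ (ofDig_lt fun i _ => hd4 i) X hX hXc.le ?_) ?_
          · rwa [remaining_congr h4]
          · rwa [remaining_congr h4]
    · have h1 : 4 ^ j ≤ 4 ^ c := Nat.pow_le_pow_right (by omega) hj
      have h2 : j + 1 ≤ c + 1 := by omega
      simp only [Expr.cost_lit, Expr.cost_reg]
      gcongr
  · rintro M₁ ⟨j, -, h, he⟩
    rcases h with h | h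
    · exact h.2
    · simp [h.1] at he
  -- There are at most c + 1 lengths with 4 ^ c strings each, at O((c + 1) n³) steps per string; (c
  -- + 1)² ≤ 4 ^ c absorbs the polynomial factor.
  · have h1 : c + 1 ≤ 2 ^ c := Nat.lt_two_pow_self
    have h2 : (c + 1) ^ 2 * 4 ^ c ≤ 16 ^ c := by
      calc (c + 1) ^ 2 * 4 ^ c ≤ (2 ^ c) ^ 2 * 4 ^ c := by gcongr
        _ = 16 ^ c := by
          rw [← pow_mul, mul_comm c 2, pow_mul, ← mul_pow]; norm_num
    have hn3 : 1 ≤ n ^ 3 := Nat.one_le_pow _ _ hn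
    have h4 : 1 ≤ 4 ^ c := Nat.one_le_pow _ _ (by omega)
    have h5 : 4 ^ c * ((3 + (c + 1) * (2000 * n ^ 3)) + (c + 1) * (1 + 1 + 40)) +
        (c + 1) * (1 + 40) + 4 + 4 ≤ (c + 1) * 4 ^ c * (2200 * n ^ 3) := by
      have h6 : 3 + (c + 1) * (2000 * n ^ 3) + (c + 1) * (1 + 1 + 40) ≤
        (c + 1) * (2100 * n ^ 3) := by nlinarith
      have h7 := Nat.mul_le_mul_left (4 ^ c) h6
      have h8 : c + 1 ≤ (c + 1) * 4 ^ c * n ^ 3 := by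
        calc c + 1 = (c + 1) * 1 * 1 := by ring
          _ ≤ (c + 1) * 4 ^ c * n ^ 3 := by gcongr
      nlinarith
    have h9 := Nat.mul_le_mul_left (c + 1) h5
    have h10 : (c + 1) * ((c + 1) * 4 ^ c * (2200 * n ^ 3)) ≤ 2200 * (16 ^ c * n ^ 3) := by
      calc (c + 1) * ((c + 1) * 4 ^ c * (2200 * n ^ 3)) =
          2200 * ((c + 1) ^ 2 * 4 ^ c * n ^ 3) := by ring
        _ ≤ _ := by gcongr
    have h11 : 1 ≤ 16 ^ c * n ^ 3 := Nat.one_le_iff_ne_zero.2 (by positivity)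
    simp only [Expr.cost_not, Expr.cost_reg, Expr.cost_lit]
    nlinarith

end MESP

/-! ### The list of requirements for a guess -/

namespace MESP

open RAM

variable {n k c len u v : ℕ} {x e ord : ℕ → ℕ} {G : SimpleGraph (Fin n)} {M : Memory}

/-- The endpoints, the removed vertices and the layout are stored in memory. -/
structure Guess (G : SimpleGraph (Fin n)) (k c : ℕ) (x ord : ℕ → ℕ) (len u v : ℕ) (M : Memory) :
    Prop where
  ready : Ready G k M
  c_eq : M.reg 7 = c
  m_eq : M.reg 29 = c + 2
  x_eq : M.arr 4 = x
  ord_eq : M.arr 5 = ord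
  len_eq : M.reg 8 = len
  u_eq : M.reg 24 = u
  v_eq : M.reg 25 = v
  u_lt : u < n
  v_lt : v < n
  x_lt : ∀ j < c + 2, x j < n
  ord_lt : ∀ i < len, ord i < n

theorem Guess.congr {M' : Memory} (h : Guess G k c x ord len u v M)
    (hr : ∀ r ∈ [0, 1, 7, 8, 24, 25, 29], M'.reg r = M.reg r)
    (ha : ∀ a ∈ [0, 1, 2, 4, 5], M'.arr a = M.arr a) : Guess G k c x ord len u v M' :=
  ⟨h.ready.congr (hr 0 (by simp)) (hr 1 (by simp)) (ha 0 (by simp)) (ha 1 (by simp))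
    (ha 2 (by simp)), (hr 7 (by simp)).trans h.c_eq, (hr 29 (by simp)).trans h.m_eq,
    (ha 4 (by simp)).trans h.x_eq, (ha 5 (by simp)).trans h.ord_eq,
    (hr 8 (by simp)).trans h.len_eq, (hr 24 (by simp)).trans h.u_eq,
    (hr 25 (by simp)).trans h.v_eq, h.u_lt, h.v_lt, h.x_lt, h.ord_lt⟩

theorem Guess.of_frame {p : Prog} {M' : Memory} (h : Guess G k c x ord len u v M)
    (hF : Frame p M M') (hr : ∀ r ∈ [0, 1, 7, 8, 24, 25, 29], p.writesReg r = false := by decide)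
    (ha : ∀ a ∈ [0, 1, 2, 4, 5], p.writesArr a = false := by decide) :
    Guess G k c x ord len u v M' :=
  h.congr (fun r h => hF.reg r (hr r h)) fun a h => hF.arr a (ha a h)

/-- Search for a vertex on the path that is too far away from the first endpoint. -/
def levelProg : Prog :=
  .find 27 28 (.reg 29) .skip (.and (.not (.get 7 (.reg 27)))
    (.lt (distE (.reg 24) (.reg 25)) (distE (.reg 24) (.get 4 (.reg 27)))))

theorem runs_levelProg (hM : Guess G k c x ord len u v M) (he : M.arr 7 = e) :
    Runs levelProg M (100 * (c + 2)) fun M' => (M'.reg 28 < c + 2 ↔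
      ¬ ∀ j < c + 2, e j = 0 → distFn G u (x j) ≤ distFn G u v) := by
  refine Runs.mono (Runs.findExpr (n := c + 2)
    (fun j => e j = 0 ∧ distFn G u v < distFn G u (x j)) (by decide) ?_ ?_) ?_ ?_
  · exact fun M' hF => (hM.of_frame hF).m_eq
  · intro j hj M' hF hMj
    have hM' := hM.of_frame hF
    have he' := (hF.arr 7 rfl).trans he
    simp [hM'.u_eq, hM'.v_eq, hM'.x_eq, he', hMj, hM'.ready.dist u hM.u_lt v hM.v_lt,
      hM'.ready.dist u hM.u_lt (x j) (hM.x_lt j hj)]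
  · simp
    omega
  · intro M' h
    rw [h, lastIdx_lt]
    push Not
    rfl

/-- Determine the vertices that may be used. -/
def allowedProg : Prog :=
  .forLoop 30 (.reg 0)
    (.find 27 28 (.reg 29) .skip
        (.or (.lt (distE (.reg 30) (.get 4 (.reg 27))) (.get 7 (.reg 27)))
          (.and (.not (.get 7 (.reg 27)))
            (.and (.eq (distE (.reg 24) (.reg 30)) (distE (.reg 24) (.get 4 (.reg 27))))
              (.not (.eq (.reg 30) (.get 4 (.reg 27))))))) ;;
      .put 9 (.reg 30) (.not (.lt (.reg 28) (.reg 29))))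

theorem runs_allowedProg (hM : Guess G k c x ord len u v M) (he : M.arr 7 = e) :
    Runs allowedProg M (200 * (c + 2) * n + 10) fun M' =>
      ∀ q < n, M'.arr 9 q ≠ 0 ↔ Allowed (distFn G) (c + 2) x e u q := by
  refine Runs.mono (Runs.forLoop (n := n) (tb := 100 * (c + 2) + 60)
    (fun i M' => ∀ q < i, M'.arr 9 q ≠ 0 ↔ Allowed (distFn G) (c + 2) x e u q) rfl ?_ (by simp) ?_)
    ?_ fun M' h => h.1
  · exact fun M' hF => (hM.of_frame hF).ready.n_eq
  · intro q hq M' hF hMq hI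
    have hM' := hM.of_frame hF
    have he' := (hF.arr 7 rfl).trans he
    refine Runs.time (Runs.seq (Runs.findExpr (n := c + 2)
      (fun j => distFn G q (x j) < e j ∨ e j = 0 ∧ distFn G u q = distFn G u (x j) ∧ q ≠ x j)
      (by decide) ?_ ?_) fun M₂ h2 hF₂ => Runs.put ?_) ?_
    · exact fun M₂ hF₂ => (hM'.of_frame hF₂).m_eq
    · intro j hj M₂ hF₂ hMj
      have hM₂ := hM'.of_frame hF₂
      have he₂ := (hF₂.arr 7 rfl).trans he'
      have hMq₂ := (hF₂.reg 30 rfl).trans hMq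
      simp [hM₂.u_eq, hM₂.x_eq, he₂, hMj, hMq₂, hM₂.ready.dist u hM.u_lt q hq,
        hM₂.ready.dist u hM.u_lt (x j) (hM.x_lt j hj), hM₂.ready.dist q hq (x j) (hM.x_lt j hj),
        imp_iff_not_or]
    · intro q' hq'
      have hMq₂ := (hF₂.reg 30 rfl).trans hMq
      have h9 := hF₂.arr 9 rfl
      simp only [Memory.setReg_arr, Memory.setArr_arr_self, Expr.eval_reg, hMq₂, h9,
        Function.update_apply]
      split_ifs with h
      · subst h
        rw [Ne, Expr.not_eq_zero, Expr.lt_eq_zero, not_not, Expr.eval_reg, Expr.eval_reg, h2,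
          (hM'.of_frame hF₂).m_eq, lastIdx_lt]
        unfold Allowed
        push Not
        rfl
      · exact hI q' (by omega)
    · simp
      omega
  · simp
    nlinarith

/-- Append a requirement to the list. -/
def appendProg (w r : Expr) : Prog :=
  .put 10 (.reg 31) w ;; .put 11 (.reg 31) r ;; .assign 31 (.add (.reg 31) (.lit 1))

/-- The list of requirements consists of `N` pairs and is equivalent to `Ψ`. -/
structure Lists (M : Memory) (N : ℕ) (Ψ : (ℕ → ℕ → Prop) → Prop) : Prop where
  card : M.reg 31 = N
  all : ∀ Φ, (∀ j < N, Φ (M.arr 10 j) (M.arr 11 j)) ↔ Ψ Φ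

theorem Lists.congr {M' : Memory} {N N' : ℕ} {Ψ Ψ' : (ℕ → ℕ → Prop) → Prop} (h : Lists M N Ψ)
    (h31 : M'.reg 31 = M.reg 31) (h10 : M'.arr 10 = M.arr 10) (h11 : M'.arr 11 = M.arr 11)
    (hN : N = N') (hΨ : ∀ Φ, Ψ Φ ↔ Ψ' Φ) : Lists M' N' Ψ' := by
  subst hN
  exact ⟨h31.trans h.card, fun Φ => by rw [h10, h11, h.all, hΨ]⟩

/-- The second entry is evaluated after the first has been written to array `10`, hence the form of
`hr`. -/
theorem runs_appendProg {N N' a b : ℕ} {w r : Expr} {Ψ Ψ' : (ℕ → ℕ → Prop) → Prop}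
    (h : Lists M N Ψ) (hw : w.eval M = a) (hr : ∀ i b', r.eval (M.setArr 10 i b') = b)
    (hN : N + 1 = N') (hΨ : ∀ Φ, Ψ Φ ∧ Φ a b ↔ Ψ' Φ) :
    Runs (appendProg w r) M (w.cost + r.cost + 8) fun M' => Lists M' N' Ψ' := by
  subst hN
  refine Runs.time (Runs.put_seq (Runs.put_seq (Runs.assign ⟨?_, fun Φ => ?_⟩)))
    (by simp; omega)
  · simp [h.card]
  · rw [← hΨ, ← h.all]
    simp only [Memory.setReg_arr, Memory.setArr_arr_self, Expr.eval_reg, hw, hr, Memory.setArr_reg,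
      Memory.setArr_arr_of_ne _ _ _ (show 10 ≠ 11 by decide),
      Memory.setArr_arr_of_ne _ _ _ (show 11 ≠ 10 by decide), h.card]
    constructor
    · intro H
      refine ⟨fun j hj => ?_, ?_⟩
      · have := H j (by omega)
        rwa [Function.update_of_ne (by omega), Function.update_of_ne (by omega)] at this
      · simpa using H N (by omega)
    · rintro ⟨H1, H2⟩ j hj
      rcases Nat.lt_succ_iff_lt_or_eq.1 hj with h | rfl
      · rw [Function.update_of_ne (by omega), Function.update_of_ne (by omega)]
        exact H1 j h
      · simpa using H2

/-- List the removed vertices that are not on the path. -/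
def nearProg : Prog :=
  .forLoop 27 (.reg 29)
    (.ite (.get 7 (.reg 27)) (appendProg (.get 4 (.reg 27)) (.get 7 (.reg 27))) .skip)

theorem card_filter_range_succ (φ : ℕ → Prop) [DecidablePred φ] (i : ℕ) :
    ((Finset.range (i + 1)).filter φ).card =
      ((Finset.range i).filter φ).card + if φ i then 1 else 0 := by
  rw [Finset.range_add_one, Finset.filter_insert]
  split_ifs
  · rw [Finset.card_insert_of_notMem (by simp)]
  · simp

theorem runs_nearProg (hM : Guess G k c x ord len u v M) (he : M.arr 7 = e) (h31 : M.reg 31 = 0) :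
    Runs nearProg M (100 * (c + 2)) fun M' =>
      Lists M' ((Finset.range (c + 2)).filter fun j => 0 < e j).card fun Φ =>
        ∀ j < c + 2, 0 < e j → Φ (x j) (e j) := by
  refine Runs.mono (Runs.forLoop (n := c + 2) (tb := 40)
    (fun i M' => Lists M' ((Finset.range i).filter fun j => 0 < e j).card fun Φ =>
      ∀ j < i, 0 < e j → Φ (x j) (e j)) rfl ?_ ?_ ?_) ?_ fun M' h => h.1
  · exact fun M' hF => (hM.of_frame hF).m_eq
  · exact ⟨by simpa using h31, by simp⟩
  · intro i hi M' hF hMi hI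
    have hM' := hM.of_frame hF
    have he' := (hF.arr 7 rfl).trans he
    refine Runs.time (Runs.ite (t := 12) (fun h => ?_) fun h => ?_) (by simp)
    · have hpos : 0 < e i := by
        have : e i ≠ 0 := by simpa [he', hMi] using h
        omega
      refine Runs.mono (runs_appendProg (a := x i) (b := e i) hI (by simp [hM'.x_eq, hMi])
        (by simp [he', hMi])
        (N' := ((Finset.range (i + 1)).filter fun j => 0 < e j).card)
        (Ψ' := fun Φ => ∀ j < i + 1, 0 < e j → Φ (x j) (e j))
        (by rw [card_filter_range_succ, if_pos hpos]) fun Φ => ?_) (by simp) ?_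
      · refine ⟨fun H j hj hp => ?_, fun H => ⟨fun j hj => H j (by omega), H i (by omega) hpos⟩⟩
        rcases Nat.lt_succ_iff_lt_or_eq.1 hj with h | rfl
        exacts [H.1 j h hp, H.2]
      · exact fun M'' h => h.congr (by simp) rfl rfl rfl fun _ => Iff.rfl
    · have h0 : e i = 0 := by simpa [he', hMi] using h
      refine Runs.time (Runs.skip (hI.congr (by simp) rfl rfl ?_ fun Φ => ?_)) (by omega)
      · rw [card_filter_range_succ, if_neg (by omega), add_zero]
      · refine ⟨fun H j hj hp => ?_, fun H => fun j hj => H j (by omega)⟩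
        rcases Nat.lt_succ_iff_lt_or_eq.1 hj with h | rfl
        exacts [H j h hp, absurd hp (by omega)]
  · simp
    omega

/-- List the first two uncovered vertices of each block of the layout. -/
def repStep : Prog :=
  .find 27 28 (.reg 29) .skip (.and (.not (.get 7 (.reg 27)))
    (.lt (distE (.get 5 (.reg 30)) (.get 4 (.reg 27))) (.lit 2))) ;;
  .ite (.or (.lt (.reg 28) (.reg 29))
      (.not (adjE (.get 5 (.sub (.reg 30) (.lit 1))) (.get 5 (.reg 30)))))
    (.assign 32 (.lit 0)) .skip ;;
  .find 27 28 (.reg 29) .skip (.not (.lt (.reg 1)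
    (.add (distE (.get 5 (.reg 30)) (.get 4 (.reg 27))) (.get 7 (.reg 27))))) ;;
  .ite (.and (.not (.lt (.reg 28) (.reg 29))) (.lt (.reg 32) (.lit 2)))
    (.assign 32 (.add (.reg 32) (.lit 1)) ;; appendProg (.get 5 (.reg 30)) (.reg 1)) .skip

-- One pass over the layout computes the representatives: register `32` is the counter of the
-- current block, reset at breaks and at missing edges. At i = 0 the truncated index i - 1 compares
-- the first vertex with itself, which counts as a missing edge.
open Classical in
theorem runs_repStep {i N : ℕ} {Ψ : (ℕ → ℕ → Prop) → Prop} (hM : Guess G k c x ord len u v M)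
    (he : M.arr 7 = e) (hi : i < len) (hMi : M.reg 30 = i)
    (h32 : M.reg 32 = blockCount (distFn G) k (c + 2) x e ord i) (hL : Lists M N Ψ) :
    Runs repStep M (200 * (c + 2)) fun M' =>
      M'.reg 32 = blockCount (distFn G) k (c + 2) x e ord (i + 1) ∧
      Lists M' (N + if IsRep (distFn G) k (c + 2) x e ord i then 1 else 0)
        fun Φ => Ψ Φ ∧ (IsRep (distFn G) k (c + 2) x e ord i → Φ (ord i) k) := by
  refine Runs.time (Runs.seq (Runs.findExpr (n := c + 2)
    (fun j => e j = 0 ∧ distFn G (ord i) (x j) < 2) (by decide) ?_ ?_)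
    (t₂ := 24 + ((c + 2) * 40 + 9 + 60)) fun M₁ h1 hF₁ => ?_) ?_
  · exact fun M' hF => (hM.of_frame hF).m_eq
  · intro j hj M' hF hMj
    have hM' := hM.of_frame hF
    simp [hM'.x_eq, hM'.ord_eq, (hF.arr 7 rfl).trans he, hMj, (hF.reg 30 rfl).trans hMi,
      hM'.ready.dist _ (hM.ord_lt i hi) (x j) (hM.x_lt j hj)]
  · have hM₁ := hM.of_frame hF₁
    have hb : M₁.reg 28 < c + 2 ↔ Break (distFn G) (c + 2) x e (ord i) := by
      rw [h1, lastIdx_lt]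
      rfl
    have h30 := (hF₁.reg 30 rfl).trans hMi
    refine Runs.time (Runs.seq (Q := fun M' => M'.reg 32 = blockPos (distFn G) k (c + 2) x e ord i)
      (Runs.ite (t := 2) (fun h => ?_) fun h => ?_) (t₂ := (c + 2) * 40 + 9 + 60)
      fun M₂ h2 hF₂ => ?_) (by simp)
    · refine Runs.assign ?_
      simp only [Expr.eval_lit, Memory.setReg_reg, if_true]
      rw [blockPos, if_pos]
      by_contra h'
      push Not at h'
      refine h ?_
      rw [Expr.or_eq_zero, Expr.lt_eq_zero, Expr.eval_reg, Expr.eval_reg, hM₁.m_eq, hb,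
        Expr.not_eq_zero]
      refine ⟨h'.1, ?_⟩
      simp [hM₁.ord_eq, h30, hM₁.ready.adj _ (hM.ord_lt (i - 1) (by omega)).le _ (hM.ord_lt i hi),
        h'.2]
    · refine Runs.time (Runs.skip ?_) (by omega)
      rw [Expr.or_eq_zero, Expr.lt_eq_zero, Expr.eval_reg, Expr.eval_reg, hM₁.m_eq, hb,
        Expr.not_eq_zero] at h
      obtain ⟨h3, h4⟩ := h
      simp [hM₁.ord_eq, h30,
        hM₁.ready.adj _ (hM.ord_lt (i - 1) (by omega)).le _ (hM.ord_lt i hi)] at h4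
      rw [hF₁.reg 32 rfl, h32, blockPos, if_neg]
      tauto
    · have hM₂ := hM₁.of_frame hF₂
      have he₂ : M₂.arr 7 = e := (hF₂.arr 7 rfl).trans ((hF₁.arr 7 rfl).trans he)
      have h30₂ := (hF₂.reg 30 rfl).trans h30
      refine Runs.time (Runs.seq (Runs.findExpr (n := c + 2)
        (fun j => ¬ k < distFn G (ord i) (x j) + e j) (by decide) ?_ ?_)
        (t₂ := 60) fun M₃ h3 hF₃ => ?_) ?_
      · exact fun M' hF => (hM₂.of_frame hF).m_eq
      · intro j hj M' hF hMj
        have hM' := hM₂.of_frame hF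
        simp [hM'.x_eq, hM'.ord_eq, (hF.arr 7 rfl).trans he₂, hMj, (hF.reg 30 rfl).trans h30₂,
          hM'.ready.k_eq, hM'.ready.dist _ (hM.ord_lt i hi) (x j) (hM.x_lt j hj)]
      · have hM₃ := hM₂.of_frame hF₃
        have hU : M₃.reg 28 < c + 2 ↔ ¬ Uncovered (distFn G) k (c + 2) x e (ord i) := by
          rw [h3, lastIdx_lt]
          unfold Uncovered
          push Not
          rfl
        have h32₃ := (hF₃.reg 32 rfl).trans h2
        have h30₃ := (hF₃.reg 30 rfl).trans h30₂
        have hL₃ : Lists M₃ N Ψ := hL.congr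
          ((hF₃.reg 31 rfl).trans ((hF₂.reg 31 rfl).trans (hF₁.reg 31 rfl)))
          ((hF₃.arr 10 rfl).trans ((hF₂.arr 10 rfl).trans (hF₁.arr 10 rfl)))
          ((hF₃.arr 11 rfl).trans ((hF₂.arr 11 rfl).trans (hF₁.arr 11 rfl))) rfl fun _ => Iff.rfl
        have hrep : (Expr.and (.not (.lt (.reg 28) (.reg 29))) (.lt (.reg 32) (.lit 2))).eval M₃ =
            0 ↔ ¬ IsRep (distFn G) k (c + 2) x e ord i := by
          rw [Expr.and_eq_zero, Expr.not_eq_zero, Expr.lt_eq_zero, Expr.lt_eq_zero, Expr.eval_reg,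
            Expr.eval_reg, Expr.eval_reg, Expr.eval_lit, hM₃.m_eq, hU, h32₃, IsRep]
          tauto
        refine Runs.time (Runs.ite (t := 30) (fun h => ?_) fun h => ?_) (by simp)
        · have hr := not_not.1 (fun h' => h (hrep.2 h'))
          refine Runs.time (Runs.assign_seq (Runs.post (runs_appendProg (a := ord i) (b := k)
            (hL₃.congr (by simp) rfl rfl rfl fun _ => Iff.rfl)
            (by simp [hM₃.ord_eq, h30₃]) (by simp [hM₃.ready.k_eq]) rfl fun _ => Iff.rfl)
            fun M₄ h4 hF₄ => ⟨?_, ?_⟩)) (by simp)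
          · rw [hF₄.reg 32 rfl, blockCount_succ, if_pos hr]
            simp [h32₃]
          · exact h4.congr rfl rfl rfl (by rw [if_pos hr]) fun _ => by simp [hr]
        · have hr := hrep.1 h
          refine Runs.time (Runs.skip ⟨?_, ?_⟩) (by omega)
          · rw [h32₃, blockCount_succ, if_neg hr]
          · exact hL₃.congr rfl rfl rfl (by rw [if_neg hr, add_zero]) fun _ => by simp [hr]
      · simp
  · simp
    omega

/-- List all requirements. -/
def reqProg : Prog :=
  .assign 31 (.lit 0) ;; nearProg ;; .assign 32 (.lit 0) ;; .forLoop 30 (.reg 8) repStep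

theorem runs_reqProg (hM : Guess G k c x ord len u v M) (he : M.arr 7 = e) :
    Runs reqProg M (300 * (c + 2) * (len + 1)) fun M' =>
      Lists M' (numReq (distFn G) k (c + 2) x e ord len)
        (ForallReq (distFn G) k (c + 2) x e ord len) := by
  classical
  have hM₀ : Guess G k c x ord len u v (M.setReg 31 0) := hM.congr (by simp) (by simp)
  refine Runs.time (Runs.assign_seq (Runs.seq (runs_nearProg hM₀ he (by simp))
    (t₂ := 2 + (len * (200 * (c + 2) + 9) + 7)) fun M₁ h1 hF₁ => ?_)) ?_
  · have hM₁ : Guess G k c x ord len u v (M₁.setReg 32 0) :=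
      (hM₀.of_frame hF₁).congr (by simp) (by simp)
    have he₁ : M₁.arr 7 = e := (hF₁.arr 7 rfl).trans he
    refine Runs.time (Runs.assign_seq (Runs.mono (Runs.forLoop (n := len) (tb := 200 * (c + 2))
      (fun i M' => M'.reg 32 = blockCount (distFn G) k (c + 2) x e ord i ∧
        Lists M' (((Finset.range (c + 2)).filter fun j => 0 < e j).card +
          ((Finset.range i).filter (IsRep (distFn G) k (c + 2) x e ord)).card)
          (ForallReq (distFn G) k (c + 2) x e ord i)) rfl ?_ ?_ ?_) le_rfl ?_)) ?_
    · exact fun M' hF => (hM₁.of_frame hF).len_eq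
    · exact ⟨by simp [blockCount], h1.congr (by simp) rfl rfl (by simp) fun Φ => by
        simp [ForallReq]⟩
    · rintro i hi M' hF hMi ⟨h2, h3⟩
      refine Runs.mono (runs_repStep (hM₁.of_frame hF) ((hF.arr 7 rfl).trans he₁) hi hMi h2 h3)
        le_rfl ?_
      rintro M'' ⟨h4, h5⟩
      refine ⟨by simpa using h4, h5.congr (by simp) rfl rfl ?_ fun Φ => ?_⟩
      · rw [card_filter_range_succ (IsRep _ _ _ _ _ _), add_assoc]
      · unfold ForallReq
        refine ⟨fun H => ⟨H.1.1, fun j hj hp => ?_⟩, fun H => ⟨⟨H.1, fun j hj => H.2 j (by omega)⟩,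
          H.2 i (by omega)⟩⟩
        rcases Nat.lt_succ_iff_lt_or_eq.1 hj with h | rfl
        exacts [H.1.2 j h hp, H.2 hp]
    · rintro M' ⟨⟨-, h⟩, -⟩
      exact h.congr rfl rfl rfl (by rw [numReq]) fun _ => Iff.rfl
    · simp
  · simp
    nlinarith

end MESP

/-! ### Dynamic programming over the sets of satisfied requirements -/

namespace RAM

/-- Testing a set number for zero tests whether no requirement is left. -/
theorem ofDig_eq_zero {b m : ℕ} {s : ℕ → ℕ} (hb : 0 < b) :
    ofDig b s m = 0 ↔ ∀ j < m, s j = 0 := by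
  induction m with
  | zero => simp [ofDig]
  | succ m ih =>
    rw [ofDig, Nat.add_eq_zero_iff, ih, Nat.mul_eq_zero, or_iff_left (by positivity)]
    refine ⟨fun h j hj => ?_, fun h => ⟨fun j hj => h j (by omega), h m (by omega)⟩⟩
    rcases Nat.lt_succ_iff_lt_or_eq.1 hj with h' | rfl
    exacts [h.1 j h', h.2]

end RAM

namespace MESP

open RAM

variable {n k c len u v N : ℕ} {x e ord wl wr : ℕ → ℕ} {G : SimpleGraph (Fin n)} {M : Memory}
  {D : ℕ → ℕ → ℕ} {A S S' : ℕ → Prop}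

/-- Some shortest path from `u` to `q` satisfies the requirements in `S` and uses only vertices
in `A`. -/
def Reach (n : ℕ) (D : ℕ → ℕ → ℕ) (A : ℕ → Prop) (u N : ℕ) (wl wr : ℕ → ℕ) (S : ℕ → Prop)
    (q : ℕ) : Prop :=
  ∃ f, f 0 = u ∧ f (D u q) = q ∧ Geodesic n D f (D u q) ∧ (∀ t ≤ D u q, A (f t)) ∧
    ∀ j < N, S j → ∃ t ≤ D u q, D (wl j) (f t) ≤ wr j

theorem Reach.congr {q : ℕ} (h : ∀ j < N, S j ↔ S' j) :
    Reach n D A u N wl wr S q ↔ Reach n D A u N wl wr S' q := by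
  unfold Reach
  refine exists_congr fun f => and_congr_right fun _ => and_congr_right fun _ =>
    and_congr_right fun _ => and_congr_right fun _ => ?_
  exact ⟨fun H j hj hS => H j hj ((h j hj).2 hS), fun H j hj hS => H j hj ((h j hj).1 hS)⟩

/-- Split off the last vertex q: a requirement not satisfied by q itself must be satisfied by the
path up to the predecessor p. Appending q to a shortest path ending in p keeps it shortest because D
u p + 1 = D u q. -/
theorem reach_iff (hM : GraphMetric n D) (hu : u < n) {q : ℕ} (hq : q < n) :
    Reach n D A u N wl wr S q ↔ A q ∧ ((q = u ∧ ∀ j < N, S j → D (wl j) q ≤ wr j) ∨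
      ∃ p < n, D p q = 1 ∧ D u p + 1 = D u q ∧
        Reach n D A u N wl wr (fun j => S j ∧ ¬ D (wl j) q ≤ wr j) p) := by
  constructor
  · rintro ⟨f, h0, hl, hf, hA, hS⟩
    refine ⟨hl ▸ hA _ le_rfl, ?_⟩
    rcases Nat.eq_zero_or_pos (D u q) with h | h
    · obtain rfl := hM.eq u hu q hq h
      refine .inl ⟨rfl, fun j hj hj' => ?_⟩
      obtain ⟨t, ht, h'⟩ := hS j hj hj'
      obtain rfl : t = 0 := by omega
      rwa [h0] at h'
    · obtain ⟨d, hd⟩ : ∃ d, D u q = d + 1 := ⟨D u q - 1, by omega⟩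
      rw [hd] at hl hf hA hS
      have h1 : D u (f d) = d := by
        have := hf.dist 0 d (by omega) (by omega)
        rwa [h0] at this
      have h2 : D (f d) q = 1 := by
        have := hf.dist d (d + 1) (by omega) le_rfl
        rw [hl] at this
        omega
      refine .inr ⟨f d, hf.lt d (by omega), h2, by omega, f, h0, by rw [h1], ?_, ?_, ?_⟩
      · rw [h1]
        exact hf.mono (by omega)
      · rw [h1]
        exact fun t ht => hA t (by omega)
      · rintro j hj ⟨hj', hn⟩
        obtain ⟨t, ht, h'⟩ := hS j hj hj'
        refine ⟨t, ?_, h'⟩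
        rcases Nat.lt_or_ge d t with h3 | h3
        · obtain rfl : t = d + 1 := by omega
          rw [hl] at h'
          exact absurd h' hn
        · omega
  · rintro ⟨hA, ⟨rfl, hS⟩ | ⟨p, hp, hpq, hup, f, h0, hl, hf, hfA, hS⟩⟩
    · have h := hM.self q hq
      refine ⟨fun _ => q, rfl, rfl, ⟨fun _ _ => hq, fun s t hs ht => ?_⟩, fun _ _ => hA,
        fun j hj hj' => ⟨0, by omega, hS j hj hj'⟩⟩
      omega
    · set d := D u p with hd
      unfold Reach
      rw [← hup]
      have hle : ∀ t ≤ d, (if t ≤ d then f t else q) = f t := fun t ht => if_pos ht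
      have hlast : (if d + 1 ≤ d then f (d + 1) else q) = q := if_neg (by omega)
      refine ⟨fun t => if t ≤ d then f t else q, ?_, hlast, Geodesic.of_steps hM ?_ ?_ ?_, ?_, ?_⟩
      · simpa using h0
      · intro t ht
        split_ifs with h
        exacts [hf.lt t h, hq]
      · intro t ht
        rw [if_pos (Nat.zero_le d)]
        split_ifs with h
        · simpa using hf.dist 0 t (by omega) h
        · rw [h0]
          omega
      · intro t ht
        rw [if_pos (by omega : t ≤ d)]
        split_ifs with h
        · have := hf.dist t (t + 1) (by omega) h
          omega
        · obtain rfl : t = d := by omega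
          rwa [hl]
      · intro t ht
        dsimp only
        split_ifs with h
        exacts [hfA t h, hA]
      · intro j hj hj'
        by_cases h : D (wl j) q ≤ wr j
        · exact ⟨d + 1, le_rfl, by dsimp only; rwa [hlast]⟩
        · obtain ⟨t, ht, h'⟩ := hS j hj ⟨hj', h⟩
          exact ⟨t, by omega, by dsimp only; rwa [hle t ht]⟩

/-- The requirements for a guess are stored in memory. -/
structure Task (G : SimpleGraph (Fin n)) (k c : ℕ) (x ord : ℕ → ℕ) (len u v : ℕ) (A : ℕ → Prop)
    (N : ℕ) (wl wr : ℕ → ℕ) (M : Memory) : Prop where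
  guess : Guess G k c x ord len u v M
  allowed : ∀ q < n, M.arr 9 q ≠ 0 ↔ A q
  wl_eq : M.arr 10 = wl
  wr_eq : M.arr 11 = wr
  card : M.reg 31 = N
  wl_lt : ∀ j < N, wl j < n

theorem Task.congr {M' : Memory} (h : Task G k c x ord len u v A N wl wr M)
    (hr : ∀ r ∈ [0, 1, 7, 8, 24, 25, 29, 31], M'.reg r = M.reg r)
    (ha : ∀ a ∈ [0, 1, 2, 4, 5, 9, 10, 11], M'.arr a = M.arr a) :
    Task G k c x ord len u v A N wl wr M' :=
  ⟨h.guess.congr (fun r h => hr r (by simp at h ⊢; tauto)) fun a h => ha a (by simp at h ⊢; tauto),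
    by rw [ha 9 (by simp)]; exact h.allowed, (ha 10 (by simp)).trans h.wl_eq,
    (ha 11 (by simp)).trans h.wr_eq, (hr 31 (by simp)).trans h.card, h.wl_lt⟩

theorem Task.of_frame {p : Prog} {M' : Memory} (h : Task G k c x ord len u v A N wl wr M)
    (hF : Frame p M M')
    (hr : ∀ r ∈ [0, 1, 7, 8, 24, 25, 29, 31], p.writesReg r = false := by decide)
    (ha : ∀ a ∈ [0, 1, 2, 4, 5, 9, 10, 11], p.writesArr a = false := by decide) :
    Task G k c x ord len u v A N wl wr M' :=
  h.congr (fun r h => hF.reg r (hr r h)) fun a h => hF.arr a (ha a h)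

/-- Array `14` lists the vertices before `q₀` in the order of the distances from `u`, where `q₀`
has distance `d`. -/
structure Sorted (G : SimpleGraph (Fin n)) (u d q₀ : ℕ) (M : Memory) : Prop where
  lt : ∀ i < M.reg 40, M.arr 14 i < n
  lex : ∀ i j, i < j → j < M.reg 40 → distFn G u (M.arr 14 i) < distFn G u (M.arr 14 j) ∨
    distFn G u (M.arr 14 i) = distFn G u (M.arr 14 j) ∧ M.arr 14 i < M.arr 14 j
  mem : ∀ q < n, (∃ i < M.reg 40, M.arr 14 i = q) ↔
    distFn G u q < d ∨ distFn G u q = d ∧ q < q₀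

theorem Sorted.congr {d q₀ d' q₀' : ℕ} {M' : Memory} (h : Sorted G u d q₀ M)
    (h40 : M'.reg 40 = M.reg 40) (h14 : M'.arr 14 = M.arr 14)
    (hd : ∀ q < n, distFn G u q < d ∨ distFn G u q = d ∧ q < q₀ ↔
      distFn G u q < d' ∨ distFn G u q = d' ∧ q < q₀') : Sorted G u d' q₀' M' :=
  ⟨by rw [h40, h14]; exact h.lt, by rw [h40, h14]; exact h.lex, by
    rw [h40, h14]
    exact fun q hq => (h.mem q hq).trans (hd q hq)⟩

theorem Sorted.card_le {d q₀ : ℕ} (h : Sorted G u d q₀ M) : M.reg 40 ≤ n := by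
  have := Finset.card_le_card_of_injOn (s := Finset.range (M.reg 40)) (t := Finset.range n)
    (M.arr 14) (fun i hi => by simpa using h.lt i (by simpa using hi)) ?_
  · simpa using this
  · intro i hi j hj hij
    simp at hi hj
    rcases lt_trichotomy i j with h' | h' | h'
    · have := h.lex i j h' hj
      rw [hij] at this
      omega
    · exact h'
    · have := h.lex j i h' hi
      rw [hij] at this
      omega

/-- Sort the vertices by their distance from the first endpoint. -/
def sortProg : Prog :=
  .assign 40 (.lit 0) ;; .forLoop 36 (.reg 0) (.forLoop 30 (.reg 0)
    (.ite (.eq (distE (.reg 24) (.reg 30)) (.reg 36))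
      (.put 14 (.reg 40) (.reg 30) ;; .assign 40 (.add (.reg 40) (.lit 1))) .skip))

/-- Round d appends the vertices at distance d in increasing order. In a connected graph distances
are below n, so n rounds list every vertex. -/
theorem runs_sortProg (hM : Task G k c x ord len u v A N wl wr M) :
    Runs sortProg M (40 * n ^ 2 + 20 * n + 10) fun M' => Sorted G u n 0 M' := by
  have hM₀ : Task G k c x ord len u v A N wl wr (M.setReg 40 0) := hM.congr (by simp) (by simp)
  refine Runs.time (Runs.assign_seq (Runs.mono (Runs.forLoop (n := n) (tb := 35 * n + 7)
    (fun d M' => Sorted G u d 0 M') rfl ?_ ?_ ?_) le_rfl fun M' h => h.1)) ?_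
  · exact fun M' hF => (hM₀.of_frame hF).guess.ready.n_eq
  · exact ⟨by simp, by simp, by simp⟩
  · intro d hd M' hF hMd hI
    have hM' := hM₀.of_frame hF
    refine Runs.mono (Runs.forLoop (n := n) (tb := 26)
      (fun q M' => Sorted G u d q M') rfl ?_ ?_ ?_) (by simp; ring_nf; omega) fun M'' h => ?_
    · exact fun M' hF => (hM'.of_frame hF).guess.ready.n_eq
    · exact hI.congr (by simp) rfl fun _ _ => Iff.rfl
    · intro q hq M₁ hF₁ hMq h
      have hM₁ := hM'.of_frame hF₁
      have hguard : (Expr.eq (distE (.reg 24) (.reg 30)) (.reg 36)).eval M₁ = 0 ↔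
          ¬ distFn G u q = d := by
        simp [hM₁.guess.u_eq, hMq, (hF₁.reg 36 rfl).trans hMd,
          hM₁.guess.ready.dist u hM.guess.u_lt q hq]
      refine Runs.time (Runs.ite (t := 7) (fun h' => ?_) fun h' => ?_) (by simp)
      · have hd' := not_not.1 fun h2 => h' (hguard.2 h2)
        have hold : ∀ i < M₁.reg 40, distFn G u (M₁.arr 14 i) < d ∨
            distFn G u (M₁.arr 14 i) = d ∧ M₁.arr 14 i < q :=
          fun i hi => (h.mem _ (h.lt i hi)).1 ⟨i, hi, rfl⟩
        refine Runs.time (Runs.put_seq (Runs.assign ⟨?_, ?_, ?_⟩)) (by simp)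
        · intro i hi
          simp at hi
          simp [hMq, Function.update_apply]
          split_ifs with h2
          · exact hq
          · exact h.lt i (by omega)
        · intro i j hij hj
          simp at hj
          simp only [Memory.setReg_arr, Memory.setArr_arr_self, Expr.eval_reg, hMq]
          rw [Function.update_of_ne (a := i) (by omega)]
          rcases hj.lt_or_eq with h2 | rfl
          · rw [Function.update_of_ne (by omega)]
            exact h.lex i j hij h2
          · rw [Function.update_self, hd']
            exact hold i hij
        · intro q' hq'
          simp only [Memory.setReg_arr, Memory.setArr_arr_self, Expr.eval_reg, hMq,
            Memory.setReg_reg, Expr.eval_add, Expr.eval_lit, Memory.setArr_reg]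
          norm_num only [if_true, if_false]
          have h2 := h.mem q' hq'
          constructor
          · rintro ⟨i, hi, rfl⟩
            rcases Nat.lt_succ_iff_lt_or_eq.1 hi with h3 | rfl
            · rw [Function.update_of_ne (by omega)]
              have := hold i h3
              omega
            · rw [Function.update_self]
              omega
          · intro h3
            by_cases h4 : q' = q
            · exact ⟨M₁.reg 40, by omega, by rw [Function.update_self, h4]⟩
            · obtain ⟨i, hi, h5⟩ := h2.2 (by omega)
              exact ⟨i, by omega, by rw [Function.update_of_ne (by omega), h5]⟩
      · have hd' := hguard.1 h'
        refine Runs.time (Runs.skip (h.congr (by simp) rfl fun q' _ => ?_)) (by omega)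
        by_cases h2 : q' = q
        · subst h2
          omega
        · omega
    · exact h.1.congr (by simp) rfl fun q hq => by omega
  · simp
    ring_nf
    omega

/-- Compute the number of the set of the bits `j` for which `E` holds, multiplied by `n`. -/
def subsetProg (E : Expr) : Prog :=
  .assign 37 (.lit 0) ;; .assign 38 (.reg 0) ;;
    .forLoop 27 (.reg 31) (.ite E (.assign 37 (.add (.reg 37) (.reg 38))) .skip ;;
      .assign 38 (.add (.reg 38) (.reg 38)))

/-- Without multiplication, register `38` runs through 2 ^ j * n by doubling; the sum is then
directly the offset of a table row. -/
theorem runs_subsetProg {E : Expr} {s : ℕ → ℕ} (hM : Task G k c x ord len u v A N wl wr M)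
    (hs : ∀ j < N, s j < 2)
    (hE : ∀ j < N, ∀ M', Frame (subsetProg E) M M' → M'.reg 27 = j → (E.eval M' ≠ 0 ↔ s j = 1)) :
    Runs (subsetProg E) M (N * (E.cost + 18) + 14) fun M' => M'.reg 37 = ofDig 2 s N * n := by
  have hn0 : M.reg 0 = n := hM.guess.ready.n_eq
  have hfr : ∀ M', Frame (.forLoop 27 (.reg 31) (.ite E (.assign 37 (.add (.reg 37) (.reg 38)))
      .skip ;; .assign 38 (.add (.reg 38) (.reg 38)))) ((M.setReg 37 0).setReg 38 n) M' →
      Frame (subsetProg E) M M' := by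
    refine fun M' hF => ⟨fun r hr => ?_, fun a ha => hF.arr a rfl⟩
    simp only [subsetProg, Prog.forLoop, Prog.writesReg, Bool.or_eq_false_iff] at hr
    have h1 : r ≠ 37 := by
      rintro rfl
      simp at hr
    have h2 : r ≠ 38 := by
      rintro rfl
      simp at hr
    rw [hF.reg r (by simp [Prog.forLoop, Prog.writesReg] at hr ⊢; tauto)]
    simp [h1, h2]
  have hset : ((M.setReg 37 ((Expr.lit 0).eval M)).setReg 38
      ((Expr.reg 0).eval (M.setReg 37 ((Expr.lit 0).eval M)))) =
      (M.setReg 37 0).setReg 38 n := by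
    simp [hn0]
  refine Runs.time (Runs.assign_seq (Runs.assign_seq (t := N * (E.cost + 9 + 1 + 8) + 7) ?_))
    (by simp; nlinarith)
  rw [hset]
  refine Runs.mono (Runs.forLoop (n := N) (tb := E.cost + 9)
    (fun j M' => M'.reg 37 = ofDig 2 s j * n ∧ M'.reg 38 = 2 ^ j * n) rfl ?_ ?_ ?_)
    (by simp) fun M' h => h.1.1
  · intro M' hF
    exact ((hfr M' hF).reg 31 rfl).trans hM.card
  · simp [ofDig]
  · rintro j hj M' hF hMj ⟨h1, h2⟩
    have hguard := hE j hj M' (hfr M' hF) hMj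
    refine Runs.time (Runs.seq (Q := fun M' => M'.reg 37 = ofDig 2 s (j + 1) * n)
      (Runs.ite (t := 4) (fun h => ?_) fun h => ?_) (t₂ := 4) fun M₂ h3 hF₂ =>
      Runs.assign ⟨?_, ?_⟩) (by simp)
    · refine Runs.assign ?_
      simp [h1, h2, ofDig, hguard.1 h]
      ring
    · have h5 : s j = 0 := by
        have := hs j hj
        have : s j ≠ 1 := fun h' => hguard.2 h' h
        omega
      refine Runs.time (Runs.skip ?_) (by omega)
      simp [h1, ofDig, h5]
    · simpa using h3
    · have : M₂.reg 38 = M'.reg 38 := hF₂.reg 38 rfl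
      simp [this, h2, pow_succ]
      ring

/-- Entry of the table for the set in array `12` and the vertex in register `30`. -/
def cellProg : Prog :=
  subsetProg (.and (.get 12 (.reg 27))
    (.lt (.get 11 (.reg 27)) (distE (.get 10 (.reg 27)) (.reg 30)))) ;;
    .find 39 28 (.reg 0) .skip (.and (adjE (.reg 39) (.reg 30))
      (.and (.eq (.add (distE (.reg 24) (.reg 39)) (.lit 1)) (distE (.reg 24) (.reg 30)))
        (.get 13 (.add (.reg 37) (.reg 39))))) ;;
    .put 13 (.add (.reg 35) (.reg 30)) (.and (.get 9 (.reg 30))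
      (.or (.and (.eq (.reg 30) (.reg 24)) (.not (.reg 37))) (.lt (.reg 28) (.reg 0)))) ;;
    .assign 35 (.add (.reg 35) (.reg 0))

/-- The table entry for the set `g` and the vertex `q` is correct. -/
def Entry (G : SimpleGraph (Fin n)) (A : ℕ → Prop) (u N : ℕ) (wl wr T : ℕ → ℕ) (g q : ℕ) : Prop :=
  T (g * n + q) ≠ 0 ↔ Reach n (distFn G) A u N wl wr (fun j => dig 2 g j ≠ 0) q

theorem runs_cellProg {g q : ℕ} (hG : G.Connected) (hn : 0 < n)
    (hM : Task G k c x ord len u v A N wl wr M)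
    (h35 : M.reg 35 = g * n) (h30 : M.reg 30 = q) (hq : q < n)
    (hb : ∀ j < N, M.arr 12 j = dig 2 g j)
    (hprev : ∀ p < n, distFn G u p + 1 = distFn G u q →
      ∀ g' < 2 ^ N, Entry G A u N wl wr (M.arr 13) g' p) :
    Runs cellProg M (70 * (N + n) + 70) fun M' => M'.reg 35 = (g + 1) * n ∧
      ∃ b, M'.arr 13 = Function.update (M.arr 13) (g * n + q) b ∧
        (b ≠ 0 ↔ Reach n (distFn G) A u N wl wr (fun j => dig 2 g j ≠ 0) q) := by
  classical
  have hGM := graphMetric_distFn hG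
  -- The requirements of g that q leaves unsatisfied; by `reach_iff` they are passed on to the
  -- predecessor.
  set s : ℕ → ℕ := fun j => if dig 2 g j ≠ 0 ∧ wr j < distFn G (wl j) q then 1 else 0 with hs
  have hs2 : ∀ j < N, s j < 2 := by
    intro j _
    simp only [hs]
    split_ifs <;> omega
  refine Runs.time (Runs.seq (runs_subsetProg (s := s) hM hs2 ?_)
    (t₂ := n * 65 + 50) fun M₁ h1 hF₁ => ?_) ?_
  · intro j hj M' hF hMj
    have hM' := hM.of_frame hF
    have h3 : M'.arr 12 = M.arr 12 := hF.arr 12 rfl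
    have h4 : M'.reg 30 = q := (hF.reg 30 rfl).trans h30
    simp [hMj, h3, h4, hb j hj, hM'.wl_eq, hM'.wr_eq,
      hM'.guess.ready.dist _ (hM.wl_lt j hj) q hq, hs]
  · have hM₁ := hM.of_frame hF₁
    have h30₁ := (hF₁.reg 30 rfl).trans h30
    have h35₁ := (hF₁.reg 35 rfl).trans h35
    have h13₁ : M₁.arr 13 = M.arr 13 := hF₁.arr 13 rfl
    have hsub : ∀ j < N, dig 2 (ofDig 2 s N) j ≠ 0 ↔
        dig 2 g j ≠ 0 ∧ ¬ distFn G (wl j) q ≤ wr j := by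
      intro j hj
      rw [dig_ofDig (by omega) hs2 j hj, not_le]
      simp only [hs]
      split_ifs with h <;> simp [h]
    refine Runs.time (Runs.seq (Runs.findExpr (n := n) (fun p => distFn G p q = 1 ∧
      distFn G u p + 1 = distFn G u q ∧ M.arr 13 (ofDig 2 s N * n + p) ≠ 0) (by decide) ?_ ?_)
      (t₂ := 41) fun M₂ h2 hF₂ => ?_) (by simp)
    · exact fun M' hF => (hM₁.of_frame hF).guess.ready.n_eq
    · intro p hp M' hF hMp
      have hM' := hM₁.of_frame hF
      simp [hMp, hM'.guess.u_eq, (hF.reg 30 rfl).trans h30₁, (hF.reg 37 rfl).trans h1,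
        (hF.arr 13 rfl).trans h13₁, hM'.guess.ready.dist u hM.guess.u_lt p hp,
        hM'.guess.ready.dist u hM.guess.u_lt q hq, hM'.guess.ready.adj p hp.le q hq]
    · have hM₂ := hM₁.of_frame hF₂
      have h30₂ := (hF₂.reg 30 rfl).trans h30₁
      have h35₂ := (hF₂.reg 35 rfl).trans h35₁
      have h37₂ := (hF₂.reg 37 rfl).trans h1
      have h13₂ := (hF₂.arr 13 rfl).trans h13₁
      refine Runs.time (Runs.put_seq (Runs.assign ⟨?_,
        (Expr.and (.get 9 (.reg 30)) (.or (.and (.eq (.reg 30) (.reg 24)) (.not (.reg 37)))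
          (.lt (.reg 28) (.reg 0)))).eval M₂, ?_, ?_⟩)) ?_
      · simp [h35₂, hM₂.guess.ready.n_eq]
        ring
      · simp [h35₂, h30₂, h13₂]
      · rw [reach_iff hGM hM.guess.u_lt hq, Ne, Expr.and_eq_zero, Expr.or_eq_zero,
          Expr.and_eq_zero, Expr.eq_eq_zero, Expr.not_eq_zero, Expr.lt_eq_zero]
        simp only [Expr.eval_get, Expr.eval_reg, h30₂, h37₂, hM₂.guess.u_eq,
          hM₂.guess.ready.n_eq, h2, lastIdx_lt]
        have hal := hM₂.allowed q hq
        have hz : ofDig 2 s N * n = 0 ↔ ∀ j < N, dig 2 g j ≠ 0 → distFn G (wl j) q ≤ wr j := by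
          rw [Nat.mul_eq_zero, or_iff_left (by omega), ofDig_eq_zero (by omega)]
          refine forall₂_congr fun j hj => ?_
          rw [← not_iff_not, ← dig_ofDig (by omega) hs2 j hj, ← Ne, hsub j hj]
          tauto
        have hex : (∃ p < n, distFn G p q = 1 ∧ distFn G u p + 1 = distFn G u q ∧
            M.arr 13 (ofDig 2 s N * n + p) ≠ 0) ↔ ∃ p < n, distFn G p q = 1 ∧
            distFn G u p + 1 = distFn G u q ∧ Reach n (distFn G) A u N wl wr
              (fun j => dig 2 g j ≠ 0 ∧ ¬ distFn G (wl j) q ≤ wr j) p := by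
          refine exists_congr fun p => and_congr_right fun hp => and_congr_right fun _ =>
            and_congr_right fun h => ?_
          rw [← Reach.congr hsub]
          exact hprev p hp h _ (ofDig_lt hs2)
        -- Propositional core of the comparison between the zero tests of the guard and `reach_iff`.
        have key : ∀ a b f e' r : Prop, (¬ a ↔ r) →
            (¬ (a ∨ (¬ b ∨ ¬ f) ∧ ¬ e') ↔ r ∧ (b ∧ f ∨ e')) := by
          intros
          tauto
        rw [hz, hex]
        exact key _ _ _ _ _ hal
      · simp
  · simp
    omega

/-- Fill the table. -/
def tableProg : Prog :=
  sortProg ;; .forLoop 36 (.reg 40)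
    (.assign 30 (.get 14 (.reg 36)) ;; .assign 35 (.lit 0) ;;
      .enum 12 33 34 (.lit 2) (.reg 31) cellProg)

/-- Vertices are treated by increasing distance from u, so the rows of all possible predecessors,
for every set, are complete when a vertex is reached. -/
theorem runs_tableProg (hG : G.Connected) (hn : 0 < n)
    (hM : Task G k c x ord len u v A N wl wr M) :
    Runs tableProg M (400 * (2 ^ N * (N + 1) * n ^ 2)) fun M' =>
      ∀ q < n, ∀ g < 2 ^ N, Entry G A u N wl wr (M'.arr 13) g q := by
  have hGM := graphMetric_distFn hG
  have hN : 1 ≤ 2 ^ N := Nat.one_le_two_pow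
  refine Runs.time (Runs.seq (runs_sortProg hM) (t₂ := n * ((3 + (2 + (2 ^ N *
    ((70 * (N + n) + 70) + (N + 1) * (1 + 1 + 40)) + (N + 1) * (1 + 40)))) + 1 + 8) + 7)
    fun M₁ h1 hF₁ => ?_) ?_
  · have hM₁ := hM.of_frame hF₁
    have hcard := h1.card_le
    set m := M₁.reg 40 with hm
    set L := M₁.arr 14 with hL
    refine Runs.time (Runs.mono (Runs.forLoop (n := m) (tb := 3 + (2 + (2 ^ N *
      ((70 * (N + n) + 70) + (N + 1) * (1 + 1 + 40)) + (N + 1) * (1 + 40))))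
      (fun i M' => ∀ i' < i, ∀ g < 2 ^ N, Entry G A u N wl wr (M'.arr 13) g (L i')) rfl ?_ ?_ ?_)
      le_rfl ?_) ?_
    · exact fun M' hF => hF.reg 40 rfl
    · simp
    · intro i hi M' hF hMi hI
      have hM' := hM₁.of_frame hF
      have h14 : M'.arr 14 = L := hF.arr 14 rfl
      have hM'' : Task G k c x ord len u v A N wl wr ((M'.setReg 30 (L i)).setReg 35 0) :=
        hM'.congr (by simp) (by simp)
      have hq : L i < n := h1.lt i hi
      have hset : (M'.setReg 30 ((Expr.get 14 (.reg 36)).eval M')) = M'.setReg 30 (L i) := by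
        simp [h14, hMi]
      refine Runs.time (Runs.assign_seq (Runs.assign_seq (t := 2 ^ N *
        ((70 * (N + n) + 70) + (N + 1) * (1 + 1 + 40)) + (N + 1) * (1 + 40)) ?_)) (by simp)
      rw [hset]
      refine Runs.mono (Runs.enum (bv := 2) (cv := N) (tb := 70 * (N + n) + 70)
        (fun g M₂ => M₂.reg 35 = g * n ∧
          (∀ i' < i, ∀ g < 2 ^ N, Entry G A u N wl wr (M₂.arr 13) g (L i')) ∧
          ∀ g' < g, Entry G A u N wl wr (M₂.arr 13) g' (L i)) (by decide) rfl (by omega)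
        (fun _ _ => rfl) ?_ ?_ ?_ ?_) (by simp) ?_
      · exact fun M₂ hF₂ => (hM''.of_frame hF₂).card
      · rintro g M₂ M₃ h hr ha
        rw [hr 35 (by decide) (by decide), ha 13 (by decide)]
        exact h
      · exact ⟨by simp, hI, by simp⟩
      · rintro g hg M₂ hF₂ hdig ⟨h35, h2, h3⟩
        have h30 : M₂.reg 30 = L i := by
          rw [hF₂.reg 30 rfl]
          simp
        refine Runs.mono (runs_cellProg hG hn (hM''.of_frame hF₂) h35 h30 hq hdig ?_) le_rfl ?_
        · intro p hp hd
          obtain ⟨i', hi', rfl⟩ := (h1.mem p hp).2 (.inl (distFn_lt hG hM.guess.u_lt hp))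
          -- The predecessor is closer to u, so the lexicographic order of the list puts it before L
          -- i.
          rcases lt_trichotomy i' i with h | rfl | h
          · exact h2 i' h
          · exact absurd hd (by simp [hL])
          · have := h1.lex i i' h hi'
            rw [← hL] at this hd
            omega
        · rintro M₃ ⟨h35', b, hT, hb⟩
          -- Different pairs of a set and a vertex have different cells, so a single write preserves
          -- all other correct entries.
          have key : ∀ g' q', q' < n → Entry G A u N wl wr (M₂.arr 13) g' q' →
              Entry G A u N wl wr (M₃.arr 13) g' q' := by
            intro g' q' hq' hE
            unfold Entry at hE ⊢
            rw [hT, Function.update_apply]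
            simp only [cell_inj hq' hq]
            split_ifs with h
            · rw [h.1, h.2]
              exact hb
            · exact hE
          refine ⟨h35', fun i' hi' g' hg' => key _ _ (h1.lt i' (by omega)) (h2 i' hi' g' hg'),
            fun g' hg' => ?_⟩
          rcases Nat.lt_succ_iff_lt_or_eq.1 hg' with h | rfl
          · exact key _ _ hq (h3 g' h)
          · unfold Entry
            rw [hT, Function.update_self]
            exact hb
      · rintro M₂ ⟨-, h2, h3⟩ i' hi' g hg
        rcases Nat.lt_succ_iff_lt_or_eq.1 hi' with h | rfl
        exacts [h2 i' h g hg, h3 g hg]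
    · rintro M' ⟨h, -⟩ q hq g hg
      obtain ⟨i, hi, rfl⟩ := (h1.mem q hq).2 (.inl (distFn_lt hG hM.guess.u_lt hq))
      exact h i hi g hg
    · simp only [Expr.cost_reg]
      gcongr
  · set a := 2 ^ N
    have h1 : 70 * (N + n) + 70 + (N + 1) * (1 + 1 + 40) ≤ 190 * ((N + 1) * n) := by nlinarith
    have h2 := Nat.mul_le_mul_left a h1
    have h3 : 1 ≤ a * (N + 1) * n := Nat.one_le_iff_ne_zero.2 (by positivity)
    have h4 : N + 1 ≤ a * (N + 1) * n := by
      calc N + 1 = 1 * (N + 1) * 1 := by ring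
        _ ≤ a * (N + 1) * n := by gcongr; omega
    have h5 : 3 + (2 + (a * ((70 * (N + n) + 70) + (N + 1) * (1 + 1 + 40)) + (N + 1) * (1 + 40))) +
        1 + 8 ≤ 250 * (a * (N + 1) * n) := by nlinarith
    have h6 := Nat.mul_le_mul_left n h5
    have h7 : n ^ 2 ≤ a * (N + 1) * n ^ 2 := Nat.le_mul_of_pos_left _ (by positivity)
    have h8 : n ≤ n ^ 2 := Nat.le_self_pow (by omega) n
    nlinarith

end MESP

/-! ### Checking all guesses -/

namespace MESP

open RAM

variable {n k c len u v : ℕ} {x e ord C : ℕ → ℕ} {G : SimpleGraph (Fin n)} {M : Memory}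

/-- Set register `26` to `1` if the guess is confirmed. -/
def confirmProg : Prog :=
  levelProg ;; .ite (.lt (.reg 28) (.reg 29)) .skip
    (allowedProg ;; reqProg ;;
      .ite (.lt (.sub (.add (.add (.reg 29) (.reg 29)) (.add (.reg 29) (.reg 29))) (.lit 4))
          (.reg 31)) .skip
        (tableProg ;; subsetProg (.lit 1) ;;
          .ite (.get 13 (.add (.reg 37) (.reg 25))) (.assign 26 (.lit 1)) .skip))

theorem confirmProg_time (hn : 0 < n) {N : ℕ} (hN : N ≤ 4 * c + 4) (hlen : len ≤ n) :
    100 * (c + 2) + (200 * (c + 2) * n + 10 + (300 * (c + 2) * (len + 1) +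
      (400 * (2 ^ N * (N + 1) * n ^ 2) + (N * 19 + 100)))) ≤ 40000 * (16 ^ c * (c + 1) * n ^ 2) := by
  have h1 : 2 ^ N * (N + 1) * n ^ 2 ≤ 2 ^ (4 * c + 4) * (4 * c + 4 + 1) * n ^ 2 := by
    gcongr
    omega
  -- The bound 4c + 4 on the number of requirements is what produces the factor 16 ^ c.
  have h2 : 2 ^ (4 * c + 4) = 16 * 16 ^ c := by
    rw [pow_add, pow_mul]
    norm_num
    ring
  have h3 : 1 ≤ 16 ^ c := Nat.one_le_pow _ _ (by omega)
  have h4 : n ≤ n ^ 2 := Nat.le_self_pow (by omega) n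
  have h5 : (c + 1) * n ^ 2 ≤ 16 ^ c * (c + 1) * n ^ 2 := by
    calc (c + 1) * n ^ 2 = 1 * (c + 1) * n ^ 2 := by ring
      _ ≤ _ := by gcongr
  have h6 : 2 ^ (4 * c + 4) * (4 * c + 4 + 1) * n ^ 2 ≤ 80 * (16 ^ c * (c + 1) * n ^ 2) := by
    rw [h2]
    calc 16 * 16 ^ c * (4 * c + 4 + 1) * n ^ 2 ≤ 16 * 16 ^ c * (5 * (c + 1)) * n ^ 2 := by
          gcongr
          omega
      _ = _ := by ring
  have h7 : c + 1 ≤ (c + 1) * n ^ 2 := Nat.le_mul_of_pos_right _ (by positivity)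
  have h8 : (c + 1) * n ≤ (c + 1) * n ^ 2 := Nat.mul_le_mul_left _ h4
  have h9 : 200 * (c + 2) * n ≤ 400 * ((c + 1) * n ^ 2) := by nlinarith
  have h10 : 300 * (c + 2) * (len + 1) ≤ 1200 * ((c + 1) * n ^ 2) := by
    calc 300 * (c + 2) * (len + 1) ≤ 300 * (2 * (c + 1)) * (2 * n) := by
          gcongr <;> omega
      _ = 1200 * ((c + 1) * n) := by ring
      _ ≤ _ := by omega
  omega

theorem runs_confirmProg (hG : G.Connected) (hn : 0 < n) (hM : Guess G k c x ord len u v M)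
    (he : M.arr 7 = e) (hlen : len ≤ n) :
    Runs confirmProg M (40000 * (16 ^ c * (c + 1) * n ^ 2)) fun M' =>
      (Confirmed n (distFn G) k c x e ord len u v → M'.reg 26 = 1) ∧
      (¬ Confirmed n (distFn G) k c x e ord len u v → M'.reg 26 = M.reg 26) := by
  set N := numReq (distFn G) k (c + 2) x e ord len with hN
  -- The table is built only if N ≤ 4c + 4, where N' = N; the minimum gives one time bound for all
  -- branches, including rejected guesses with large N.
  set N' := min N (4 * c + 4) with hN'
  refine Runs.time (Runs.seq (runs_levelProg hM he) (t₂ := 4 + (200 * (c + 2) * n + 10 +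
    (300 * (c + 2) * (len + 1) + (12 + (400 * (2 ^ N' * (N' + 1) * n ^ 2) + (N' * 19 + 14 + 7))))))
    fun M₁ h1 hF₁ => ?_) (le_trans ?_ (confirmProg_time (N := N') hn (min_le_right _ _) hlen))
  · have hM₁ := hM.of_frame hF₁
    refine Runs.ite (fun h => ?_) fun h => ?_
    · have h2 : M₁.reg 28 < c + 2 := by simpa [hM₁.m_eq] using h
      exact Runs.time (Runs.skip ⟨fun h' => absurd h'.1 (h1.1 h2), fun _ => hF₁.reg 26 rfl⟩)
        (by omega)
    · have h2 : ¬ M₁.reg 28 < c + 2 := by simpa [hM₁.m_eq] using h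
      have hlev := not_not.1 (fun h' => h2 (h1.2 h'))
      have he₁ := (hF₁.arr 7 rfl).trans he
      refine Runs.seq (runs_allowedProg hM₁ he₁) fun M₂ hal hF₂ => ?_
      have hM₂ := hM₁.of_frame hF₂
      refine Runs.seq (runs_reqProg hM₂ ((hF₂.arr 7 rfl).trans he₁)) fun M₃ hreq hF₃ => ?_
      have hM₃ := hM₂.of_frame hF₃
      have h26₃ : M₃.reg 26 = M.reg 26 :=
        (hF₃.reg 26 rfl).trans ((hF₂.reg 26 rfl).trans (hF₁.reg 26 rfl))
      refine Runs.time (Runs.ite (t := 400 * (2 ^ N' * (N' + 1) * n ^ 2) + (N' * 19 + 14 + 7))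
        (fun h => ?_) fun h => ?_) (by simp)
      · have h3 : c + 2 + (c + 2) + (c + 2 + (c + 2)) - 4 < N := by
          simpa [hM₃.m_eq, hreq.card] using h
        refine Runs.time (Runs.skip ⟨fun h' => ?_, fun _ => h26₃⟩) (by omega)
        have := h'.2.1
        omega
      · have h3 : N ≤ c + 2 + (c + 2) + (c + 2 + (c + 2)) - 4 := by
          simpa [hM₃.m_eq, hreq.card] using h
        have hNN : N' = N := min_eq_left (by omega)
        rw [hNN]
        have hT : Task G k c x ord len u v (Allowed (distFn G) (c + 2) x e u) N (M₃.arr 10)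
            (M₃.arr 11) M₃ := by
          refine ⟨hM₃, ?_, rfl, rfl, hreq.card, ?_⟩
          · rw [hF₃.arr 9 rfl]
            exact hal
          -- The list is known only through the predicates it satisfies; the predicate "is a vertex"
          -- bounds its entries.
          · exact (hreq.all fun w _ => w < n).2 ⟨fun j hj _ => hM.x_lt j hj,
              fun i hi _ => hM.ord_lt i hi⟩
        refine Runs.seq (runs_tableProg hG hn hT) fun M₄ htab hF₄ => ?_
        have hT₄ := hT.of_frame hF₄
        refine Runs.seq (t₁ := N * 19 + 14) (t₂ := 7) (runs_subsetProg (s := fun _ => 1) hT₄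
          (fun _ _ => by omega) fun _ _ _ _ _ => by simp) fun M₅ h5 hF₅ => ?_
        have hT₅ := hT₄.of_frame hF₅
        have hg : ofDig 2 (fun _ => 1) N < 2 ^ N := ofDig_lt fun _ _ => by omega
        have hent := htab v hM.v_lt _ hg
        have hiff : M₅.arr 13 (M₅.reg 37 + M₅.reg 25) ≠ 0 ↔
            Confirmed n (distFn G) k c x e ord len u v := by
          rw [h5, hT₅.guess.v_eq, hF₅.arr 13 rfl]
          refine hent.trans ?_
          have hle : N ≤ 4 * c + 4 := by omega
          unfold Confirmed Reach
          rw [and_iff_right hlev, ← hN, and_iff_right hle]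
          refine exists_congr fun f => and_congr_right fun _ => and_congr_right fun _ =>
            and_congr_right fun _ => and_congr_right fun _ => ?_
          rw [← hreq.all fun w r => ∃ t ≤ distFn G u v, distFn G w (f t) ≤ r]
          refine forall₂_congr fun j hj => ?_
          simp [dig_ofDig (b := 2) (m := N) (s := fun _ => 1) (by omega) (fun _ _ => by omega) j hj]
        have h26₅ : M₅.reg 26 = M.reg 26 :=
          (hF₅.reg 26 rfl).trans ((hF₄.reg 26 rfl).trans h26₃)
        refine Runs.time (Runs.ite (t := 2) (fun h => ?_) fun h => ?_) (by simp)
        · have h : M₅.arr 13 (M₅.reg 37 + M₅.reg 25) ≠ 0 := h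
          exact Runs.assign ⟨fun _ => by simp, fun h' => absurd (hiff.1 h) h'⟩
        · have h : M₅.arr 13 (M₅.reg 37 + M₅.reg 25) = 0 := h
          exact Runs.time (Runs.skip ⟨fun h' => absurd h (hiff.2 h'), fun _ => h26₅⟩) (by omega)
  · omega

/-- Check the distances in array `15`. -/
def checkProg : Prog :=
  .forLoop 27 (.reg 7) (.put 7 (.reg 27) (.get 15 (.reg 27))) ;; .put 7 (.reg 7) (.lit 0) ;;
    .put 7 (.add (.reg 7) (.lit 1)) (.lit 0) ;; confirmProg

theorem runs_checkProg (hG : G.Connected) (hn : 0 < n) (hM : Guess G k c x ord len u v M)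
    (hlen : len ≤ n) :
    Runs checkProg M (40100 * (16 ^ c * (c + 1) * n ^ 2)) fun M' =>
      ∃ e, (∀ j < c, e j = M.arr 15 j) ∧ e c = 0 ∧ e (c + 1) = 0 ∧
      (Confirmed n (distFn G) k c x e ord len u v → M'.reg 26 = 1) ∧
      (¬ Confirmed n (distFn G) k c x e ord len u v → M'.reg 26 = M.reg 26) := by
  refine Runs.time (Runs.seq (Runs.forLoop (n := c) (tb := 4)
    (fun i M' => ∀ j < i, M'.arr 7 j = M.arr 15 j) rfl ?_ (by simp) ?_)
    (t₂ := 8 + 40000 * (16 ^ c * (c + 1) * n ^ 2)) fun M₁ h1 hF₁ => ?_) ?_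
  · exact fun M' hF => (hM.of_frame hF).c_eq
  · intro i hi M' hF hMi hI
    refine Runs.put ?_
    intro j hj
    simp only [Memory.setReg_arr, Memory.setArr_arr_self, Expr.eval_reg, Expr.eval_get, hMi,
      Function.update_apply, hF.arr 15 rfl]
    split_ifs with h
    · rw [h]
    · exact hI j (by omega)
  · have hM₁ := hM.of_frame hF₁
    have h7 := hM₁.c_eq
    refine Runs.time (Runs.put_seq (Runs.put_seq (Runs.mono (runs_confirmProg hG hn
      (hM₁.congr (by simp) (by simp [Memory.setArr_arr])) rfl hlen) le_rfl fun M' h => ?_)))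
      (by simp; omega)
    refine ⟨_, fun j hj => ?_, ?_, ?_, h.1, fun h' => (h.2 h').trans ?_⟩
    · simp [h7, Function.update_apply]
      rw [if_neg (by omega), if_neg (by omega)]
      exact h1.1 j hj
    · simp [h7]
    · simp [h7]
    · simpa using hF₁.reg 26 rfl
  · have h1 : 1 ≤ 16 ^ c := Nat.one_le_pow _ _ (by omega)
    have h2 : 1 ≤ n ^ 2 := Nat.one_le_pow _ _ hn
    have h5 : c + 1 ≤ 16 ^ c * (c + 1) * n ^ 2 := by
      calc c + 1 = 1 * (c + 1) * 1 := by ring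
        _ ≤ _ := by gcongr
    simp only [Expr.cost_reg]
    omega

/-- No distances from the removed vertices are confirmed for `u` and `v`. -/
def Refuted (G : SimpleGraph (Fin n)) (k c : ℕ) (C ord : ℕ → ℕ) (len u v : ℕ) : Prop :=
  ¬ distFn G u v + 1 = n ∧ (0 < k → ∀ e₀ : ℕ → ℕ, (∀ j < c, e₀ j ≤ k) → ∃ x e : ℕ → ℕ,
    (∀ j < c, x j = C j) ∧ x c = u ∧ x (c + 1) = v ∧ (∀ j < c, e j = e₀ j) ∧ e c = 0 ∧
    e (c + 1) = 0 ∧ ¬ Confirmed n (distFn G) k c x e ord len u v)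

/-- The answer in register `26` is justified if it is positive, and `Ψ` holds otherwise. -/
structure Answer (G : SimpleGraph (Fin n)) (k : ℕ) (Ψ : Prop) (M : Memory) : Prop where
  le : M.reg 26 ≤ 1
  pos : M.reg 26 ≠ 0 → HasGeodesic n (distFn G) k
  neg : M.reg 26 = 0 → Ψ

theorem Answer.congr {Ψ Ψ' : Prop} {M' : Memory} (h : Answer G k Ψ M)
    (h26 : M'.reg 26 = M.reg 26) (hΨ : Ψ → Ψ') : Answer G k Ψ' M' :=
  ⟨by rw [h26]; exact h.le, by rw [h26]; exact h.pos, fun h' => hΨ (h.neg (by rw [← h26, h']))⟩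

/-- Check all guesses for the endpoints in the registers `24` and `25`. -/
def pairProg : Prog :=
  .ite (.eq (.add (distE (.reg 24) (.reg 25)) (.lit 1)) (.reg 0)) (.assign 26 (.lit 1)) .skip ;;
    .ite (.reg 1)
      (.put 4 (.reg 7) (.reg 24) ;; .put 4 (.add (.reg 7) (.lit 1)) (.reg 25) ;;
        .enum 15 41 42 (.add (.reg 1) (.lit 1)) (.reg 7) checkProg) .skip

/-- The removed vertices and the layout are stored in memory. -/
structure Base (G : SimpleGraph (Fin n)) (k c : ℕ) (C ord : ℕ → ℕ) (len : ℕ) (M : Memory) :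
    Prop where
  ready : Ready G k M
  c_eq : M.reg 7 = c
  m_eq : M.reg 29 = c + 2
  C_eq : ∀ j < c, M.arr 4 j = C j
  ord_eq : M.arr 5 = ord
  len_eq : M.reg 8 = len
  C_lt : ∀ j < c, C j < n
  cover : ∀ a < n, (∃ j < c, C j = a) ∨ ∃ i < len, ord i = a
  lay : Layout n (distFn G) ord len

theorem Base.congr {M' : Memory} (h : Base G k c C ord len M)
    (hr : ∀ r ∈ [0, 1, 7, 8, 29], M'.reg r = M.reg r)
    (ha : ∀ a ∈ [0, 1, 2, 5], M'.arr a = M.arr a) (h4 : ∀ j < c, M'.arr 4 j = M.arr 4 j) :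
    Base G k c C ord len M' :=
  ⟨h.ready.congr (hr 0 (by simp)) (hr 1 (by simp)) (ha 0 (by simp)) (ha 1 (by simp))
    (ha 2 (by simp)), (hr 7 (by simp)).trans h.c_eq, (hr 29 (by simp)).trans h.m_eq,
    fun j hj => (h4 j hj).trans (h.C_eq j hj), (ha 5 (by simp)).trans h.ord_eq,
    (hr 8 (by simp)).trans h.len_eq, h.C_lt, h.cover, h.lay⟩

theorem Layout.len_le {D : ℕ → ℕ → ℕ} (h : Layout n D ord len) : len ≤ n := by
  have := Finset.card_le_card_of_injOn (s := Finset.range len) (t := Finset.range n) ord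
    (fun i hi => by simpa using h.lt i (by simpa using hi))
    fun i hi j hj hij => h.inj i (by simpa using hi) j (by simpa using hj) hij
  simpa using this

theorem runs_pairProg {Ψ : Prop} (hG : G.Connected) (hn : 0 < n) (hM : Base G k c C ord len M)
    (h24 : M.reg 24 = u) (h25 : M.reg 25 = v) (hu : u < n) (hv : v < n) (hA : Answer G k Ψ M) :
    Runs pairProg M (40300 * ((k + 1) ^ c * (16 ^ c * (c + 1) * n ^ 2))) fun M' =>
      Answer G k (Ψ ∧ Refuted G k c C ord len u v) M' ∧ ∀ j < c, M'.arr 4 j = M.arr 4 j := by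
  have hGM := graphMetric_distFn hG
  refine Runs.time (Runs.seq (Q := fun M' => Answer G k (Ψ ∧ ¬ distFn G u v + 1 = n) M')
    (Runs.ite (t := 2) (fun h => ?_) fun h => ?_) (t₂ := 12 + ((k + 1) ^ c *
      ((40100 * (16 ^ c * (c + 1) * n ^ 2)) + (c + 1) * (3 + 1 + 40)) + (c + 1) * (1 + 40)))
    fun M₁ h1 hF₁ => ?_) ?_
  · have h' : distFn G u v + 1 = n := by
      by_contra h'
      refine h ?_
      rw [Expr.eq_eq_zero]
      simpa [h24, h25, hM.ready.dist u hu v hv, hM.ready.n_eq] using h'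
    exact Runs.assign ⟨by simp, fun _ => hasGeodesic_of_dist_add_one hGM hu hv h', by simp⟩
  · rw [Expr.eq_eq_zero] at h
    refine Runs.time (Runs.skip (hA.congr rfl fun h' => ⟨h', ?_⟩)) (by omega)
    simpa [h24, h25, hM.ready.dist u hu v hv, hM.ready.n_eq] using h
  · have hM₁ : Base G k c C ord len M₁ :=
      hM.congr (fun r hr => hF₁.reg r (by revert r; decide)) (fun a ha => hF₁.arr a rfl)
        fun j _ => by rw [hF₁.arr 4 rfl]
    have h24₁ := (hF₁.reg 24 rfl).trans h24
    have h25₁ := (hF₁.reg 25 rfl).trans h25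
    refine Runs.time (Runs.ite (t := 9 + ((k + 1) ^ c *
      ((40100 * (16 ^ c * (c + 1) * n ^ 2)) + (c + 1) * (3 + 1 + 40)) + (c + 1) * (1 + 40)))
      (fun h => ?_) fun h => ?_) (by simp; omega)
    · have hk : 0 < k := by
        have h : M₁.reg 1 ≠ 0 := h
        rw [hM₁.ready.k_eq] at h
        omega
      refine Runs.time (Runs.put_seq (Runs.put_seq (t := (k + 1) ^ c *
        ((40100 * (16 ^ c * (c + 1) * n ^ 2)) + (c + 1) * (3 + 1 + 40)) + (c + 1) * (1 + 40)) ?_))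
        (by simp; omega)
      set M₂ := (M₁.setArr 4 ((Expr.reg 7).eval M₁) ((Expr.reg 24).eval M₁)).setArr 4
        ((Expr.add (.reg 7) (.lit 1)).eval
          (M₁.setArr 4 ((Expr.reg 7).eval M₁) ((Expr.reg 24).eval M₁)))
        ((Expr.reg 25).eval (M₁.setArr 4 ((Expr.reg 7).eval M₁) ((Expr.reg 24).eval M₁))) with hM₂
      have hx : M₂.arr 4 = Function.update (Function.update (M₁.arr 4) c u) (c + 1) v := by
        simp [hM₂, hM₁.c_eq, h24₁, h25₁]
      have hr₂ : M₂.reg = M₁.reg := rfl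
      have ha₂ : ∀ a, a ≠ 4 → M₂.arr a = M₁.arr a := by
        intro a ha
        simp [hM₂, ha]
      have hxC : ∀ j < c, M₂.arr 4 j = C j := by
        intro j hj
        rw [hx, Function.update_of_ne (by omega), Function.update_of_ne (by omega), hM₁.C_eq j hj]
      have hxu : M₂.arr 4 c = u := by
        rw [hx, Function.update_of_ne (by omega), Function.update_self]
      have hxv : M₂.arr 4 (c + 1) = v := by
        rw [hx, Function.update_self]
      have hGu : Guess G k c (M₂.arr 4) ord len u v M₂ := by
        refine ⟨hM₁.ready.congr rfl rfl (ha₂ 0 (by decide)) (ha₂ 1 (by decide))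
          (ha₂ 2 (by decide)), hM₁.c_eq, hM₁.m_eq, rfl, (ha₂ 5 (by decide)).trans hM₁.ord_eq,
          hM₁.len_eq, h24₁, h25₁, hu, hv, fun j hj => ?_, hM.lay.lt⟩
        rcases (by omega : j < c ∨ j = c ∨ j = c + 1) with h' | rfl | rfl
        · rw [hxC j h']
          exact hM.C_lt j h'
        · rwa [hxu]
        · rwa [hxv]
      refine Runs.post (Runs.time (Runs.enum (bv := k + 1) (cv := c)
        (tb := 40100 * (16 ^ c * (c + 1) * n ^ 2))
        (fun g M' => Answer G k ((Ψ ∧ ¬ distFn G u v + 1 = n) ∧ ∀ g' < g, ∃ e : ℕ → ℕ,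
          (∀ j < c, e j = dig (k + 1) g' j) ∧ e c = 0 ∧ e (c + 1) = 0 ∧
            ¬ Confirmed n (distFn G) k c (M₂.arr 4) e ord len u v) M') (by decide) rfl (by omega)
        ?_ ?_ ?_ ?_ ?_) (by simp)) ?_
      · intro M' hF
        simp [(hGu.of_frame hF).ready.k_eq]
      · exact fun M' hF => (hGu.of_frame hF).c_eq
      · exact fun g M₃ M₄ h' hr _ => h'.congr (hr 26 (by decide) (by decide)) id
      · exact h1.congr rfl fun h' => ⟨h', by simp⟩
      · intro g hg M₃ hF₃ hdig hI
        have hM₃ := hGu.of_frame hF₃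
        refine Runs.mono (runs_checkProg hG hn hM₃ hM.lay.len_le) le_rfl ?_
        rintro M₄ ⟨e, he, hec, hec', hyes, hno⟩
        by_cases hconf : Confirmed n (distFn G) k c (M₂.arr 4) e ord len u v
        · refine ⟨(hyes hconf).le, fun _ => ?_, fun h' => absurd (hyes hconf) (by omega)⟩
          refine hasGeodesic_of_confirmed hGM hM.lay (fun a ha hs => ?_) hGu.x_lt hxu hxv hk
            (fun j hj => ?_) hconf
          · refine (hM.cover a ha).resolve_left ?_
            rintro ⟨j, hj, h'⟩
            exact hs ⟨j, by omega, (hxC j hj).trans h'⟩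
          · rcases (by omega : j < c ∨ j = c ∨ j = c + 1) with h' | rfl | rfl
            · have := dig_lt (b := k + 1) (by omega) g j
              rw [he j h', hdig j h']
              omega
            · omega
            · omega
        · refine hI.congr (hno hconf) fun h' => ⟨h'.1, fun g' hg' => ?_⟩
          rcases Nat.lt_succ_iff_lt_or_eq.1 hg' with h3 | rfl
          · exact h'.2 g' h3
          · exact ⟨e, fun j hj => by rw [he j hj, hdig j hj], hec, hec', hconf⟩
      · intro M' h' hF
        refine ⟨h'.congr rfl fun h3 => ⟨h3.1.1, h3.1.2, fun _ e₀ he₀ => ?_⟩, fun j hj => ?_⟩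
        · have h4 : ∀ j < c, e₀ j < k + 1 := fun j hj => Nat.lt_succ_of_le (he₀ j hj)
          -- The arbitrary guess e₀ is the digit string with number `ofDig (k + 1) e₀ c`, so it has
          -- been tried.
          obtain ⟨e, he, hec, hec', hno⟩ := h3.2 _ (ofDig_lt h4)
          exact ⟨M₂.arr 4, e, hxC, hxu, hxv,
            fun j hj => by rw [he j hj, dig_ofDig (by omega) h4 j hj], hec, hec', hno⟩
        · rw [hF.arr 4 rfl, hxC j hj, hM.C_eq j hj]
    · have hk : k = 0 := by
        have h : M₁.reg 1 = 0 := h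
        rwa [hM₁.ready.k_eq] at h
      exact Runs.time (Runs.skip ⟨h1.congr rfl fun h' => ⟨h'.1, h'.2, fun h3 => by omega⟩,
        fun j _ => by rw [hF₁.arr 4 rfl]⟩) (by omega)
  · have h1 : 1 ≤ 16 ^ c := Nat.one_le_pow _ _ (by omega)
    have h2 : 1 ≤ n ^ 2 := Nat.one_le_pow _ _ hn
    have h3 : 1 ≤ (k + 1) ^ c := Nat.one_le_pow _ _ (by omega)
    have h5 : c + 1 ≤ 16 ^ c * (c + 1) * n ^ 2 := by
      calc c + 1 = 1 * (c + 1) * 1 := by ring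
        _ ≤ _ := by gcongr
    generalize 16 ^ c * (c + 1) * n ^ 2 = T at h5 ⊢
    have h6 : T ≤ (k + 1) ^ c * T := Nat.le_mul_of_pos_left _ (by positivity)
    have h7 : (k + 1) ^ c * (40100 * T + (c + 1) * (3 + 1 + 40)) ≤
        (k + 1) ^ c * (40144 * T) := by
      gcongr
      omega
    have h8 : (k + 1) ^ c * (40144 * T) = 40144 * ((k + 1) ^ c * T) := by ring
    simp only [Expr.cost_eq, Expr.cost_add, cost_distE, Expr.cost_reg, Expr.cost_lit]
    omega

/-- Check all pairs of endpoints. -/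
def mainProg : Prog :=
  .assign 26 (.lit 0) ;; .assign 29 (.add (.reg 7) (.lit 2)) ;;
    .forLoop 24 (.reg 0) (.forLoop 25 (.reg 0) pairProg) ;; .assign 0 (.reg 26)

theorem runs_mainProg (hG : G.Connected) (hn : 0 < n) (hM : Ready G k M) (hf : Found G M)
    (hc : M.reg 7 = c) :
    Runs mainProg M (40400 * ((k + 1) ^ c * (16 ^ c * (c + 1) * n ^ 4))) fun M' =>
      (HasGeodesic n (distFn G) k → M'.reg 0 = 1) ∧
      (¬ HasGeodesic n (distFn G) k → M'.reg 0 = 0) := by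
  have hGM := graphMetric_distFn hG
  set T := 40300 * ((k + 1) ^ c * (16 ^ c * (c + 1) * n ^ 2)) with hT
  have hM₀ : Base G k c (M.arr 4) (M.arr 5) (M.reg 8) ((M.setReg 26 0).setReg 29 (c + 2)) :=
    ⟨hM.congr (by simp) (by simp) rfl rfl rfl, by simpa using hc, by simp, fun _ _ => rfl, rfl,
      by simp, hc ▸ hf.C_lt, hc ▸ hf.cover, hf.lay⟩
  have hset : (M.setReg 26 ((Expr.lit 0).eval M)).setReg 29 ((Expr.add (.reg 7) (.lit 2)).eval
      (M.setReg 26 ((Expr.lit 0).eval M))) = (M.setReg 26 0).setReg 29 (c + 2) := by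
    simp [hc]
  refine Runs.time (Runs.assign_seq (Runs.assign_seq (t := n * ((n * (T + 1 + 8) + 7) + 1 + 8) + 7 +
    2) ?_)) ?_
  · rw [hset]
    set M₀ := (M.setReg 26 0).setReg 29 (c + 2) with hM₀'
    have hbase : ∀ M', (∀ r ∈ [0, 1, 7, 8, 29], M'.reg r = M₀.reg r) →
        (∀ a ∈ [0, 1, 2, 5], M'.arr a = M₀.arr a) → (∀ j < c, M'.arr 4 j = M.arr 4 j) →
        Base G k c (M.arr 4) (M.arr 5) (M.reg 8) M' :=
      fun M' h1 h2 h3 => hM₀.congr h1 h2 h3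
    refine Runs.seq (Runs.forLoop (n := n) (tb := n * (T + 1 + 8) + 7)
      (fun u M' => Answer G k (∀ u' < u, ∀ v' < n,
        Refuted G k c (M.arr 4) (M.arr 5) (M.reg 8) u' v') M' ∧ ∀ j < c, M'.arr 4 j = M.arr 4 j)
        rfl ?_ ?_ ?_) fun M₁ h1 hF₁ => Runs.assign ?_
    · intro M' hF
      simp [hF.reg 0 rfl, hM₀', hM.n_eq]
    · exact ⟨⟨by simp [hM₀'], by simp [hM₀'], by simp⟩, fun _ _ => rfl⟩
    · rintro u hu M₁ hF₁ hMu ⟨hA, h4⟩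
      refine Runs.mono (Runs.forLoop (n := n) (tb := T)
        (fun v M' => Answer G k ((∀ u' < u, ∀ v' < n,
          Refuted G k c (M.arr 4) (M.arr 5) (M.reg 8) u' v') ∧ ∀ v' < v,
          Refuted G k c (M.arr 4) (M.arr 5) (M.reg 8) u v') M' ∧ ∀ j < c, M'.arr 4 j = M.arr 4 j)
          rfl ?_ ?_ ?_) le_rfl ?_
      · intro M' hF
        simp [hF.reg 0 rfl, hF₁.reg 0 rfl, hM₀', hM.n_eq]
      · exact ⟨hA.congr (by simp) fun h => ⟨h, by simp⟩, h4⟩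
      · rintro v hv M₂ hF₂ hMv ⟨hA₂, h4₂⟩
        have hB : Base G k c (M.arr 4) (M.arr 5) (M.reg 8) M₂ := by
          refine hbase M₂ (fun r hr => (hF₂.reg r ?_).trans (hF₁.reg r ?_))
            (fun a ha => (hF₂.arr a ?_).trans (hF₁.arr a ?_)) h4₂
          · revert r; decide
          · revert r; decide
          · revert a; decide
          · revert a; decide
        refine Runs.mono (runs_pairProg hG hn hB ((hF₂.reg 24 rfl).trans hMu) hMv hu hv hA₂)
          le_rfl ?_
        rintro M₃ ⟨hA₃, h4₃⟩
        refine ⟨hA₃.congr (by simp) fun h => ⟨h.1.1, fun v' hv' => ?_⟩,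
          fun j hj => (h4₃ j hj).trans (h4₂ j hj)⟩
        rcases Nat.lt_succ_iff_lt_or_eq.1 hv' with h3 | rfl
        exacts [h.1.2 v' h3, h.2]
      · rintro M₂ ⟨⟨hA₂, h4₂⟩, -⟩
        refine ⟨hA₂.congr (by simp) fun h u' hu' => ?_, h4₂⟩
        rcases Nat.lt_succ_iff_lt_or_eq.1 hu' with h3 | rfl
        exacts [h.1 u' h3, h.2]
    · obtain ⟨⟨hA, -⟩, -⟩ := h1
      refine ⟨fun h => ?_, fun h => ?_⟩
      · simp only [Expr.eval_reg, Memory.setReg_reg, if_true]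
        by_contra h26
        have hle := hA.le
        have href := hA.neg (by omega)
        rcases Nat.eq_zero_or_pos k with rfl | hk
        · obtain ⟨u, hu, v, hv, h'⟩ := exists_dist_add_one hGM h
          exact (href u hu v hv).1 h'
        · obtain ⟨u, hu, v, hv, e₀, he₀, h'⟩ := exists_confirmed hGM hM₀.lay
            (fun a ha hn => (hM₀.cover a ha).resolve_left fun ⟨j, hj, h3⟩ => hn j hj h3)
            hM₀.C_lt hk h
          obtain ⟨x, e, h1, h2, h3, h4, h5, h6, h7⟩ := (href u hu v hv).2 hk e₀ he₀
          exact h7 (h' x e h1 h2 h3 h4 h5 h6)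
      · simp only [Expr.eval_reg, Memory.setReg_reg, if_true]
        by_contra h26
        exact h (hA.pos h26)
  · have h1 : 1 ≤ (k + 1) ^ c * (16 ^ c * (c + 1)) := Nat.one_le_iff_ne_zero.2 (by positivity)
    have hTn : n ^ 2 * T = 40300 * ((k + 1) ^ c * (16 ^ c * (c + 1) * n ^ 4)) := by
      rw [hT]
      ring
    have h2 : (k + 1) ^ c * (16 ^ c * (c + 1) * n ^ 4) =
      (k + 1) ^ c * (16 ^ c * (c + 1)) * n ^ 4 := by ring
    have h3 : n ^ 4 ≤ (k + 1) ^ c * (16 ^ c * (c + 1)) * n ^ 4 := Nat.le_mul_of_pos_left _ h1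
    have h4 : n ^ 2 ≤ n ^ 4 := Nat.pow_le_pow_right hn (by omega)
    have h5 : n ≤ n ^ 4 := Nat.le_self_pow (by omega) n
    have h6 : n * (n * (T + 1 + 8) + 7 + 1 + 8) = n ^ 2 * T + 9 * n ^ 2 + 16 * n := by ring
    simp only [Expr.cost_lit, Expr.cost_add, Expr.cost_reg]
    omega

end MESP

/-! ### The complete algorithm and its running time -/

open RAM MESP in
theorem mainTheorem4 :
    ∃ (A : RAM.Prog) (B : ℕ), ∀ (n k : ℕ) (G : SimpleGraph (Fin n)), G.Connected →
      ∃ (t : ℕ) (M : RAM.Memory), RAM.Exec A (MESP.input G k) t M ∧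
        (MESP.IsYes G k → M.reg 0 = 1) ∧ (¬ MESP.IsYes G k → M.reg 0 = 0) ∧
        t ≤ B * (2 ^ (5 * MESP.distToDisjointPaths G) *
          (max k 1) ^ MESP.distToDisjointPaths G * max (MESP.distToDisjointPaths G) 1 * n ^ 4) := by
  refine ⟨(rowProg ;; distProg) ;; searchProg ;; mainProg, 100000, fun n k G hG => ?_⟩
  have hn : 0 < n := by
    obtain ⟨i⟩ := hG.nonempty
    exact i.pos
  set c := distToDisjointPaths G with hc
  set K := max k 1 with hK
  set m := max c 1 with hm
  have h1 : n ^ 3 ≤ n ^ 4 := Nat.pow_le_pow_right hn (by omega)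
  have h32 : 2 ^ (5 * c) = 2 ^ c * 16 ^ c := by
    rw [pow_mul, ← mul_pow]
    norm_num
  have h3 : 16 ^ c ≤ 2 ^ (5 * c) := by
    rw [h32]
    exact Nat.le_mul_of_pos_left _ (by positivity)
  have h4 : 1 ≤ K ^ c := Nat.one_le_pow _ _ (by omega)
  have h5 : 1 ≤ m := by omega
  -- From k + 1 ≤ 2 max(k, 1). This 2 ^ c, together with 16 ^ c, makes up 2 ^ (5c).
  have h6 : (k + 1) ^ c ≤ 2 ^ c * K ^ c := by
    rw [← mul_pow]
    exact Nat.pow_le_pow_left (by omega) c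
  have h7 : 16 ^ c * n ^ 3 ≤ 2 ^ (5 * c) * K ^ c * m * n ^ 4 := by
    calc 16 ^ c * n ^ 3 = 16 ^ c * 1 * 1 * n ^ 3 := by ring
      _ ≤ _ := by gcongr
  have h8 : n ^ 4 ≤ 2 ^ (5 * c) * K ^ c * m * n ^ 4 :=
    Nat.le_mul_of_pos_left _ (by positivity)
  have h9 : ∀ d ≤ c, (k + 1) ^ d * (16 ^ d * (d + 1) * n ^ 4) ≤
      2 * (2 ^ (5 * c) * K ^ c * m * n ^ 4) := by
    intro d hd
    calc (k + 1) ^ d * (16 ^ d * (d + 1) * n ^ 4)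
        ≤ (k + 1) ^ c * (16 ^ c * (2 * m) * n ^ 4) := by
          gcongr
          · omega
          · omega
          · omega
      _ ≤ 2 ^ c * K ^ c * (16 ^ c * (2 * m) * n ^ 4) := by gcongr
      _ = 2 * (2 ^ (5 * c) * K ^ c * m * n ^ 4) := by
          rw [h32]
          ring
  have key : Runs ((rowProg ;; distProg) ;; searchProg ;; mainProg) (input G k)
      (100000 * (2 ^ (5 * c) * K ^ c * m * n ^ 4)) fun M =>
        (IsYes G k → M.reg 0 = 1) ∧ (¬ IsYes G k → M.reg 0 = 0) := by
    rw [isYes_iff_hasGeodesic hG]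
    refine Runs.time (Runs.seq (runs_prepare hG) (t₂ := 90000 * (2 ^ (5 * c) * K ^ c * m * n ^ 4))
      fun M₁ h hF₁ => Runs.time (Runs.seq (runs_searchProg hG hn h)
        (t₂ := 80800 * (2 ^ (5 * c) * K ^ c * m * n ^ 4)) fun M₂ h' hF₂ => ?_) ?_) ?_
    · refine Runs.time (runs_mainProg hG hn (h.of_frame hF₂) h'.1 rfl) ?_
      have := h9 _ h'.2
      omega
    · rw [← hc]
      omega
    · omega
  obtain ⟨t, ht, M, hE, hy, hno⟩ := key
  exact ⟨t, M, hE, hy, hno, ht⟩
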